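/- Let $d\in(0,\pi)$ and $H\in\mathbb{C}$ be fixed. For a complex-valued $q\in L^1[0,\pi]$, $h,\gamma\in\mathbb{C}$ and $\beta>0$, let $B=B(q,h,H,\beta,\gamma,d)$ be the boundary value problem $$-y''+q(x)y=\lambda y\ \text{ on }(0,\pi),\qquad y'(0)-hy(0)=0,\qquad y'(\pi)+Hy(\pi)=0,$$ $$y(d+0)=\beta y(d-0),\qquad y'(d+0)=\beta^{-1}y'(d-0)+\gamma y(d-0),$$ and let $B^\infty$ be the same problem with the condition at $\pi$ replaced by $y(\pi)=0$. Let $\varphi(x,\lambda)$ be the solution of the equation and of the conditions at $d$ with $\varphi(0,\lambda)=1$, $\varphi'(0,\lambda)=h$. The algebraic multiplicity of an eigenvalue of $B$ (of $B^\infty$) is its order as a zero of $\Delta(\lambda)=\varphi'(\pi,\lambda)+H\varphi(\pi,\lambda)$ (of $\Delta^\infty(\lambda)=-\varphi(\pi,\lambda)$). Let $\{\lambda_n\}_{n\ge 0}$ and $\{\lambda_n^\infty\}_{n\ge 0}$ be the sequences of all eigenvalues of $B$ and $B^\infty$, repeated according to algebraic multiplicity, in order of increasing moduli, with identical eigenvalues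 adjacent. Let $m\ge -1$ be an integer, and let $\widetilde B,\widetilde B^\infty$ be the problems with coefficients $\widetilde q,\widetilde h,\widetilde\beta,\widetilde\gamma$ and the same $H$ and $d$, with eigenvalues $\{\widetilde\lambda_n\}$, $\{\widetilde\lambda_n^\infty\}$. Suppose that $q$ and $\widetilde q$ are $C^m$ near $\pi$, that is, on $[\pi-\delta,\pi]$ for some $\delta>0$ (no condition if $m=-1$), and that $q^{(j)}(\pi)=\widetilde q^{(j)}(\pi)$ for $j=0,1,\ldots,m$ (left derivatives). Let $\Lambda_1,\Lambda_1^\infty\subset\mathbb{N}_0$ be finite sets with $$\#\Lambda_1+\#\Lambda_1^\infty=\left[\tfrac{m+2}{2}\right],$$ and suppose that $\{\lambda_n\}_{n\in\mathbb{N}_0\setminus\Lambda_1}$ is, up to order and counting repetitions, also a subsequence of $\{\widetilde\lambda_n\}$ (for instance $\lambda_n=\widetilde\lambda_n$ for all $n\notin\Lambda_1$), and that $\{\lambda_n^\infty\}_{n\in\mathbb{N}_0\setminus\Lambda_1^\infty}$ is likewise a subsequence of $\{\widetilde\lambda_n^\infty\}$. Then $h=\widetilde h$, $\beta=\widetilde\beta$,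 $\gamma=\widetilde\gamma$ and $q=\widetilde q$ a.e. on $[0,\pi]$. -/

import Mathlib

namespace SturmLiouville

open MeasureTheory Set

/-- `y`, with derivative `y'`, is a (Caratheodory) solution of `-y'' + q y = z y` on `[a, b]`, in
integrated form: `y` and `y'` are absolutely continuous and `y'' = (q - z) y` almost everywhere. -/
structure IsSolutionOn (q : ℝ → ℂ) (z : ℂ) (a b : ℝ) (y y' : ℝ → ℂ) : Prop where
  continuousOn : ContinuousOn y (Icc a b)
  continuousOn' : ContinuousOn y' (Icc a b)
  eq_integral : ∀ x ∈ Icc a b, y x = y a + ∫ t in a..x, y' t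
  eq_integral' : ∀ x ∈ Icc a b, y' x = y' a + ∫ t in a..x, (q t - z) * y t

/-- `∫ g Gⁿ = Gⁿ⁺¹ / (n + 1)` for a primitive `G` of the integrable function `g`. -/
theorem integral_mul_primitive_pow {g : ℝ → ℝ} {a b : ℝ} (hg : IntervalIntegrable g volume a b)
    (n : ℕ) : ∫ t in a..b, g t * (∫ s in a..t, g s) ^ n
      = (∫ s in a..b, g s) ^ (n + 1) / (n + 1) := by
  set G : ℝ → ℝ := fun x => ∫ s in a..x, g s with hG
  have hac : AbsolutelyContinuousOnInterval G a b :=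
    hg.absolutelyContinuousOnInterval_intervalIntegral (by simp)
  have hpow : ∀ k : ℕ, AbsolutelyContinuousOnInterval (fun x => G x ^ (k + 1)) a b := by
    intro k
    induction k with
    | zero => simpa using hac
    | succ k ih => simpa [pow_succ] using ih.fun_mul hac
  have h1 := (hpow n).integral_deriv_eq_sub
  have h2 : ∫ x in a..b, deriv (fun x => G x ^ (n + 1)) x
      = ∫ t in a..b, ((n : ℝ) + 1) * (g t * G t ^ n) := by
    apply intervalIntegral.integral_congr_ae
    filter_upwards [hg.ae_hasDerivAt_integral] with x hx hx'
    have := (hx (uIoc_subset_uIcc hx') a (by simp)).pow (n + 1)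
    have h3 := this.deriv
    simp only [Nat.cast_add, Nat.cast_one, Nat.add_sub_cancel] at h3
    refine Eq.trans h3 ?_
    ring
  rw [h2, intervalIntegral.integral_const_mul] at h1
  have h4 : G a = 0 := by simp [hG]
  rw [h4] at h1
  have h5 : (n : ℝ) + 1 ≠ 0 := by positivity
  rw [eq_div_iff h5, mul_comm]
  simpa using h1

/-- Existence and uniqueness for the initial value problem with integrable potential. -/
theorem exists_isSolutionOn {q : ℝ → ℂ} {a b : ℝ} (hab : a ≤ b)
    (hq : IntervalIntegrable q volume a b) (z c c' : ℂ) :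
    ∃ y y' : ℝ → ℂ, (IsSolutionOn q z a b y y' ∧ y a = c ∧ y' a = c') ∧
      ∀ w w' : ℝ → ℂ, IsSolutionOn q z a b w w' → w a = c → w' a = c' →
        EqOn w y (Icc a b) ∧ EqOn w' y' (Icc a b) := by
  set p : ℝ → ℂ := fun t => q t - z with hp
  have hpi : IntervalIntegrable p volume a b := hq.sub intervalIntegrable_const
  let X := C(Icc a b, ℂ × ℂ)
  let ext (u : X) : ℝ → ℂ × ℂ := fun t => u (projIcc a b hab t)
  have hext (u : X) : Continuous (ext u) := u.continuous.comp continuous_projIcc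
  let A (u : X) : ℝ → ℂ × ℂ := fun t => ((ext u t).2, p t * (ext u t).1)
  have hA1 (u : X) : IntervalIntegrable (fun t => (ext u t).2) volume a b :=
    (continuous_snd.comp (hext u)).intervalIntegrable _ _
  have hA2 (u : X) : IntervalIntegrable (fun t => p t * (ext u t).1) volume a b :=
    hpi.mul_continuousOn (continuous_fst.comp (hext u)).continuousOn
  have hA (u : X) : IntervalIntegrable (A u) volume a b :=
    ⟨(hA1 u).1.prodMk (hA2 u).1, (hA1 u).2.prodMk (hA2 u).2⟩
  let P (u : X) : ℝ → ℂ × ℂ := fun x => (c, c') + ∫ t in a..x, A u t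
  have hP (u : X) : ContinuousOn (P u) (Icc a b) := by
    have := intervalIntegral.continuousOn_primitive_interval' (hA u) (left_mem_uIcc)
    rw [uIcc_of_le hab] at this
    exact continuousOn_const.add this
  let Φ (u : X) : X := ⟨fun x => P u x, continuousOn_iff_continuous_domRestrict.1 (hP u)⟩
  let g : ℝ → ℝ := fun t => 1 + ‖p t‖
  have hg : IntervalIntegrable g volume a b := intervalIntegrable_const.add hpi.norm
  have hsub {x : ℝ} (hx : x ∈ Icc a b) : uIcc a x ⊆ uIcc a b :=
    uIcc_subset_uIcc left_mem_uIcc (by rwa [uIcc_of_le hab])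
  have key (n : ℕ) (u w : X) (x : ℝ) (hx : x ∈ Icc a b) :
      ‖(Φ^[n] u) ⟨x, hx⟩ - (Φ^[n] w) ⟨x, hx⟩‖
        ≤ (∫ s in a..x, g s) ^ n / n.factorial * dist u w := by
    induction n generalizing x with
    | zero =>
      have h0 := ContinuousMap.dist_apply_le_dist (f := u) (g := w) ⟨x, hx⟩
      rw [dist_eq_norm] at h0
      simpa using h0
    | succ n ih =>
      rw [Function.iterate_succ_apply', Function.iterate_succ_apply']
      set u' := Φ^[n] u
      set w' := Φ^[n] w
      have e1 : (Φ u') ⟨x, hx⟩ - (Φ w') ⟨x, hx⟩ = ∫ t in a..x, (A u' t - A w' t) := by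
        rw [intervalIntegral.integral_sub ((hA u').mono_set (hsub hx)) ((hA w').mono_set (hsub hx))]
        exact add_sub_add_left_eq_sub _ _ _
      rw [e1]
      have hgx : IntervalIntegrable g volume a x := hg.mono_set (hsub hx)
      have hGc : ContinuousOn (fun t => ∫ s in a..t, g s) (uIcc a x) :=
        intervalIntegral.continuousOn_primitive_interval' hgx left_mem_uIcc
      have e2 : ‖∫ t in a..x, (A u' t - A w' t)‖
          ≤ ∫ t in a..x, (g t * (∫ s in a..t, g s) ^ n) * (dist u w / n.factorial) := by
        apply intervalIntegral.norm_integral_le_of_norm_le hx.1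
        · refine Filter.Eventually.of_forall fun t ht => ?_
          have ht' : t ∈ Icc a b := ⟨ht.1.le, ht.2.trans hx.2⟩
          have h0 := ih t ht'
          have h1 : ext u' t - ext w' t = u' ⟨t, ht'⟩ - w' ⟨t, ht'⟩ := by
            simp [ext, projIcc_of_mem hab ht']
          rw [← h1] at h0
          have h2 : ‖A u' t - A w' t‖ ≤ g t * ‖ext u' t - ext w' t‖ := by
            have hs := norm_snd_le (ext u' t - ext w' t)
            have hf := norm_fst_le (ext u' t - ext w' t)
            have hn := norm_nonneg (ext u' t - ext w' t)
            have hpn := norm_nonneg (p t)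
            simp only [A, g]
            rw [Prod.mk_sub_mk, Prod.norm_mk, ← mul_sub, norm_mul]
            simp only [Prod.fst_sub, Prod.snd_sub] at hs hf
            refine max_le ?_ ?_
            · nlinarith [mul_nonneg hpn hn]
            · nlinarith [mul_le_mul_of_nonneg_left hf hpn]
          refine h2.trans ?_
          have hgt : 0 ≤ g t := by simp only [g]; positivity
          calc g t * ‖ext u' t - ext w' t‖
              ≤ g t * ((∫ s in a..t, g s) ^ n / n.factorial * dist u w) := by gcongr
            _ = _ := by ring
        · exact (hgx.mul_continuousOn (hGc.pow n)).mul_const _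
      refine e2.trans (le_of_eq ?_)
      rw [intervalIntegral.integral_mul_const, integral_mul_primitive_pow hgx, Nat.factorial_succ]
      push_cast
      field_simp
  set M := ∫ s in a..b, g s with hM
  have hM0 : 0 ≤ M := intervalIntegral.integral_nonneg hab fun t _ => by
    simp only [g]; positivity
  obtain ⟨n, hn⟩ := (FloorSemiring.tendsto_pow_div_factorial_atTop M
    |>.eventually (gt_mem_nhds zero_lt_one)).exists
  have hK : (0 : ℝ) ≤ M ^ n / n.factorial := by positivity
  have hcon : ContractingWith ⟨M ^ n / n.factorial, hK⟩ Φ^[n] := by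
    refine ⟨hn, LipschitzWith.of_dist_le_mul fun u w => ?_⟩
    refine (ContinuousMap.dist_le (by positivity)).2 fun x => ?_
    rw [dist_eq_norm]
    refine (key n u w x x.2).trans ?_
    have hx0 : 0 ≤ ∫ s in a..(x : ℝ), g s := intervalIntegral.integral_nonneg x.2.1 fun t _ => by
      simp only [g]; positivity
    have hxM : ∫ s in a..(x : ℝ), g s ≤ M :=
      intervalIntegral.integral_mono_interval le_rfl x.2.1 x.2.2
        (Filter.Eventually.of_forall fun t => by simp only [g, Pi.zero_apply]; positivity) hg
    change _ ≤ M ^ n / n.factorial * dist u w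
    gcongr
  have : Nonempty X := ⟨0⟩
  have hfix := hcon.isFixedPt_fixedPoint_iterate
  set u := ContractingWith.fixedPoint Φ^[n] hcon
  have hu (x : ℝ) (hx : x ∈ Icc a b) : ext u x = (c, c') + ∫ t in a..x, A u t := by
    have h1 : Φ u ⟨x, hx⟩ = u ⟨x, hx⟩ := by rw [hfix]
    simp only [ext, projIcc_of_mem hab hx]
    exact h1.symm
  have hua : ext u a = (c, c') := by simpa using hu a (left_mem_Icc.2 hab)
  have i2 (v : X) (x : ℝ) (hx : x ∈ Icc a b) : (∫ t in a..x, A v t)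
      = (∫ t in a..x, (ext v t).2, ∫ t in a..x, p t * (ext v t).1) := by
    have hAx := (hA v).mono_set (hsub hx)
    refine Prod.ext ?_ ?_
    · exact (ContinuousLinearMap.intervalIntegral_comp_comm
        (ContinuousLinearMap.fst ℝ ℂ ℂ) hAx).symm
    · exact (ContinuousLinearMap.intervalIntegral_comp_comm
        (ContinuousLinearMap.snd ℝ ℂ ℂ) hAx).symm
  refine ⟨fun t => (ext u t).1, fun t => (ext u t).2, ⟨⟨?_, ?_, ?_, ?_⟩, ?_, ?_⟩, ?_⟩
  · exact (continuous_fst.comp (hext u)).continuousOn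
  · exact (continuous_snd.comp (hext u)).continuousOn
  · intro x hx
    have := congrArg Prod.fst (hu x hx)
    rw [i2 u x hx] at this
    simpa [hua] using this
  · intro x hx
    have := congrArg Prod.snd (hu x hx)
    rw [i2 u x hx] at this
    simpa [hua] using this
  · simp [hua]
  · simp [hua]
  · intro w w' hw hwa hwa'
    let v : X := ⟨fun x => (w x, w' x), (continuousOn_iff_continuous_domRestrict.1
      (hw.continuousOn.prodMk hw.continuousOn'))⟩
    have hev (t : ℝ) (ht : t ∈ Icc a b) : ext v t = (w t, w' t) := by
      simp only [ext, projIcc_of_mem hab ht]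
      rfl
    have hv : Φ v = v := by
      ext1 ⟨x, hx⟩
      have hAx := (hA v).mono_set (hsub hx)
      change (c, c') + ∫ t in a..x, A v t = (w x, w' x)
      rw [i2 v x hx, hw.eq_integral x hx, hw.eq_integral' x hx, hwa, hwa']
      have hc1 : ∫ t in a..x, (ext v t).2 = ∫ t in a..x, w' t :=
        intervalIntegral.integral_congr fun t ht => by
          rw [uIcc_of_le hx.1] at ht
          simp only [hev t ⟨ht.1, ht.2.trans hx.2⟩]
      have hc2 : ∫ t in a..x, p t * (ext v t).1 = ∫ t in a..x, (q t - z) * w t :=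
        intervalIntegral.integral_congr fun t ht => by
          rw [uIcc_of_le hx.1] at ht
          simp only [hev t ⟨ht.1, ht.2.trans hx.2⟩, hp]
      rw [hc1, hc2]
      rfl
    have hvu : v = u := hcon.fixedPoint_unique (Function.iterate_fixed hv n)
    refine ⟨fun x hx => ?_, fun x hx => ?_⟩
    · simp [← hvu, hev x hx]
    · simp [← hvu, hev x hx]


/-- The coefficients of `ℓ y = -y'' + q y` on `(0, π)` with a complex potential `q ∈ L¹[0, π]`, the
boundary coefficients `h, H ∈ ℂ`, and the transmission coefficients `β > 0`, `γ ∈ ℂ` at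
`d ∈ (0, π)`. -/
structure Problem where
  q : ℝ → ℂ
  q_integrable : IntervalIntegrable q volume 0 Real.pi
  h : ℂ
  H : ℂ
  β : ℝ
  β_pos : 0 < β
  γ : ℂ
  d : ℝ
  d_mem : d ∈ Ioo 0 Real.pi

/-- A function on `[0, π]` with a possible jump at `d`: its branch on `[0, d]`, whose value at `d`
is the left limit `y(d - 0)`, and its branch on `[d, π]`, whose value at `d` is the right limit
`y(d + 0)`, each with its derivative. -/
structure Branches where
  left : ℝ → ℂ
  left' : ℝ → ℂ
  right : ℝ → ℂ
  right' : ℝ → ℂ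

/-- `y` solves `ℓ y = z y` on `(0, d)` and on `(d, π)` and satisfies the discontinuous conditions
`y(d + 0) = β y(d - 0)`, `y'(d + 0) = β⁻¹ y'(d - 0) + γ y(d - 0)`. -/
structure Problem.IsSolution (L : Problem) (z : ℂ) (y : Branches) : Prop where
  left : IsSolutionOn L.q z 0 L.d y.left y.left'
  right : IsSolutionOn L.q z L.d Real.pi y.right y.right'
  jump : y.right L.d = L.β * y.left L.d
  jump' : y.right' L.d = (L.β : ℂ)⁻¹ * y.left' L.d + L.γ * y.left L.d

theorem Problem.exists_phi (L : Problem) (z : ℂ) :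
    ∃ y : Branches, L.IsSolution z y ∧ y.left 0 = 1 ∧ y.left' 0 = L.h := by
  have hd := L.d_mem
  have h1 : IntervalIntegrable L.q volume 0 L.d := L.q_integrable.mono_set (by
    rw [uIcc_of_le hd.1.le, uIcc_of_le Real.pi_pos.le]; exact Icc_subset_Icc le_rfl hd.2.le)
  have h2 : IntervalIntegrable L.q volume L.d Real.pi := L.q_integrable.mono_set (by
    rw [uIcc_of_le hd.2.le, uIcc_of_le Real.pi_pos.le]; exact Icc_subset_Icc hd.1.le le_rfl)
  obtain ⟨y, y', ⟨hy, hy0, hy0'⟩, -⟩ := exists_isSolutionOn hd.1.le h1 z 1 L.h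
  obtain ⟨w, w', ⟨hw, hwd, hwd'⟩, -⟩ := exists_isSolutionOn hd.2.le h2 z (L.β * y L.d)
    ((L.β : ℂ)⁻¹ * y' L.d + L.γ * y L.d)
  exact ⟨⟨y, y', w, w'⟩, ⟨hy, hw, hwd, hwd'⟩, hy0, hy0'⟩

/-- The solution `φ(·, z)` of `ℓ y = z y` with the discontinuous conditions and
`φ(0, z) = 1`, `φ'(0, z) = h`. -/
noncomputable def Problem.phi (L : Problem) (z : ℂ) : Branches :=
  (L.exists_phi z).choose

/-- The characteristic function `Δ(z) = V(φ) = φ'(π, z) + H φ(π, z)` of the problem `B`. -/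
noncomputable def Problem.charFun (L : Problem) (z : ℂ) : ℂ :=
  (L.phi z).right' Real.pi + L.H * (L.phi z).right Real.pi

/-- The characteristic function `Δ^∞(z) = -V^∞(φ) = -φ(π, z)` of the problem `B^∞`. -/
noncomputable def Problem.charFunInfty (L : Problem) (z : ℂ) : ℂ :=
  -(L.phi z).right Real.pi

/-- `y` does not vanish identically on `[0, π]`. -/
def Problem.Nontrivial (L : Problem) (y : Branches) : Prop :=
  (∃ x ∈ Icc 0 L.d, y.left x ≠ 0) ∨ ∃ x ∈ Icc L.d Real.pi, y.right x ≠ 0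

/-- `z` is an eigenvalue of `B`: `U(y) = y'(0) - h y(0) = 0`, `V(y) = y'(π) + H y(π) = 0`. -/
def Problem.IsEigenvalue (L : Problem) (z : ℂ) : Prop :=
  ∃ y : Branches, L.IsSolution z y ∧ L.Nontrivial y ∧
    y.left' 0 - L.h * y.left 0 = 0 ∧ y.right' Real.pi + L.H * y.right Real.pi = 0

/-- `z` is an eigenvalue of `B^∞`: `U(y) = y'(0) - h y(0) = 0`, `V^∞(y) = y(π) = 0`. -/
def Problem.IsEigenvalueInfty (L : Problem) (z : ℂ) : Prop :=
  ∃ y : Branches, L.IsSolution z y ∧ L.Nontrivial y ∧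
    y.left' 0 - L.h * y.left 0 = 0 ∧ y.right Real.pi = 0

/-- `lam` is the sequence of all points satisfying `eig`, each one repeated according to its order
as a zero of `Δ`, in order of increasing moduli and with identical entries adjacent. -/
structure IsSpectralSequence (eig : ℂ → Prop) (Δ : ℂ → ℂ) (lam : ℕ → ℂ) : Prop where
  mem : ∀ n, eig (lam n)
  count : ∀ z, eig z → {n | lam n = z}.encard = analyticOrderAt Δ z
  mono : Monotone fun n => ‖lam n‖
  adjacent : ∀ i j k, i ≤ j → j ≤ k → lam i = lam k → lam j = lam i

/-- `σ(B) = {lam n}`, with algebraic multiplicities. -/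
def Problem.IsSpectrum (L : Problem) (lam : ℕ → ℂ) : Prop :=
  IsSpectralSequence L.IsEigenvalue L.charFun lam

/-- `σ(B^∞) = {lam n}`, with algebraic multiplicities. -/
def Problem.IsSpectrumInfty (L : Problem) (lam : ℕ → ℂ) : Prop :=
  IsSpectralSequence L.IsEigenvalueInfty L.charFunInfty lam

/-- `q` is `C^m` near `π`, that is, on some `[π - δ, π]`; no condition for `m = -1`. -/
def IsSmoothNearPi (m : ℤ) (q : ℝ → ℂ) : Prop :=
  ∃ δ > 0, ∀ k : ℕ, (k : ℤ) ≤ m → ContDiffOn ℝ k q (Icc (Real.pi - δ) Real.pi)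

/-- The (left) derivative `q^(j)(π)`. -/
noncomputable def derivAtPi (j : ℕ) (q : ℝ → ℂ) : ℂ :=
  iteratedDerivWithin j q (Iic Real.pi) Real.pi

/-- The family `(a n)`, `n ∉ Λ`, is a subfamily of `b`: distinct indices `n ∉ Λ` are matched with
distinct entries of `b` of the same value (for instance `a n = b n` for all `n ∉ Λ`). -/
def IsSubsequenceOff (Λ : Finset ℕ) (a b : ℕ → ℂ) : Prop :=
  ∃ e : ℕ → ℕ, InjOn e {n | n ∉ Λ} ∧ ∀ n, n ∉ Λ → a n = b (e n)

end SturmLiouville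

/-!
The theorem compares `B` and `B̃` (coefficients with a prime in the code) through the Wronskian
`W(z) = φ φ̃' - φ' φ̃` at `π`, which equals `Δ Δ̃^∞ - Δ^∞ Δ̃` because `H = H̃`. Two facts force `W = 0`.

* Let `P`, `P^∞` be the polynomials whose roots are the eigenvalues of `B`, `B^∞` with indices in
  the exceptional sets. The other eigenvalues being shared with multiplicity, `Δ̃ P = F Δ` and
  `Δ̃^∞ P^∞ = F^∞ Δ^∞` with entire `F`, `F^∞`. With `z = ρ²`, the classical asymptotics of `φ` bound
  `Δ` and `Δ^∞` from below on large squares in the `ρ`-plane whose vertical sides avoid the zeros,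
  so `F(ρ²)` and `F^∞(ρ²)` are polynomials in `ρ`, and so is `T = F^∞ P - F P^∞`, for which
  `T Δ Δ^∞ = P P^∞ W`.
* By Lagrange's identity `W` is, up to the contribution of `[0, d]`, the integral of
  `(q̃ - q) φ φ̃` over `[d, π]`. As `q̃ - q = o((π - x)^m)` at `π`, this is `o(τ^{-m-1} e^{2πτ})` at
  `ρ = iτ`, whereas `|Δ Δ^∞|` is at least of order `τ e^{2πτ}` there and `P P^∞` has degree
  `[(m + 2) / 2]` in `z`. Hence `T → 0` along the imaginary axis, so `T = 0` and `W = 0`. The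
  contribution of `[0, d]` is of order `τ e^{2dτ}` whatever the transmission coefficients are, so
  they need not be known to agree at this stage.

See `Problem.wronskian_pi_eq_zero`. It remains to recover the coefficients from the Weyl function
`φ'/φ` at `π`. On an interval without a discontinuity the Weyl function at an end determines the
potential (`potential_eq_of_weyl_eq_right`): for fundamental solutions `C`, `S` and `C̃`, `S̃` at that
end the entire function `C S̃ - C̃ S` equals `(φ/φ(π)) S̃ - (φ̃/φ̃(π)) S`, which is `O(1/ρ)` on the
squares, so it vanishes; then `C = C̃`, `S = S̃` and `q = q̃`. This applies on `[d, π]` first. The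
Weyl functions at `d + 0` now agree, and their growth along `ρ = iτ` gives `β = β̃` and `γ = γ̃`
(`Problem.transmission_eq_of_wronskian_d`), so the Weyl functions at `d - 0` agree, and the same
argument on `[0, d]` gives the rest.
-/

namespace SturmLiouville

open MeasureTheory Set Filter Topology

/-! ### Entire functions bounded on expanding squares -/

/-- The boundary of the square with vertices `±R ± iR`. -/
def squareBoundary (R : ℝ) : Set ℂ :=
  {z | |z.re| ≤ R ∧ |z.im| ≤ R ∧ (|z.re| = R ∨ |z.im| = R)}

theorem le_norm_of_mem_squareBoundary {R : ℝ} {z : ℂ} (hz : z ∈ squareBoundary R) : R ≤ ‖z‖ := by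
  rcases hz.2.2 with h | h
  · exact h ▸ Complex.abs_re_le_norm z
  · exact h ▸ Complex.abs_im_le_norm z

theorem norm_le_of_mem_squareBoundary {R : ℝ} {z : ℂ} (hz : z ∈ squareBoundary R) :
    ‖z‖ ≤ 2 * R := by
  linarith [Complex.norm_le_abs_re_add_abs_im z, hz.1, hz.2.1]

/-- The maximum modulus principle on a square. -/
theorem norm_le_of_forall_mem_squareBoundary {f : ℂ → ℂ} (hf : Differentiable ℂ f) {R C : ℝ}
    (h : ∀ z ∈ squareBoundary R, ‖f z‖ ≤ C) {z : ℂ} (hz : ‖z‖ < R) : ‖f z‖ ≤ C := by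
  have hR : -R < R := by linarith [norm_nonneg z]
  have hb : Bornology.IsBounded (Ioo (-R) R ×ℂ Ioo (-R) R) :=
    Bornology.IsBounded.reProdIm (Metric.isBounded_Ioo _ _) (Metric.isBounded_Ioo _ _)
  refine Complex.norm_le_of_forall_mem_frontier_norm_le hb hf.diffContOnCl ?_
    (subset_closure ?_)
  · intro w hw
    rw [Complex.frontier_reProdIm, frontier_Ioo hR, closure_Ioo hR.ne] at hw
    apply h
    rcases hw with ⟨h1, h2⟩ | ⟨h1, h2⟩
    · refine ⟨abs_le.2 h1, ?_, Or.inr ?_⟩ <;> rcases h2 with h2 | h2 <;>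
        simp_all [abs_of_nonneg, show (0 : ℝ) ≤ R by linarith]
    · refine ⟨?_, abs_le.2 h2, Or.inl ?_⟩ <;> rcases h1 with h1 | h1 <;>
        simp_all [abs_of_nonneg, show (0 : ℝ) ≤ R by linarith]
  · have h1 := (Complex.abs_re_le_norm z).trans_lt hz
    have h2 := (Complex.abs_im_le_norm z).trans_lt hz
    exact ⟨abs_lt.1 h1, abs_lt.1 h2⟩

/-- An entire function that is `O(1 / R)` on the boundaries of expanding squares vanishes. -/
theorem eq_zero_of_norm_le_div {f : ℂ → ℂ} (hf : Differentiable ℂ f) {R : ℕ → ℝ}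
    (hR : Tendsto R atTop atTop) {K : ℝ}
    (h : ∀ᶠ n in atTop, ∀ z ∈ squareBoundary (R n), ‖f z‖ ≤ K / R n) (z : ℂ) : f z = 0 := by
  have h1 : ∀ᶠ n in atTop, ‖f z‖ ≤ K / R n := by
    filter_upwards [h, hR.eventually_gt_atTop ‖z‖] with n hn hz
    exact norm_le_of_forall_mem_squareBoundary hf hn hz
  have h2 : Tendsto (fun n => K / R n) atTop (𝓝 0) := hR.const_div_atTop K
  simpa using ge_of_tendsto h2 h1

/-- Liouville's theorem for polynomial growth, with the growth known only on the boundaries of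
expanding squares. The degree of the bound is lowered by passing to `(f z - f 0) / z`. -/
theorem exists_polynomial_of_norm_le {f : ℂ → ℂ} (hf : Differentiable ℂ f) {R : ℕ → ℝ}
    (hR : Tendsto R atTop atTop) {K : ℝ} {k : ℕ}
    (h : ∀ᶠ n in atTop, ∀ z ∈ squareBoundary (R n), ‖f z‖ ≤ K * R n ^ k) :
    ∃ p : Polynomial ℂ, ∀ z, f z = p.eval z := by
  induction k generalizing f K with
  | zero =>
    have hb : ∀ z, ‖f z‖ ≤ K := fun z => by
      obtain ⟨n, hn, hz⟩ := (h.and (hR.eventually_gt_atTop ‖z‖)).exists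
      exact norm_le_of_forall_mem_squareBoundary hf (by simpa using hn) hz
    refine ⟨Polynomial.C (f 0), fun z => ?_⟩
    rw [Polynomial.eval_C]
    exact hf.apply_eq_apply_of_bounded
      (isBounded_iff_forall_norm_le.2 ⟨K, by rintro _ ⟨z, rfl⟩; exact hb z⟩) z 0
  | succ k ih =>
    have hg : Differentiable ℂ (dslope f 0) := by
      rw [← differentiableOn_univ] at hf ⊢
      exact (Complex.differentiableOn_dslope univ_mem).2 hf
    obtain ⟨p, hp⟩ := ih (f := dslope f 0) (K := K + ‖f 0‖) hg (by
      filter_upwards [h, hR.eventually_ge_atTop 1] with n hn h1 z hz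
      have hzR := le_norm_of_mem_squareBoundary hz
      have hz0 : z ≠ 0 := norm_pos_iff.1 (by linarith)
      rw [dslope_of_ne _ hz0, slope_def_field, sub_zero, norm_div, div_le_iff₀ (by linarith)]
      have h3 : 1 ≤ R n ^ (k + 1) := one_le_pow₀ h1
      have hK : 0 ≤ K * R n ^ (k + 1) := (norm_nonneg _).trans (hn z hz)
      have hK0 : 0 ≤ K := nonneg_of_mul_nonneg_left hK (by positivity)
      calc ‖f z - f 0‖ ≤ K * R n ^ (k + 1) + ‖f 0‖ :=
            (norm_sub_le _ _).trans (by gcongr; exact hn z hz)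
        _ ≤ K * R n ^ (k + 1) + ‖f 0‖ * R n ^ (k + 1) := by
            gcongr; exact le_mul_of_one_le_right (norm_nonneg _) h3
        _ = (K + ‖f 0‖) * R n ^ k * R n := by ring
        _ ≤ (K + ‖f 0‖) * R n ^ k * ‖z‖ := by gcongr)
    refine ⟨Polynomial.C (f 0) + Polynomial.X * p, fun z => ?_⟩
    have := sub_smul_dslope f 0 z
    simp only [sub_zero, smul_eq_mul] at this
    simp [← hp, this]

theorem polynomial_eq_zero_of_tendsto_zero {p : Polynomial ℂ}
    (h : Tendsto (fun τ : ℝ => p.eval (τ * Complex.I)) atTop (𝓝 0)) : p = 0 := by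
  have hI : Tendsto (fun τ : ℝ => ‖(τ : ℂ) * Complex.I‖) atTop atTop := by
    simpa using tendsto_abs_atTop_atTop
  by_cases hd : 0 < p.degree
  · exact absurd (p.tendsto_norm_atTop hd hI) (not_tendsto_atTop_of_tendsto_nhds h.norm)
  · rw [Polynomial.eq_C_of_degree_le_zero (not_lt.1 hd)] at h ⊢
    simp only [Polynomial.eval_C] at h
    rw [tendsto_nhds_unique tendsto_const_nhds h, map_zero]

/-! ### Division of entire functions -/

/-- If every zero of `g` is a zero of `f` of at least the same order, then `g` divides `f` in the
ring of entire functions. The quotient is the meromorphic normal form of `f / g`. -/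
theorem exists_entire_quotient {f g : ℂ → ℂ} (hf : Differentiable ℂ f) (hg : Differentiable ℂ g)
    (hfin : ∀ z, analyticOrderAt g z ≠ ⊤)
    (hle : ∀ z, analyticOrderAt g z ≤ analyticOrderAt f z) :
    ∃ F : ℂ → ℂ, Differentiable ℂ F ∧ ∀ z, f z = F z * g z := by
  have haf : ∀ z, AnalyticAt ℂ f z := fun z => hf.analyticAt z
  have hag : ∀ z, AnalyticAt ℂ g z := fun z => hg.analyticAt z
  have hm : MeromorphicOn (f / g) univ := fun z _ => (haf z).meromorphicAt.div (hag z).meromorphicAt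
  have hF : Differentiable ℂ (toMeromorphicNFOn (f / g) univ) := fun z => by
    refine AnalyticAt.differentiableAt ?_
    rw [← (meromorphicNFOn_toMeromorphicNFOn (f / g) univ
      (mem_univ z)).meromorphicOrderAt_nonneg_iff_analyticAt,
      meromorphicOrderAt_toMeromorphicNFOn hm (mem_univ z),
      meromorphicOrderAt_div (haf z).meromorphicAt (hag z).meromorphicAt,
      (haf z).meromorphicOrderAt_eq, (hag z).meromorphicOrderAt_eq]
    have h1 := hfin z
    have h2 := hle z
    generalize analyticOrderAt g z = m at *
    generalize analyticOrderAt f z = n at *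
    lift m to ℕ using h1
    induction n using ENat.recTopCoe with
    | top => simp
    | coe n =>
      have h3 : m ≤ n := by exact_mod_cast h2
      simp only [ENat.map_natCast]
      norm_cast
      simp
  refine ⟨_, hF, fun z => ?_⟩
  have hev : ∀ᶠ w in 𝓝[≠] z, f w = toMeromorphicNFOn (f / g) univ w * g w := by
    have h1 := hm.toMeromorphicNFOn_eq_self_on_nhdsNE (mem_univ z)
    have h2 : ∀ᶠ w in 𝓝[≠] z, g w ≠ 0 := by
      rcases (hag z).eventually_eq_zero_or_eventually_ne_zero with h | h
      · exact absurd (analyticOrderAt_eq_top.2 h) (hfin z)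
      · exact h
    filter_upwards [h1, h2] with w hw hw2
    rw [hw, Pi.div_apply, div_mul_cancel₀ _ hw2]
  exact ((hf.continuous.continuousAt.eventuallyEq_nhds_iff_eventuallyEq_nhdsNE
    (hF.continuous.mul hg.continuous).continuousAt).1 hev).eq_of_nhds

/-! ### Bounds for trigonometric functions -/

theorem norm_cos_sq (z : ℂ) : ‖Complex.cos z‖ ^ 2 = Real.cos z.re ^ 2 + Real.sinh z.im ^ 2 := by
  rw [Complex.cos_eq, ← Complex.normSq_eq_norm_sq, Complex.normSq_apply]
  simp only [← Complex.ofReal_cos, ← Complex.ofReal_sin, ← Complex.ofReal_cosh,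
    ← Complex.ofReal_sinh, Complex.sub_re, Complex.sub_im,
    Complex.mul_re, Complex.mul_im, Complex.ofReal_re, Complex.ofReal_im, Complex.I_re,
    Complex.I_im]
  nlinarith [Real.cosh_sq z.im, Real.sin_sq_add_cos_sq z.re]

theorem norm_sin_sq (z : ℂ) : ‖Complex.sin z‖ ^ 2 = Real.sin z.re ^ 2 + Real.sinh z.im ^ 2 := by
  rw [Complex.sin_eq, ← Complex.normSq_eq_norm_sq, Complex.normSq_apply]
  simp only [← Complex.ofReal_cos, ← Complex.ofReal_sin, ← Complex.ofReal_cosh,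
    ← Complex.ofReal_sinh, Complex.add_re, Complex.add_im,
    Complex.mul_re, Complex.mul_im, Complex.ofReal_re, Complex.ofReal_im, Complex.I_re,
    Complex.I_im]
  nlinarith [Real.cosh_sq z.im, Real.sin_sq_add_cos_sq z.re]

theorem norm_cos_le_cosh (z : ℂ) : ‖Complex.cos z‖ ≤ Real.cosh z.im := by
  refine abs_le_of_sq_le_sq' ?_ (Real.cosh_pos _).le |>.2
  rw [norm_cos_sq, Real.cosh_sq]
  nlinarith [Real.cos_sq_le_one z.re]

theorem norm_sin_le_cosh (z : ℂ) : ‖Complex.sin z‖ ≤ Real.cosh z.im := by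
  refine abs_le_of_sq_le_sq' ?_ (Real.cosh_pos _).le |>.2
  rw [norm_sin_sq, Real.cosh_sq]
  nlinarith [Real.sin_sq_le_one z.re]

theorem sinh_abs_sq (x : ℝ) : Real.sinh |x| ^ 2 = Real.sinh x ^ 2 := by
  rcases abs_choice x with h | h <;> simp [h]

theorem sinh_le_norm_cos (z : ℂ) : Real.sinh |z.im| ≤ ‖Complex.cos z‖ := by
  refine abs_le_of_sq_le_sq' ?_ (norm_nonneg _) |>.2
  rw [norm_cos_sq, sinh_abs_sq]
  nlinarith [sq_nonneg (Real.cos z.re)]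

theorem sinh_le_norm_sin (z : ℂ) : Real.sinh |z.im| ≤ ‖Complex.sin z‖ := by
  refine abs_le_of_sq_le_sq' ?_ (norm_nonneg _) |>.2
  rw [norm_sin_sq, sinh_abs_sq]
  nlinarith [sq_nonneg (Real.sin z.re)]

theorem norm_cos_eq_cosh {z : ℂ} (h : Real.sin z.re = 0) : ‖Complex.cos z‖ = Real.cosh z.im := by
  refine (sq_eq_sq₀ (norm_nonneg _) (Real.cosh_pos _).le).1 ?_
  rw [norm_cos_sq, Real.cosh_sq]
  nlinarith [Real.sin_sq_add_cos_sq z.re]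

theorem norm_sin_eq_cosh {z : ℂ} (h : Real.cos z.re = 0) : ‖Complex.sin z‖ = Real.cosh z.im := by
  refine (sq_eq_sq₀ (norm_nonneg _) (Real.cosh_pos _).le).1 ?_
  rw [norm_sin_sq, Real.cosh_sq]
  nlinarith [Real.sin_sq_add_cos_sq z.re]

theorem cosh_le_exp_abs (x : ℝ) : Real.cosh x ≤ Real.exp |x| := by
  rw [← Real.cosh_abs, Real.cosh_eq]
  have : Real.exp (-|x|) ≤ Real.exp |x| := Real.exp_le_exp.2 (by linarith [abs_nonneg x])
  linarith

theorem norm_cos_le_exp (z : ℂ) : ‖Complex.cos z‖ ≤ Real.exp |z.im| :=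
  (norm_cos_le_cosh z).trans (cosh_le_exp_abs _)

theorem norm_sin_le_exp (z : ℂ) : ‖Complex.sin z‖ ≤ Real.exp |z.im| :=
  (norm_sin_le_cosh z).trans (cosh_le_exp_abs _)

/-- `b₁ u + b₂ v` is bounded below by a multiple of `exp s` if `|b₂| < b₁`, `‖v‖ ≤ cosh s`, and
`‖u‖` is either equal to `cosh s` or, for large `s`, at least `sinh s`. The alternatives serve the
vertical and the horizontal sides of the squares, where `u` is a sine or cosine. -/
theorem exists_exp_le_norm_add {b₁ b₂ : ℝ} (hb : |b₂| < b₁) :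
    ∃ κ > 0, ∃ T, ∀ (u v : ℂ) (s : ℝ), 0 ≤ s → ‖v‖ ≤ Real.cosh s →
      (‖u‖ = Real.cosh s ∨ (T ≤ s ∧ Real.sinh s ≤ ‖u‖)) →
      κ * Real.exp s ≤ ‖b₁ * u + b₂ * v‖ := by
  have hb0 : 0 < b₁ := (abs_nonneg _).trans_lt hb
  have hd : 0 < b₁ - |b₂| := by linarith
  refine ⟨(b₁ - |b₂|) / 4, by positivity, 2 * (b₁ + |b₂|) / (b₁ - |b₂|), ?_⟩
  intro u v s hs hv hu
  have h1 : b₁ * ‖u‖ - |b₂| * Real.cosh s ≤ ‖b₁ * u + b₂ * v‖ := by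
    have := norm_sub_norm_le ((b₁ : ℂ) * u) (-(b₂ * v))
    rw [norm_neg, sub_neg_eq_add, norm_mul, norm_mul, Complex.norm_real, Complex.norm_real,
      Real.norm_eq_abs, Real.norm_eq_abs, abs_of_pos hb0] at this
    nlinarith [abs_nonneg b₂]
  refine le_trans ?_ h1
  have he := Real.exp_pos s
  have he' := Real.exp_pos (-s)
  rcases hu with hu | ⟨hT, hu⟩
  · rw [hu, Real.cosh_eq]
    nlinarith
  · have h2 : b₁ * Real.sinh s ≤ b₁ * ‖u‖ := by gcongr
    refine le_trans ?_ (sub_le_sub_right h2 _)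
    rw [Real.cosh_eq, Real.sinh_eq]
    rw [div_le_iff₀ hd] at hT
    have h3 : s ≤ Real.exp s := by linarith [Real.add_one_le_exp s]
    have h4 : Real.exp (-s) ≤ 1 := by simpa using hs
    nlinarith [abs_nonneg b₂]

/-! ### Primitives of integrable functions -/

/-- `F` is absolutely continuous on `[a, b]` with integrable derivative `f`, in integrated form. -/
structure IsPrimitiveOn (F f : ℝ → ℂ) (a b : ℝ) : Prop where
  integrable : IntervalIntegrable f volume a b
  eq : ∀ x ∈ Icc a b, F x = F a + ∫ t in a..x, f t

theorem intervalIntegrable_initial {E : Type*} [NormedAddCommGroup E] {f : ℝ → E} {a b x : ℝ}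
    (hf : IntervalIntegrable f volume a b) (hx : x ∈ Icc a b) :
    IntervalIntegrable f volume a x :=
  hf.mono_set (uIcc_subset_uIcc left_mem_uIcc (Icc_subset_uIcc hx))

theorem intervalIntegrable_final {E : Type*} [NormedAddCommGroup E] {f : ℝ → E} {a b x : ℝ}
    (hf : IntervalIntegrable f volume a b) (hx : x ∈ Icc a b) :
    IntervalIntegrable f volume x b :=
  hf.mono_set (uIcc_subset_uIcc (Icc_subset_uIcc hx) right_mem_uIcc)

/-- The primitive of a complex-valued integrable function is absolutely continuous, by comparison
with the primitive of the norm. -/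
theorem absolutelyContinuousOnInterval_primitive {f : ℝ → ℂ} {a b : ℝ}
    (hf : IntervalIntegrable f volume a b) :
    AbsolutelyContinuousOnInterval (fun x => ∫ t in a..x, f t) a b := by
  have hn : AbsolutelyContinuousOnInterval (fun x => ∫ t in a..x, ‖f t‖) a b :=
    hf.norm.absolutelyContinuousOnInterval_intervalIntegral (by simp)
  unfold AbsolutelyContinuousOnInterval at hn ⊢
  refine squeeze_zero'
    (Eventually.of_forall fun _ => Finset.sum_nonneg fun _ _ => dist_nonneg) ?_ hn
  rw [eventually_inf_principal]
  filter_upwards with ⟨n, I⟩ hI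
  refine Finset.sum_le_sum fun i hi => ?_
  have h1 := (hI.1 i hi).1
  have h2 := (hI.1 i hi).2
  have i1 : IntervalIntegrable f volume a (I i).1 :=
    hf.mono_set (uIcc_subset_uIcc left_mem_uIcc h1)
  have i2 : IntervalIntegrable f volume a (I i).2 :=
    hf.mono_set (uIcc_subset_uIcc left_mem_uIcc h2)
  rw [dist_eq_norm, Real.dist_eq, intervalIntegral.integral_interval_sub_left i1 i2,
    intervalIntegral.integral_interval_sub_left i1.norm i2.norm]
  exact intervalIntegral.norm_integral_le_abs_integral_norm

namespace IsPrimitiveOn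

variable {F G f g : ℝ → ℂ} {a b : ℝ}

theorem continuousOn (hab : a ≤ b) (hF : IsPrimitiveOn F f a b) : ContinuousOn F (Icc a b) := by
  have := intervalIntegral.continuousOn_primitive_interval' hF.integrable left_mem_uIcc
  rw [uIcc_of_le hab] at this
  exact (continuousOn_const.add this).congr fun x hx => hF.eq x hx

theorem of_hasDerivAt (h : ∀ x, HasDerivAt F (f x) x) (hf : Continuous f) :
    IsPrimitiveOn F f a b := by
  refine ⟨hf.intervalIntegrable _ _, fun x _ => ?_⟩
  rw [intervalIntegral.integral_eq_sub_of_hasDerivAt (fun t _ => h t) (hf.intervalIntegrable _ _)]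
  ring

theorem congr (hF : IsPrimitiveOn F f a b) (h : ∀ x ∈ Icc a b, f x = g x) (hab : a ≤ b) :
    IsPrimitiveOn F g a b := by
  refine ⟨(intervalIntegrable_congr fun t ht => ?_).1 hF.integrable, fun x hx => ?_⟩
  · rw [uIoc_of_le hab] at ht
    exact h t ⟨ht.1.le, ht.2⟩
  · rw [hF.eq x hx]
    congr 1
    refine intervalIntegral.integral_congr fun t ht => ?_
    rw [uIcc_of_le hx.1] at ht
    exact h t ⟨ht.1, ht.2.trans hx.2⟩

theorem sub (hF : IsPrimitiveOn F f a b) (hG : IsPrimitiveOn G g a b) :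
    IsPrimitiveOn (fun x => F x - G x) (fun x => f x - g x) a b := by
  refine ⟨hF.integrable.sub hG.integrable, fun x hx => ?_⟩
  rw [hF.eq x hx, hG.eq x hx, intervalIntegral.integral_sub
    (intervalIntegrable_initial hF.integrable hx)
    (intervalIntegrable_initial hG.integrable hx)]
  ring

/-- The product rule: the difference of the two sides of the integrated form is absolutely
continuous with derivative zero almost everywhere. -/
theorem mul (hab : a ≤ b) (hF : IsPrimitiveOn F f a b) (hG : IsPrimitiveOn G g a b) :
    IsPrimitiveOn (fun x => F x * G x) (fun x => f x * G x + F x * g x) a b := by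
  have hFc := hF.continuousOn hab
  have hGc := hG.continuousOn hab
  rw [← uIcc_of_le hab] at hFc hGc
  have hint : IntervalIntegrable (fun x => f x * G x + F x * g x) volume a b :=
    (hF.integrable.mul_continuousOn hGc).add (hG.integrable.continuousOn_mul hFc)
  refine ⟨hint, fun x hx => ?_⟩
  have hconst (c : ℂ) : AbsolutelyContinuousOnInterval (fun _ : ℝ => c) a b := by
    have : LipschitzOnWith 0 (fun _ : ℝ => c) (uIcc a b) :=
      (LipschitzWith.const c).lipschitzOnWith
    exact this.absolutelyContinuousOnInterval
  have hF0 := (hconst (F a)).add (absolutelyContinuousOnInterval_primitive hF.integrable)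
  have hG0 := (hconst (G a)).add (absolutelyContinuousOnInterval_primitive hG.integrable)
  have hH := (hF0.smul hG0).sub (absolutelyContinuousOnInterval_primitive hint)
  obtain ⟨C, hC⟩ := hH.const_of_ae_hasDerivAt_zero (by
    filter_upwards [hF.integrable.ae_hasDerivAt_integral, hG.integrable.ae_hasDerivAt_integral,
      hint.ae_hasDerivAt_integral] with t h1 h2 h3 ht
    have d1 := (h1 ht a left_mem_uIcc).const_add (F a)
    have d2 := (h2 ht a left_mem_uIcc).const_add (G a)
    have d3 := (d1.mul d2).sub (h3 ht a left_mem_uIcc)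
    have ht' : t ∈ Icc a b := by rwa [uIcc_of_le hab] at ht
    rw [← hF.eq t ht', ← hG.eq t ht', sub_self] at d3
    exact d3)
  have e1 := hC a left_mem_uIcc
  have e2 := hC x (Icc_subset_uIcc hx)
  simp only [Pi.sub_apply, Pi.add_apply, smul_eq_mul, Pi.mul_apply,
    intervalIntegral.integral_same, add_zero, sub_zero] at e1 e2
  rw [← hF.eq x hx, ← hG.eq x hx, ← e1] at e2
  rw [← e2]; ring

/-- The derivative of the zero function vanishes almost everywhere. -/
theorem ae_eq_zero (hF : IsPrimitiveOn F f a b) (h : ∀ x ∈ Icc a b, F x = 0) :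
    ∀ᵐ x, x ∈ Icc a b → f x = 0 := by
  filter_upwards [hF.integrable.ae_hasDerivAt_integral,
    Ioo_ae_eq_Icc (a := a) (b := b) (μ := volume)] with x hx hI hxI
  have hxo : x ∈ Ioo a b := (iff_of_eq hI).2 hxI
  have h1 := hx (Icc_subset_uIcc hxI) a left_mem_uIcc
  have h2 : HasDerivAt (fun x => ∫ t in a..x, f t) 0 x := by
    refine (hasDerivAt_const x (0 : ℂ)).congr_of_eventuallyEq ?_
    filter_upwards [Ioo_mem_nhds hxo.1 hxo.2] with t ht
    have := hF.eq t (Ioo_subset_Icc_self ht)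
    rw [h t (Ioo_subset_Icc_self ht), h a ⟨le_rfl, (hxI.1.trans hxI.2)⟩, zero_add] at this
    exact this.symm
  exact h1.unique h2

end IsPrimitiveOn

/-! ### Solutions of `-y'' + q y = z y` -/

namespace IsSolutionOn

variable {q p : ℝ → ℂ} {z ζ : ℂ} {a b : ℝ} {y y' w w' : ℝ → ℂ}

theorem isPrimitiveOn (hab : a ≤ b) (hy : IsSolutionOn q z a b y y') : IsPrimitiveOn y y' a b :=
  ⟨(uIcc_of_le hab ▸ hy.continuousOn').intervalIntegrable, hy.eq_integral⟩

theorem isPrimitiveOn' (hab : a ≤ b) (hq : IntervalIntegrable q volume a b)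
    (hy : IsSolutionOn q z a b y y') : IsPrimitiveOn y' (fun t => (q t - z) * y t) a b :=
  ⟨(hq.sub intervalIntegrable_const).mul_continuousOn (uIcc_of_le hab ▸ hy.continuousOn),
    hy.eq_integral'⟩

/-- Lagrange's identity: the derivative of the Wronskian of two solutions with different potentials
and spectral parameters. -/
theorem lagrange (hab : a ≤ b) (hq : IntervalIntegrable q volume a b)
    (hp : IntervalIntegrable p volume a b) (hy : IsSolutionOn q z a b y y')
    (hw : IsSolutionOn p ζ a b w w') :
    IsPrimitiveOn (fun x => y x * w' x - y' x * w x)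
      (fun t => ((p t - ζ) - (q t - z)) * (y t * w t)) a b :=
  (((hy.isPrimitiveOn hab).mul hab (hw.isPrimitiveOn' hab hp)).sub
    ((hy.isPrimitiveOn' hab hq).mul hab (hw.isPrimitiveOn hab))).congr
    (fun x _ => by ring) hab

theorem wronskian_eq (hab : a ≤ b) (hq : IntervalIntegrable q volume a b)
    (hy : IsSolutionOn q z a b y y') (hw : IsSolutionOn q z a b w w') {x : ℝ} (hx : x ∈ Icc a b) :
    y x * w' x - y' x * w x = y a * w' a - y' a * w a := by
  simpa using (hy.lagrange hab hq hq hw).eq x hx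

/-- The substitution `x ↦ c - x` carries solutions to solutions; `c = a + b` reflects `[a, b]` about
its midpoint. -/
theorem reflect (hab : a ≤ b) (hq : IntervalIntegrable q volume a b)
    (hy : IsSolutionOn q z a b y y') (c : ℝ) :
    IsSolutionOn (fun x => q (c - x)) z (c - b) (c - a) (fun x => y (c - x))
      (fun x => -y' (c - x)) := by
  have hmaps : MapsTo (fun x => c - x) (Icc (c - b) (c - a)) (Icc a b) := fun x hx =>
    ⟨by linarith [hx.2], by linarith [hx.1]⟩
  have hc : ContinuousOn (fun x => c - x) (Icc (c - b) (c - a)) := by fun_prop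
  have key {F f : ℝ → ℂ} (hF : IsPrimitiveOn F f a b) (x : ℝ) (hx : x ∈ Icc (c - b) (c - a)) :
      F (c - x) = F b - ∫ t in (c - b)..x, f (c - t) := by
    have hx' := hmaps hx
    rw [intervalIntegral.integral_comp_sub_left, sub_sub_cancel, hF.eq _ hx',
      hF.eq b ⟨hab, le_rfl⟩, ← intervalIntegral.integral_add_adjacent_intervals
      (intervalIntegrable_initial hF.integrable hx')
      (intervalIntegrable_final hF.integrable hx')]
    ring
  refine ⟨hy.continuousOn.comp hc hmaps, (hy.continuousOn'.comp hc hmaps).neg, ?_, ?_⟩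
  · intro x hx
    simp only [sub_sub_cancel, intervalIntegral.integral_neg]
    rw [key (hy.isPrimitiveOn hab) x hx]
    ring
  · intro x hx
    simp only [sub_sub_cancel]
    rw [key (hy.isPrimitiveOn' hab hq) x hx]
    ring

/-- Classical solutions of `-y'' = z y` are solutions in the integrated sense. -/
theorem of_hasDerivAt (h : ∀ x, HasDerivAt y (y' x) x)
    (h' : ∀ x, HasDerivAt y' (-z * y x) x) : IsSolutionOn 0 z a b y y' := by
  have hc : Continuous y := continuous_iff_continuousAt.2 fun x => (h x).continuousAt
  have hc' : Continuous y' := continuous_iff_continuousAt.2 fun x => (h' x).continuousAt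
  refine ⟨hc.continuousOn, hc'.continuousOn, (IsPrimitiveOn.of_hasDerivAt h hc').eq, fun x hx => ?_⟩
  have := (IsPrimitiveOn.of_hasDerivAt (a := a) (b := b) h' (by fun_prop)).eq x hx
  simpa using this

end IsSolutionOn

/-- Gronwall's inequality with an integrable weight. -/
theorem le_mul_exp_of_le_add_integral {v g : ℝ → ℝ} {a b A : ℝ} (hA : 0 ≤ A)
    (hv : ContinuousOn v (Icc a b)) (hg : IntervalIntegrable g volume a b) (hg0 : ∀ t, 0 ≤ g t)
    (h : ∀ x ∈ Icc a b, v x ≤ A + ∫ t in a..x, g t * v t) {x : ℝ} (hx : x ∈ Icc a b) :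
    v x ≤ A * Real.exp (∫ t in a..b, g t) := by
  obtain ⟨M, hM⟩ := isCompact_Icc.bddAbove_image hv
  have hM' : ∀ t ∈ Icc a b, v t ≤ M := fun t ht => hM (mem_image_of_mem v ht)
  set G : ℝ → ℝ := fun x => ∫ t in a..x, g t with hG
  have hG0 : ∀ t ∈ Icc a b, 0 ≤ G t := fun t ht =>
    intervalIntegral.integral_nonneg ht.1 fun _ _ => hg0 _
  -- the inequality `h` iterated `n` times
  have key (n : ℕ) : ∀ x ∈ Icc a b,
      v x ≤ A * ∑ k ∈ Finset.range n, G x ^ k / k.factorial + M * (G x ^ n / n.factorial) := by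
    induction n with
    | zero => intro x hx; simpa using hM' x hx
    | succ n ih =>
      intro x hx
      have hgx := intervalIntegrable_initial hg hx
      have hsub : uIcc a x ⊆ Icc a b := by
        rw [uIcc_of_le hx.1]; exact Icc_subset_Icc le_rfl hx.2
      have hGc : ContinuousOn G (uIcc a x) :=
        intervalIntegral.continuousOn_primitive_interval' hgx left_mem_uIcc
      have hk (k : ℕ) : IntervalIntegrable (fun t => g t * (G t ^ k / k.factorial)) volume a x :=
        hgx.mul_continuousOn ((hGc.pow k).div_const _)
      have hval (k : ℕ) : ∫ t in a..x, g t * (G t ^ k / k.factorial)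
          = G x ^ (k + 1) / (k + 1).factorial := by
        have := integral_mul_primitive_pow hgx k
        simp_rw [← mul_div_assoc]
        rw [intervalIntegral.integral_div, this, Nat.factorial_succ]
        push_cast
        field_simp
        rfl
      have e : ∀ t, g t * (A * ∑ k ∈ Finset.range n, G t ^ k / k.factorial
          + M * (G t ^ n / n.factorial)) = A * ∑ k ∈ Finset.range n, g t * (G t ^ k / k.factorial)
          + M * (g t * (G t ^ n / n.factorial)) := fun t => by
        rw [mul_add, ← Finset.mul_sum]; ring
      have hs : IntervalIntegrable
          (fun t => ∑ k ∈ Finset.range n, g t * (G t ^ k / k.factorial)) volume a x := by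
        have := IntervalIntegrable.sum (Finset.range n) (f := fun k t =>
          g t * (G t ^ k / k.factorial)) (μ := volume) (a := a) (b := x) fun k _ => hk k
        convert! this using 1
        ext t; simp
      refine (h x hx).trans ?_
      have hle : ∫ t in a..x, g t * v t ≤ ∫ t in a..x, g t * (A * ∑ k ∈ Finset.range n,
          G t ^ k / k.factorial + M * (G t ^ n / n.factorial)) := by
        refine intervalIntegral.integral_mono_on hx.1 (hgx.mul_continuousOn (hv.mono hsub)) ?_ ?_
        · simp_rw [e]; exact (hs.const_mul A).add ((hk n).const_mul M)
        · intro t ht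
          exact mul_le_mul_of_nonneg_left (ih t ⟨ht.1, ht.2.trans hx.2⟩) (hg0 t)
      simp_rw [e] at hle
      rw [intervalIntegral.integral_add (hs.const_mul A) ((hk n).const_mul M),
        intervalIntegral.integral_const_mul, intervalIntegral.integral_const_mul,
        intervalIntegral.integral_finsetSum fun k _ => hk k, hval] at hle
      simp_rw [hval] at hle
      rw [Finset.sum_range_succ']
      simp only [pow_zero, Nat.factorial_zero, Nat.cast_one, div_one]
      linarith
  have hlim : Tendsto (fun n : ℕ => A * Real.exp (G x) + M * (G x ^ n / n.factorial)) atTop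
      (𝓝 (A * Real.exp (G x) + M * 0)) :=
    tendsto_const_nhds.add ((FloorSemiring.tendsto_pow_div_factorial_atTop (G x)).const_mul M)
  have h1 : v x ≤ A * Real.exp (G x) + M * 0 := by
    refine ge_of_tendsto' hlim fun n => (key n x hx).trans ?_
    have := Real.sum_le_exp_of_nonneg (hG0 x hx) n
    gcongr
  rw [mul_zero, add_zero] at h1
  refine h1.trans ?_
  have hGx : G x ≤ G b := intervalIntegral.integral_mono_interval le_rfl hx.1 hx.2
    (Eventually.of_forall hg0) hg
  gcongr

namespace IsSolutionOn

variable {q p : ℝ → ℂ} {z ζ : ℂ} {a b : ℝ} {y y' w w' : ℝ → ℂ}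

/-- A bound for solutions that is locally uniform in the spectral parameter. -/
theorem norm_add_norm_le (hab : a ≤ b) (hq : IntervalIntegrable q volume a b)
    (hy : IsSolutionOn q z a b y y') {x : ℝ} (hx : x ∈ Icc a b) :
    ‖y x‖ + ‖y' x‖ ≤ (‖y a‖ + ‖y' a‖) * Real.exp (∫ t in a..b, (1 + ‖z‖ + ‖q t‖)) := by
  have hg : IntervalIntegrable (fun t => 1 + ‖z‖ + ‖q t‖) volume a b :=
    intervalIntegrable_const.add hq.norm
  have hvc : ContinuousOn (fun t => ‖y t‖ + ‖y' t‖) (Icc a b) :=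
    hy.continuousOn.norm.add hy.continuousOn'.norm
  refine le_mul_exp_of_le_add_integral (v := fun t => ‖y t‖ + ‖y' t‖) (by positivity) hvc
    hg (fun t => by positivity) (fun x hx => ?_) hx
  have hP := hy.isPrimitiveOn hab
  have hP' := hy.isPrimitiveOn' hab hq
  have i1 := intervalIntegrable_initial hP.integrable hx
  have i2 := intervalIntegrable_initial hP'.integrable hx
  have hsub : uIcc a x ⊆ Icc a b := by
    rw [uIcc_of_le hx.1]; exact Icc_subset_Icc le_rfl hx.2
  have h1 : ‖y x‖ ≤ ‖y a‖ + ∫ t in a..x, ‖y' t‖ := by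
    rw [hP.eq x hx]
    exact (norm_add_le _ _).trans
      (by gcongr; exact intervalIntegral.norm_integral_le_integral_norm hx.1)
  have h2 : ‖y' x‖ ≤ ‖y' a‖ + ∫ t in a..x, ‖(q t - z) * y t‖ := by
    rw [hP'.eq x hx]
    exact (norm_add_le _ _).trans
      (by gcongr; exact intervalIntegral.norm_integral_le_integral_norm hx.1)
  have h3 : (∫ t in a..x, ‖y' t‖) + ∫ t in a..x, ‖(q t - z) * y t‖
      ≤ ∫ t in a..x, (1 + ‖z‖ + ‖q t‖) * (‖y t‖ + ‖y' t‖) := by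
    rw [← intervalIntegral.integral_add i1.norm i2.norm]
    refine intervalIntegral.integral_mono_on hx.1 (i1.norm.add i2.norm)
      ((intervalIntegrable_initial hg hx).mul_continuousOn (hvc.mono hsub)) fun t _ => ?_
    rw [norm_mul]
    have := norm_sub_le (q t) z
    have := norm_nonneg (y t)
    have := norm_nonneg (y' t)
    have := norm_nonneg (q t)
    have := norm_nonneg z
    have := mul_le_mul_of_nonneg_right (norm_sub_le (q t) z) (norm_nonneg (y t))
    nlinarith [mul_nonneg (norm_nonneg (q t)) (norm_nonneg (y' t)),
      mul_nonneg (norm_nonneg z) (norm_nonneg (y' t))]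
  linarith

/-- Expansion of a solution with spectral parameter `z` in the fundamental system `C`, `S` at the
left end with spectral parameter `ζ` (variation of constants). -/
theorem eq_add_integral (hab : a ≤ b) (hq : IntervalIntegrable q volume a b)
    {C C' S S' : ℝ → ℂ} (hC : IsSolutionOn q ζ a b C C') (hS : IsSolutionOn q ζ a b S S')
    (hC0 : C a = 1) (hC0' : C' a = 0) (hS0 : S a = 0) (hS0' : S' a = 1)
    (hy : IsSolutionOn q z a b y y') {x : ℝ} (hx : x ∈ Icc a b) :
    y x = C x * (y a + (z - ζ) * ∫ t in a..x, y t * S t)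
        + S x * (y' a - (z - ζ) * ∫ t in a..x, y t * C t) ∧
      y' x = C' x * (y a + (z - ζ) * ∫ t in a..x, y t * S t)
        + S' x * (y' a - (z - ζ) * ∫ t in a..x, y t * C t) := by
  have hW := hC.wronskian_eq hab hq hS hx
  have hA := (hy.lagrange hab hq hq hS).eq x hx
  have hB := (hy.lagrange hab hq hq hC).eq x hx
  have e (w : ℝ → ℂ) : (fun t => ((q t - ζ) - (q t - z)) * (y t * w t))
      = fun t => (z - ζ) * (y t * w t) := by ext t; ring
  simp only [hS0, hS0', hC0, hC0', e, intervalIntegral.integral_const_mul, mul_zero, mul_one,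
    sub_zero, zero_sub] at hA hB hW
  constructor
  · linear_combination (-y x) * hW + C x * hA - S x * hB
  · linear_combination (-y' x) * hW + C' x * hA - S' x * hB

/-- A solution is determined by its initial data and the fundamental system. -/
theorem eq_fundamental (hab : a ≤ b) (hq : IntervalIntegrable q volume a b)
    {C C' S S' : ℝ → ℂ} (hC : IsSolutionOn q z a b C C') (hS : IsSolutionOn q z a b S S')
    (hC0 : C a = 1) (hC0' : C' a = 0) (hS0 : S a = 0) (hS0' : S' a = 1)
    (hy : IsSolutionOn q z a b y y') {x : ℝ} (hx : x ∈ Icc a b) :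
    y x = y a * C x + y' a * S x ∧ y' x = y a * C' x + y' a * S' x := by
  obtain ⟨h1, h2⟩ := eq_add_integral hab hq hC hS hC0 hC0' hS0 hS0' hy hx
  rw [h1, h2]
  constructor <;> ring

end IsSolutionOn

/-! ### Analytic dependence on the spectral parameter -/

/-- Solutions with initial data independent of the spectral parameter are entire functions of it.
Near `ζ` the solution is expanded in the fundamental system at `ζ`; the factor `z - ζ` in
`IsSolutionOn.eq_add_integral` gives first continuity and then the difference quotient. -/
theorem differentiable_of_initial_const {q : ℝ → ℂ} {a b : ℝ} (hab : a ≤ b)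
    (hq : IntervalIntegrable q volume a b) {Y Y' : ℂ → ℝ → ℂ}
    (hY : ∀ z, IsSolutionOn q z a b (Y z) (Y' z)) {c c' : ℂ} (h0 : ∀ z, Y z a = c)
    (h0' : ∀ z, Y' z a = c') {x : ℝ} (hx : x ∈ Icc a b) :
    Differentiable ℂ (fun z => Y z x) ∧ Differentiable ℂ (fun z => Y' z x) := by
  refine forall_and.1 fun ζ => ?_
  obtain ⟨C, C', ⟨hC, hC0, hC0'⟩, -⟩ := exists_isSolutionOn hab hq ζ 1 0
  obtain ⟨S, S', ⟨hS, hS0, hS0'⟩, -⟩ := exists_isSolutionOn hab hq ζ 0 1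
  have hrep (z : ℂ) {t : ℝ} (ht : t ∈ Icc a b) :=
    IsSolutionOn.eq_add_integral hab hq hC hS hC0 hC0' hS0 hS0' (hY z) ht
  set B : ℝ := (‖c‖ + ‖c'‖) * Real.exp (∫ t in a..b, (1 + (‖ζ‖ + 1) + ‖q t‖)) with hB
  have hbound : ∀ᶠ z in 𝓝 ζ, ∀ t ∈ Icc a b, ‖Y z t‖ ≤ B := by
    filter_upwards [Metric.ball_mem_nhds ζ one_pos] with z hz t ht
    have h1 := (hY z).norm_add_norm_le hab hq ht
    rw [h0, h0'] at h1
    refine (le_add_of_nonneg_right (norm_nonneg _)).trans (h1.trans ?_)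
    have hz' : ‖z‖ ≤ ‖ζ‖ + 1 := by
      have := norm_sub_norm_le z ζ
      rw [mem_ball_iff_norm] at hz
      linarith
    rw [hB]
    gcongr ?_ * Real.exp ?_
    refine intervalIntegral.integral_mono_on hab ?_ ?_ fun t _ => by gcongr
    · exact intervalIntegrable_const.add hq.norm
    · exact intervalIntegrable_const.add hq.norm
  have hbC : ∃ M, ∀ t ∈ Icc a b, ‖C t‖ ≤ M :=
    isCompact_Icc.exists_bound_of_continuousOn hC.continuousOn
  have hbS : ∃ M, ∀ t ∈ Icc a b, ‖S t‖ ≤ M :=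
    isCompact_Icc.exists_bound_of_continuousOn hS.continuousOn
  -- integrals of solutions against a fixed continuous function stay bounded near `ζ`
  have hIbd {w : ℝ → ℂ} (hw : ∃ M, ∀ t ∈ Icc a b, ‖w t‖ ≤ M) :
      ∃ K, ∀ t ∈ Icc a b, ∀ᶠ z in 𝓝 ζ, ‖∫ s in a..t, Y z s * w s‖ ≤ K := by
    obtain ⟨M, hM⟩ := hw
    have hM0 : 0 ≤ M := (norm_nonneg _).trans (hM a ⟨le_rfl, hab⟩)
    refine ⟨B * M * (b - a), fun t ht => ?_⟩
    filter_upwards [hbound] with z hz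
    refine (intervalIntegral.norm_integral_le_of_norm_le_const (C := B * M) fun s hs => ?_).trans ?_
    · rw [uIoc_of_le ht.1] at hs
      have hs' : s ∈ Icc a b := ⟨hs.1.le, hs.2.trans ht.2⟩
      rw [norm_mul]
      exact mul_le_mul (hz s hs') (hM s hs') (norm_nonneg _) ((norm_nonneg _).trans (hz s hs'))
    · have hB0 : 0 ≤ B := by positivity
      rw [abs_of_nonneg (by linarith [ht.1])]
      gcongr
      exact ht.2
  have hsmall {w : ℝ → ℂ} (hw : ∃ M, ∀ t ∈ Icc a b, ‖w t‖ ≤ M) {t : ℝ} (ht : t ∈ Icc a b) :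
      Tendsto (fun z => (z - ζ) * ∫ s in a..t, Y z s * w s) (𝓝 ζ) (𝓝 0) := by
    obtain ⟨K, hK⟩ := hIbd hw
    have h1 : Tendsto (fun z : ℂ => ‖z - ζ‖ * K) (𝓝 ζ) (𝓝 0) := by
      have : Continuous fun z : ℂ => ‖z - ζ‖ * K := by fun_prop
      simpa using this.tendsto ζ
    refine squeeze_zero_norm' ?_ h1
    filter_upwards [hK t ht] with z hz
    rw [norm_mul]
    gcongr
  have hcont {t : ℝ} (ht : t ∈ Icc a b) : Tendsto (fun z => Y z t) (𝓝 ζ) (𝓝 (Y ζ t)) := by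
    have h1 : Tendsto (fun z => C t * (c + (z - ζ) * ∫ s in a..t, Y z s * S s)
        + S t * (c' - (z - ζ) * ∫ s in a..t, Y z s * C s)) (𝓝 ζ)
        (𝓝 (C t * (c + 0) + S t * (c' - 0))) :=
      ((tendsto_const_nhds.add (hsmall hbS ht)).const_mul _).add
        ((tendsto_const_nhds.sub (hsmall hbC ht)).const_mul _)
    have e := (hrep ζ ht).1
    simp only [sub_self, zero_mul, h0, h0'] at e
    rw [← e] at h1
    refine h1.congr fun z => ?_
    rw [(hrep z ht).1, h0, h0']
  have hint {w : ℝ → ℂ} (hwc : ContinuousOn w (Icc a b)) (hw : ∃ M, ∀ t ∈ Icc a b, ‖w t‖ ≤ M) :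
      Tendsto (fun z => ∫ s in a..x, Y z s * w s) (𝓝 ζ) (𝓝 (∫ s in a..x, Y ζ s * w s)) := by
    obtain ⟨M, hM⟩ := hw
    have hmem {s : ℝ} (hs : s ∈ uIoc a x) : s ∈ Icc a b := by
      rw [uIoc_of_le hx.1] at hs; exact ⟨hs.1.le, hs.2.trans hx.2⟩
    refine intervalIntegral.tendsto_integral_filter_of_dominated_convergence (fun _ => B * M)
      (Eventually.of_forall fun z => ?_) ?_ intervalIntegrable_const
      (Eventually.of_forall fun s hs => ?_)
    · exact (((hY z).continuousOn.mul hwc).mono fun s hs => hmem hs).aestronglyMeasurable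
        measurableSet_uIoc
    · filter_upwards [hbound] with z hz
      refine Eventually.of_forall fun s hs => ?_
      rw [norm_mul]
      exact mul_le_mul (hz s (hmem hs)) (hM s (hmem hs)) (norm_nonneg _)
        ((norm_nonneg _).trans (hz s (hmem hs)))
    · exact (hcont (hmem hs)).mul_const _
  -- the difference quotient, in closed form
  have hslope (D E : ℂ) (f : ℂ → ℂ) (hf : ∀ z, f z = D * (c + (z - ζ) * ∫ t in a..x, Y z t * S t)
        + E * (c' - (z - ζ) * ∫ t in a..x, Y z t * C t)) : DifferentiableAt ℂ f ζ := by
    have h1 : Tendsto (fun z => D * (∫ t in a..x, Y z t * S t) - E * ∫ t in a..x, Y z t * C t)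
        (𝓝[≠] ζ) (𝓝 (D * (∫ t in a..x, Y ζ t * S t) - E * ∫ t in a..x, Y ζ t * C t)) :=
      (((hint hS.continuousOn hbS).const_mul D).sub
        ((hint hC.continuousOn hbC).const_mul E)).mono_left nhdsWithin_le_nhds
    refine (hasDerivAt_iff_tendsto_slope.2 (h1.congr' ?_)).differentiableAt
    filter_upwards [self_mem_nhdsWithin] with z hz
    have hz' : z - ζ ≠ 0 := sub_ne_zero.2 hz
    rw [slope_def_field, eq_div_iff hz', hf z, hf ζ]
    ring
  refine ⟨hslope (C x) (S x) _ fun z => ?_, hslope (C' x) (S' x) _ fun z => ?_⟩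
  · rw [(hrep z hx).1, h0, h0']
  · rw [(hrep z hx).2, h0, h0']

/-- Solutions whose initial data are entire functions of the spectral parameter are entire. -/
theorem differentiable_of_initial {q : ℝ → ℂ} {a b : ℝ} (hab : a ≤ b)
    (hq : IntervalIntegrable q volume a b) {Y Y' : ℂ → ℝ → ℂ}
    (hY : ∀ z, IsSolutionOn q z a b (Y z) (Y' z)) (h0 : Differentiable ℂ fun z => Y z a)
    (h0' : Differentiable ℂ fun z => Y' z a) {x : ℝ} (hx : x ∈ Icc a b) :
    Differentiable ℂ (fun z => Y z x) ∧ Differentiable ℂ (fun z => Y' z x) := by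
  choose C C' hC using fun z => exists_isSolutionOn hab hq z 1 0
  choose S S' hS using fun z => exists_isSolutionOn hab hq z 0 1
  have dC := differentiable_of_initial_const hab hq (fun z => (hC z).1.1) (fun z => (hC z).1.2.1)
    (fun z => (hC z).1.2.2) hx
  have dS := differentiable_of_initial_const hab hq (fun z => (hS z).1.1) (fun z => (hS z).1.2.1)
    (fun z => (hS z).1.2.2) hx
  have e (z : ℂ) := IsSolutionOn.eq_fundamental hab hq (hC z).1.1 (hS z).1.1 (hC z).1.2.1
    (hC z).1.2.2 (hS z).1.2.1 (hS z).1.2.2 (hY z) hx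
  constructor
  · rw [funext fun z => (e z).1]
    exact (h0.mul dC.1).add (h0'.mul dS.1)
  · rw [funext fun z => (e z).2]
    exact (h0.mul dC.2).add (h0'.mul dS.2)

/-! ### Asymptotics for large spectral parameters -/

namespace IsSolutionOn

variable {q : ℝ → ℂ} {ρ : ℂ} {a b : ℝ} {y y' : ℝ → ℂ}

/-- The integral equations that a solution with spectral parameter `ρ²` satisfies. -/
theorem integral_equation (hab : a ≤ b) (hq : IntervalIntegrable q volume a b) (hρ : ρ ≠ 0)
    (hy : IsSolutionOn q (ρ ^ 2) a b y y') {x : ℝ} (hx : x ∈ Icc a b) :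
    y x = y a * Complex.cos (ρ * (x - a)) + y' a / ρ * Complex.sin (ρ * (x - a))
        + (∫ t in a..x, q t * y t * Complex.sin (ρ * (x - t))) / ρ ∧
      y' x = -(ρ * (y a * Complex.sin (ρ * (x - a)))) + y' a * Complex.cos (ρ * (x - a))
        + ∫ t in a..x, q t * y t * Complex.cos (ρ * (x - t)) := by
  have d0 (t : ℝ) : HasDerivAt (fun s : ℝ => ρ * ((x : ℂ) - s)) (-ρ) t := by
    simpa using (((hasDerivAt_id t).ofReal_comp.const_sub (x : ℂ)).const_mul ρ)
  have hs : IsSolutionOn 0 (ρ ^ 2) a b (fun t => Complex.sin (ρ * (x - t)))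
      (fun t => -ρ * Complex.cos (ρ * (x - t))) :=
    .of_hasDerivAt (fun t => (Complex.hasDerivAt_sin _).scomp t (d0 t)) (fun t => by
      convert! ((Complex.hasDerivAt_cos _).scomp t (d0 t)).const_mul (-ρ) using 1
      simp only [smul_eq_mul]; ring)
  have hc : IsSolutionOn 0 (ρ ^ 2) a b (fun t => Complex.cos (ρ * (x - t)))
      (fun t => ρ * Complex.sin (ρ * (x - t))) :=
    .of_hasDerivAt (fun t => by
      convert! (Complex.hasDerivAt_cos _).scomp t (d0 t) using 1
      simp only [smul_eq_mul]; ring) (fun t => by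
      convert! ((Complex.hasDerivAt_sin _).scomp t (d0 t)).const_mul ρ using 1
      simp only [smul_eq_mul]; ring)
  have h0 : IntervalIntegrable (0 : ℝ → ℂ) volume a b := intervalIntegrable_const
  have hS := (hy.lagrange hab hq h0 hs).eq x hx
  have hC := (hy.lagrange hab hq h0 hc).eq x hx
  have e (w : ℝ → ℂ) : ∫ t in a..x, (((0 : ℝ → ℂ) t - ρ ^ 2) - (q t - ρ ^ 2)) * (y t * w t)
      = -∫ t in a..x, q t * y t * w t := by
    rw [← intervalIntegral.integral_neg]
    congr 1; ext t; simp only [Pi.zero_apply]; ring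
  rw [e] at hS hC
  simp only [sub_self, mul_zero, Complex.sin_zero, Complex.cos_zero, mul_one] at hS hC
  constructor
  · field_simp
    linear_combination -hS
  · linear_combination -hC

variable (q a b) in
/-- The constant `exp ‖q‖₁` in the bounds for solutions. -/
noncomputable def boundConst : ℝ := Real.exp (∫ t in a..b, ‖q t‖)

theorem boundConst_pos : 0 < boundConst q a b := Real.exp_pos _

theorem norm_trig_le (ρ : ℂ) {x t : ℝ} (h : t ≤ x) :
    ‖Complex.cos (ρ * (x - t))‖ ≤ Real.exp (|ρ.im| * (x - t)) ∧
      ‖Complex.sin (ρ * (x - t))‖ ≤ Real.exp (|ρ.im| * (x - t)) := by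
  have e : |(ρ * ((x : ℂ) - t)).im| = |ρ.im| * (x - t) := by
    rw [← Complex.ofReal_sub, Complex.im_mul_ofReal, abs_mul, abs_of_nonneg (sub_nonneg.2 h)]
  exact ⟨e ▸ norm_cos_le_exp _, e ▸ norm_sin_le_exp _⟩

/-- The exponential bound for solutions with spectral parameter `ρ²`: Gronwall's inequality for
`‖y x‖ exp(-|Im ρ| (x - a))`. The initial value of `y'` enters with the weight `1 / ρ`. -/
theorem norm_le (hab : a ≤ b) (hq : IntervalIntegrable q volume a b) (hρ : 1 ≤ ‖ρ‖)
    (hy : IsSolutionOn q (ρ ^ 2) a b y y') {A : ℝ} (hA : ‖y a‖ + ‖y' a‖ / ‖ρ‖ ≤ A) {x : ℝ}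
    (hx : x ∈ Icc a b) :
    ‖y x‖ ≤ A * boundConst q a b * Real.exp (|ρ.im| * (x - a)) := by
  have hρ0 : ρ ≠ 0 := norm_pos_iff.1 (by linarith)
  have hA0 : 0 ≤ A := le_trans (by positivity) hA
  have hec : Continuous fun t : ℝ => Real.exp (-(|ρ.im| * (t - a))) := by fun_prop
  have key := le_mul_exp_of_le_add_integral
    (v := fun t => ‖y t‖ * Real.exp (-(|ρ.im| * (t - a)))) (g := fun t => ‖q t‖) hA0
    (hy.continuousOn.norm.mul hec.continuousOn) hq.norm (fun _ => norm_nonneg _) (fun x hx => ?_) hx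
  · have h1 : Real.exp (-(|ρ.im| * (x - a))) * Real.exp (|ρ.im| * (x - a)) = 1 := by
      rw [← Real.exp_add]; simp
    calc ‖y x‖ = ‖y x‖ * Real.exp (-(|ρ.im| * (x - a))) * Real.exp (|ρ.im| * (x - a)) := by
          rw [mul_assoc, h1, mul_one]
      _ ≤ A * Real.exp (∫ t in a..b, ‖q t‖) * Real.exp (|ρ.im| * (x - a)) :=
          mul_le_mul_of_nonneg_right key (Real.exp_pos _).le
  · have hsub : uIcc a x ⊆ Icc a b := by
      rw [uIcc_of_le hx.1]; exact Icc_subset_Icc le_rfl hx.2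
    have hqx := intervalIntegrable_initial hq hx
    rw [← le_div_iff₀ (Real.exp_pos _), Real.exp_neg, div_inv_eq_mul, add_mul,
      (hy.integral_equation hab hq hρ0 hx).1]
    have ht := norm_trig_le ρ hx.1
    refine (norm_add_le _ _).trans (add_le_add ?_ ?_)
    · calc _ ≤ ‖y a‖ * Real.exp (|ρ.im| * (x - a))
            + ‖y' a‖ / ‖ρ‖ * Real.exp (|ρ.im| * (x - a)) := by
            refine (norm_add_le _ _).trans ?_
            rw [norm_mul, norm_mul, norm_div]
            gcongr
            exacts [ht.1, ht.2]
        _ ≤ _ := by rw [← add_mul]; gcongr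
    · rw [norm_div, ← intervalIntegral.integral_mul_const]
      refine (div_le_self (norm_nonneg _) hρ).trans ?_
      refine intervalIntegral.norm_integral_le_of_norm_le hx.1
        (Eventually.of_forall fun t ht => ?_) ?_
      · have ht' := (norm_trig_le ρ ht.2).2
        have e : Real.exp (-(|ρ.im| * (t - a))) * Real.exp (|ρ.im| * (x - a))
            = Real.exp (|ρ.im| * (x - t)) := by
          rw [← Real.exp_add]; congr 1; ring
        rw [norm_mul, norm_mul, mul_assoc, mul_assoc, mul_assoc, e]
        gcongr
      · exact (hqx.norm.mul_continuousOn
          ((hy.continuousOn.norm.mul hec.continuousOn).mono hsub)).mul_const _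

/-- The deviation of a solution from the solution of `-y'' = ρ² y` with the same initial data is
smaller than the bound in `norm_le` by a factor `O(1 / ρ)`. -/
theorem norm_sub_le (hab : a ≤ b) (hq : IntervalIntegrable q volume a b) (hρ : 1 ≤ ‖ρ‖)
    (hy : IsSolutionOn q (ρ ^ 2) a b y y') {A : ℝ} (hA : ‖y a‖ + ‖y' a‖ / ‖ρ‖ ≤ A) {x : ℝ}
    (hx : x ∈ Icc a b) :
    ‖y x - (y a * Complex.cos (ρ * (x - a)) + y' a / ρ * Complex.sin (ρ * (x - a)))‖
        ≤ A * boundConst q a b * (∫ t in a..b, ‖q t‖) * Real.exp (|ρ.im| * (x - a)) / ‖ρ‖ ∧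
      ‖y' x - (-(ρ * (y a * Complex.sin (ρ * (x - a)))) + y' a * Complex.cos (ρ * (x - a)))‖
        ≤ A * boundConst q a b * (∫ t in a..b, ‖q t‖) * Real.exp (|ρ.im| * (x - a)) := by
  have hρ0 : ρ ≠ 0 := norm_pos_iff.1 (by linarith)
  have hA0 : 0 ≤ A := le_trans (by positivity) hA
  have hK := boundConst_pos (q := q) (a := a) (b := b)
  have hqx := intervalIntegrable_initial hq hx
  have hle : ∫ t in a..x, ‖q t‖ ≤ ∫ t in a..b, ‖q t‖ :=
    intervalIntegral.integral_mono_interval le_rfl hx.1 hx.2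
      (Eventually.of_forall fun _ => norm_nonneg _) hq.norm
  have key (w : ℝ → ℂ) (hw : ∀ t ≤ x, ‖w t‖ ≤ Real.exp (|ρ.im| * (x - t))) :
      ‖∫ t in a..x, q t * y t * w t‖
        ≤ A * boundConst q a b * (∫ t in a..b, ‖q t‖) * Real.exp (|ρ.im| * (x - a)) := by
    have h1 : ‖∫ t in a..x, q t * y t * w t‖
        ≤ ∫ t in a..x, ‖q t‖ * (A * boundConst q a b * Real.exp (|ρ.im| * (x - a))) := by
      refine intervalIntegral.norm_integral_le_of_norm_le hx.1
        (Eventually.of_forall fun t ht => ?_) (hqx.norm.mul_const _)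
      have hyt := hy.norm_le hab hq hρ hA (x := t) ⟨ht.1.le, ht.2.trans hx.2⟩
      have e : Real.exp (|ρ.im| * (x - a))
          = Real.exp (|ρ.im| * (t - a)) * Real.exp (|ρ.im| * (x - t)) := by
        rw [← Real.exp_add]; congr 1; ring
      rw [norm_mul, norm_mul, e, ← mul_assoc (A * _), mul_assoc ‖q t‖]
      have := hw t ht.2
      gcongr
    refine h1.trans ?_
    rw [intervalIntegral.integral_mul_const]
    calc _ ≤ (∫ t in a..b, ‖q t‖) * (A * boundConst q a b * Real.exp (|ρ.im| * (x - a))) := by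
          gcongr
      _ = _ := by ring
  obtain ⟨h1, h2⟩ := hy.integral_equation hab hq hρ0 hx
  constructor
  · rw [h1, add_sub_cancel_left, norm_div]
    gcongr
    exact key _ fun t ht => (norm_trig_le ρ ht).2
  · rw [h2, add_sub_cancel_left]
    exact key _ fun t ht => (norm_trig_le ρ ht).1

end IsSolutionOn

/-! ### The Weyl function determines the potential -/

/-- A function that vanishes on an interval has zero derivative there, everywhere if the derivative
is continuous. -/
theorem IsPrimitiveOn.eq_zero_of_continuousOn {F f : ℝ → ℂ} {a b : ℝ} (hab : a < b)
    (hF : IsPrimitiveOn F f a b) (h : ∀ x ∈ Icc a b, F x = 0) (hf : ContinuousOn f (Icc a b)) :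
    ∀ x ∈ Icc a b, f x = 0 :=
  Measure.eqOn_Icc_of_ae_eq volume hab.ne
    ((ae_restrict_iff' measurableSet_Icc).2 (hF.ae_eq_zero h)) hf continuousOn_const

/-- If the quotients `C / S` and `Ct / St` of the fundamental solutions of two equations agree, for
a single spectral parameter, then the fundamental solutions and the potentials agree. With
`k = C St' - S Ct'`, the derivative of the assumption `C St = Ct S` and the two Wronskians give
`k² = 1`; as `k` is continuously differentiable, `k' = 0` and `k = 1`. -/
theorem fundamental_eq_of_cross_eq {q p : ℝ → ℂ} {z : ℂ} {a b : ℝ} (hab : a < b)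
    (hq : IntervalIntegrable q volume a b) (hp : IntervalIntegrable p volume a b)
    {C C' S S' Ct Ct' St St' : ℝ → ℂ}
    (hC : IsSolutionOn q z a b C C') (hC0 : C a = 1) (hC0' : C' a = 0)
    (hS : IsSolutionOn q z a b S S') (hS0 : S a = 0) (hS0' : S' a = 1)
    (hCt : IsSolutionOn p z a b Ct Ct') (hCt0 : Ct a = 1) (hCt0' : Ct' a = 0)
    (hSt : IsSolutionOn p z a b St St') (hSt0 : St a = 0) (hSt0' : St' a = 1)
    (hE : ∀ x ∈ Icc a b, C x * St x - Ct x * S x = 0) :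
    (∀ x ∈ Icc a b, C x = Ct x ∧ S x = St x ∧ C' x = Ct' x ∧ S' x = St' x) ∧
      ∀ᵐ x, x ∈ Icc a b → q x = p x := by
  have hle := hab.le
  have W : ∀ x ∈ Icc a b, C x * S' x - C' x * S x = 1 := fun x hx => by
    simpa [hC0, hC0', hS0, hS0'] using hC.wronskian_eq hle hq hS hx
  have Wt : ∀ x ∈ Icc a b, Ct x * St' x - Ct' x * St x = 1 := fun x hx => by
    simpa [hCt0, hCt0', hSt0, hSt0'] using hCt.wronskian_eq hle hp hSt hx
  have pC := hC.isPrimitiveOn hle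
  have pC' := hC.isPrimitiveOn' hle hq
  have pS := hS.isPrimitiveOn hle
  have pS' := hS.isPrimitiveOn' hle hq
  have pCt := hCt.isPrimitiveOn hle
  have pCt' := hCt.isPrimitiveOn' hle hp
  have pSt := hSt.isPrimitiveOn hle
  have pSt' := hSt.isPrimitiveOn' hle hp
  have cC := hC.continuousOn
  have cC' := hC.continuousOn'
  have cS := hS.continuousOn
  have cS' := hS.continuousOn'
  have cCt := hCt.continuousOn
  have cCt' := hCt.continuousOn'
  have cSt := hSt.continuousOn
  have cSt' := hSt.continuousOn'
  have hE' : ∀ x ∈ Icc a b,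
      (C' x * St x + C x * St' x) - (Ct' x * S x + Ct x * S' x) = 0 :=
    ((pC.mul hle pSt).sub (pCt.mul hle pS)).eq_zero_of_continuousOn hab hE
      (((cC'.mul cSt).add (cC.mul cSt')).sub ((cCt'.mul cS).add (cCt.mul cS')))
  -- the function `k` and its derivative
  have pk : IsPrimitiveOn (fun x => C x * St' x - S x * Ct' x)
      (fun x => C' x * St' x - S' x * Ct' x) a b :=
    ((pC.mul hle pSt').sub (pS.mul hle pCt')).congr
      (fun x hx => by linear_combination (p x - z) * hE x hx) hle
  have ck : ContinuousOn (fun x => C x * St' x - S x * Ct' x) (Icc a b) := pk.continuousOn hle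
  have ck' : ContinuousOn (fun x => C' x * St' x - S' x * Ct' x) (Icc a b) :=
    (cC'.mul cSt').sub (cS'.mul cCt')
  have hk2 : ∀ x ∈ Icc a b, (C x * St' x - S x * Ct' x) * (C x * St' x - S x * Ct' x) = 1 :=
    fun x hx => by
      linear_combination (C x * St' x - S x * Ct' x) * hE' x hx
        + (C x * S' x - C' x * S x) * Wt x hx + W x hx + (S' x * Ct' x - C' x * St' x) * hE x hx
  have hone : IsPrimitiveOn (fun _ => (1 : ℂ)) (fun _ => 0) a b :=
    .of_hasDerivAt (fun x => hasDerivAt_const x 1) continuous_const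
  have hkk := ((pk.mul hle pk).sub hone).eq_zero_of_continuousOn hab
    (fun x hx => by rw [hk2 x hx, sub_self])
    (((ck'.mul ck).add (ck.mul ck')).sub continuousOn_const)
  have hk' : ∀ x ∈ Icc a b, C' x * St' x - S' x * Ct' x = 0 := fun x hx => by
    linear_combination (C x * St' x - S x * Ct' x) / 2 * hkk x hx
      - (C' x * St' x - S' x * Ct' x) * hk2 x hx
  have hk : ∀ x ∈ Icc a b, C x * St' x - S x * Ct' x = 1 := fun x hx => by
    have h1 := (pk.congr (g := fun _ => 0) hk' hle).eq x hx
    simpa [hC0, hS0, hSt0'] using h1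
  have hall : ∀ x ∈ Icc a b, C x = Ct x ∧ S x = St x ∧ C' x = Ct' x ∧ S' x = St' x := by
    intro x hx
    have e := hE x hx
    have e' := hE' x hx
    have w := W x hx
    have wt := Wt x hx
    have k := hk x hx
    have k' := hk' x hx
    have b : Ct x * S' x - C' x * St x = 1 := by linear_combination k - e'
    refine ⟨?_, ?_, ?_, ?_⟩
    · linear_combination (-C x) * wt + Ct x * k - Ct' x * e
    · linear_combination (-S x) * wt + St x * k - St' x * e
    · linear_combination (-C' x) * wt + Ct' x * b + Ct x * k'
    · linear_combination (-S' x) * wt + St' x * b + St x * k'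
  refine ⟨hall, ?_⟩
  have h1 := (pC'.sub pCt').ae_eq_zero fun x hx => by rw [(hall x hx).2.2.1, sub_self]
  have h2 := (pS'.sub pSt').ae_eq_zero fun x hx => by rw [(hall x hx).2.2.2, sub_self]
  filter_upwards [h1, h2] with x e1 e2 hx
  have f1 := e1 hx
  have f2 := e2 hx
  rw [← (hall x hx).1] at f1
  rw [← (hall x hx).2.1] at f2
  linear_combination (-(q x - p x)) * W x hx + S' x * f1 - C' x * f2

/-- Solutions `y`, `w` of two equations that decay from `a` along expanding squares in the
`√z`-plane and have the same Weyl function `y' / y = w' / w` at `a`: the potentials agree, and so do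
the Weyl functions at every point. The quotients `C / S` and `Ct / St` of the fundamental solutions
are compared through the entire function `C St - Ct S`. -/
theorem potential_eq_of_weyl_eq_left {q p : ℝ → ℂ} {a b : ℝ} (hab : a < b)
    (hq : IntervalIntegrable q volume a b) (hp : IntervalIntegrable p volume a b)
    {y y' w w' : ℂ → ℝ → ℂ} (hy : ∀ z, IsSolutionOn q z a b (y z) (y' z))
    (hw : ∀ z, IsSolutionOn p z a b (w z) (w' z))
    (hW : ∀ z, y z a * w' z a = y' z a * w z a) {R : ℕ → ℝ} (hR : Tendsto R atTop atTop) {K : ℝ}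
    (hdecay : ∀ᶠ n in atTop, ∀ ρ ∈ squareBoundary (R n), ∀ x ∈ Icc a b,
      y (ρ ^ 2) a ≠ 0 ∧ w (ρ ^ 2) a ≠ 0 ∧
      ‖y (ρ ^ 2) x‖ ≤ K * Real.exp (-(|ρ.im| * (x - a))) * ‖y (ρ ^ 2) a‖ ∧
      ‖w (ρ ^ 2) x‖ ≤ K * Real.exp (-(|ρ.im| * (x - a))) * ‖w (ρ ^ 2) a‖) :
    (∀ᵐ x, x ∈ Icc a b → q x = p x) ∧
      ∀ z, ∀ x ∈ Icc a b, y z x * w' z x = y' z x * w z x := by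
  have hle := hab.le
  choose C C' hC using fun z => exists_isSolutionOn hle hq z 1 0
  choose S S' hS using fun z => exists_isSolutionOn hle hq z 0 1
  choose Ct Ct' hCt using fun z => exists_isSolutionOn hle hp z 1 0
  choose St St' hSt using fun z => exists_isSolutionOn hle hp z 0 1
  have ey (z : ℂ) {x : ℝ} (hx : x ∈ Icc a b) := IsSolutionOn.eq_fundamental hle hq (hC z).1.1
    (hS z).1.1 (hC z).1.2.1 (hC z).1.2.2 (hS z).1.2.1 (hS z).1.2.2 (hy z) hx
  have ew (z : ℂ) {x : ℝ} (hx : x ∈ Icc a b) := IsSolutionOn.eq_fundamental hle hp (hCt z).1.1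
    (hSt z).1.1 (hCt z).1.2.1 (hCt z).1.2.2 (hSt z).1.2.1 (hSt z).1.2.2 (hw z) hx
  have hE (z : ℂ) : ∀ x ∈ Icc a b, C z x * St z x - Ct z x * S z x = 0 := by
    intro x hx
    have dC := (differentiable_of_initial_const hle hq (fun z => (hC z).1.1)
      (fun z => (hC z).1.2.1) (fun z => (hC z).1.2.2) hx).1
    have dS := (differentiable_of_initial_const hle hq (fun z => (hS z).1.1)
      (fun z => (hS z).1.2.1) (fun z => (hS z).1.2.2) hx).1
    have dCt := (differentiable_of_initial_const hle hp (fun z => (hCt z).1.1)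
      (fun z => (hCt z).1.2.1) (fun z => (hCt z).1.2.2) hx).1
    have dSt := (differentiable_of_initial_const hle hp (fun z => (hSt z).1.1)
      (fun z => (hSt z).1.2.1) (fun z => (hSt z).1.2.2) hx).1
    have hG : Differentiable ℂ fun ρ : ℂ =>
        C (ρ ^ 2) x * St (ρ ^ 2) x - Ct (ρ ^ 2) x * S (ρ ^ 2) x :=
      ((dC.mul dSt).sub (dCt.mul dS)).comp (differentiable_id.pow 2)
    -- the squares live in the `ρ`-plane, where `z = ρ²`
    obtain ⟨ρ, rfl⟩ := IsAlgClosed.exists_pow_nat_eq z two_pos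
    refine eq_zero_of_norm_le_div hG hR (K := K * (IsSolutionOn.boundConst p a b
      + IsSolutionOn.boundConst q a b)) ?_ ρ
    filter_upwards [hdecay, hR.eventually_ge_atTop 1] with n hn hR1 ρ hρ
    obtain ⟨y0, w0, hyx, hwx⟩ := hn ρ hρ x hx
    have hρR := le_norm_of_mem_squareBoundary hρ
    have hρ1 : 1 ≤ ‖ρ‖ := hR1.trans hρR
    have bS := (hS (ρ ^ 2)).1.1.norm_le hle hq hρ1 (A := 1 / ‖ρ‖)
      (by simp [(hS (ρ ^ 2)).1.2.1, (hS (ρ ^ 2)).1.2.2]) hx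
    have bSt := (hSt (ρ ^ 2)).1.1.norm_le hle hp hρ1 (A := 1 / ‖ρ‖)
      (by simp [(hSt (ρ ^ 2)).1.2.1, (hSt (ρ ^ 2)).1.2.2]) hx
    have hyx' : ‖y (ρ ^ 2) x / y (ρ ^ 2) a‖ ≤ K * Real.exp (-(|ρ.im| * (x - a))) := by
      rwa [norm_div, div_le_iff₀ (norm_pos_iff.2 y0)]
    have hwx' : ‖w (ρ ^ 2) x / w (ρ ^ 2) a‖ ≤ K * Real.exp (-(|ρ.im| * (x - a))) := by
      rwa [norm_div, div_le_iff₀ (norm_pos_iff.2 w0)]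
    have hK0 : 0 ≤ K := nonneg_of_mul_nonneg_left ((norm_nonneg _).trans hyx') (Real.exp_pos _)
    -- the equality of the Weyl functions replaces `C`, `Ct` by the decaying `y / y a`, `w / w a`
    have e : C (ρ ^ 2) x * St (ρ ^ 2) x - Ct (ρ ^ 2) x * S (ρ ^ 2) x
        = y (ρ ^ 2) x / y (ρ ^ 2) a * St (ρ ^ 2) x - w (ρ ^ 2) x / w (ρ ^ 2) a * S (ρ ^ 2) x := by
      rw [(ey _ hx).1, (ew _ hx).1]
      field_simp
      linear_combination (-S (ρ ^ 2) x * St (ρ ^ 2) x) * (-hW (ρ ^ 2))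
    have hexp : Real.exp (-(|ρ.im| * (x - a))) * Real.exp (|ρ.im| * (x - a)) = 1 := by
      rw [← Real.exp_add]; simp
    calc _ ≤ K * Real.exp (-(|ρ.im| * (x - a))) * (1 / ‖ρ‖ * IsSolutionOn.boundConst p a b
            * Real.exp (|ρ.im| * (x - a))) + K * Real.exp (-(|ρ.im| * (x - a))) * (1 / ‖ρ‖
            * IsSolutionOn.boundConst q a b * Real.exp (|ρ.im| * (x - a))) := by
          rw [e]
          refine (norm_sub_le _ _).trans ?_
          rw [norm_mul, norm_mul]
          gcongr
      _ = K * (IsSolutionOn.boundConst p a b + IsSolutionOn.boundConst q a b) / ‖ρ‖ := by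
          linear_combination (K * (IsSolutionOn.boundConst p a b
            + IsSolutionOn.boundConst q a b) / ‖ρ‖) * hexp
      _ ≤ _ := by
          have h1 := IsSolutionOn.boundConst_pos (q := q) (a := a) (b := b)
          have h2 := IsSolutionOn.boundConst_pos (q := p) (a := a) (b := b)
          gcongr
  have hfund (z : ℂ) := fundamental_eq_of_cross_eq hab hq hp (hC z).1.1 (hC z).1.2.1 (hC z).1.2.2
    (hS z).1.1 (hS z).1.2.1 (hS z).1.2.2 (hCt z).1.1 (hCt z).1.2.1 (hCt z).1.2.2
    (hSt z).1.1 (hSt z).1.2.1 (hSt z).1.2.2 (hE z)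
  refine ⟨(hfund 0).2, fun z x hx => ?_⟩
  obtain ⟨h1, h2, h3, h4⟩ := (hfund z).1 x hx
  rw [(ey z hx).1, (ey z hx).2, (ew z hx).1, (ew z hx).2, h1, h2, h3, h4]
  linear_combination (Ct z x * St' z x - Ct' z x * St z x) * hW z

/-- The reflected form of `potential_eq_of_weyl_eq_left`, with the Weyl functions taken at `b`. -/
theorem potential_eq_of_weyl_eq_right {q p : ℝ → ℂ} {a b : ℝ} (hab : a < b)
    (hq : IntervalIntegrable q volume a b) (hp : IntervalIntegrable p volume a b)
    {y y' w w' : ℂ → ℝ → ℂ} (hy : ∀ z, IsSolutionOn q z a b (y z) (y' z))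
    (hw : ∀ z, IsSolutionOn p z a b (w z) (w' z))
    (hW : ∀ z, y z b * w' z b = y' z b * w z b) {R : ℕ → ℝ} (hR : Tendsto R atTop atTop) {K : ℝ}
    (hdecay : ∀ᶠ n in atTop, ∀ ρ ∈ squareBoundary (R n), ∀ x ∈ Icc a b,
      y (ρ ^ 2) b ≠ 0 ∧ w (ρ ^ 2) b ≠ 0 ∧
      ‖y (ρ ^ 2) x‖ ≤ K * Real.exp (-(|ρ.im| * (b - x))) * ‖y (ρ ^ 2) b‖ ∧
      ‖w (ρ ^ 2) x‖ ≤ K * Real.exp (-(|ρ.im| * (b - x))) * ‖w (ρ ^ 2) b‖) :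
    (∀ᵐ x, x ∈ Icc a b → q x = p x) ∧
      ∀ z, ∀ x ∈ Icc a b, y z x * w' z x = y' z x * w z x := by
  have hle := hab.le
  have hint {f : ℝ → ℂ} (hf : IntervalIntegrable f volume a b) :
      IntervalIntegrable (fun x => f (a + b - x)) volume a b := by
    have := (hf.comp_sub_left (a + b)).symm
    rwa [add_sub_cancel_right, add_sub_cancel_left] at this
  have hry (z : ℂ) := (hy z).reflect hle hq (a + b)
  have hrw (z : ℂ) := (hw z).reflect hle hp (a + b)
  simp only [add_sub_cancel_right, add_sub_cancel_left] at hry hrw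
  have hmem {x : ℝ} (hx : x ∈ Icc a b) : a + b - x ∈ Icc a b :=
    ⟨by linarith [hx.2], by linarith [hx.1]⟩
  obtain ⟨h1, h2⟩ := potential_eq_of_weyl_eq_left hab (hint hq) (hint hp) hry hrw
    (fun z => by simp only [add_sub_cancel_left]; linear_combination -hW z) hR (K := K) (by
      filter_upwards [hdecay] with n hn ρ hρ x hx
      have := hn ρ hρ (a + b - x) (hmem hx)
      rw [show b - (a + b - x) = x - a by ring] at this
      simpa only [add_sub_cancel_left] using this)
  constructor
  · have h3 := (Measure.measurePreserving_sub_left volume (a + b)).quasiMeasurePreserving.ae h1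
    filter_upwards [h3] with x hx hxI
    simpa using hx (hmem hxI)
  · intro z x hx
    have := h2 z _ (hmem hx)
    simp only [sub_sub_cancel] at this
    linear_combination -this

/-! ### Shared zeros and entire quotients -/

theorem norm_prod_sub_le (Λ : Finset ℕ) (lam : ℕ → ℂ) :
    ∃ C > 0, ∀ z : ℂ, 1 ≤ ‖z‖ → ‖∏ n ∈ Λ, (z - lam n)‖ ≤ C * ‖z‖ ^ Λ.card := by
  refine ⟨∏ n ∈ Λ, (1 + ‖lam n‖), Finset.prod_pos fun n _ => by positivity, fun z hz => ?_⟩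
  rw [norm_prod, ← Finset.prod_const, ← Finset.prod_mul_distrib]
  refine Finset.prod_le_prod (fun _ _ => norm_nonneg _) fun n _ => ?_
  have := norm_sub_le z (lam n)
  nlinarith [norm_nonneg (lam n)]

theorem card_filter_le_analyticOrderAt_prod (Λ : Finset ℕ) (lam : ℕ → ℂ) (z : ℂ) :
    ((Λ.filter fun n => lam n = z).card : ℕ∞)
      ≤ analyticOrderAt (fun w => ∏ n ∈ Λ, (w - lam n)) z := by
  have ha (s : Finset ℕ) : AnalyticAt ℂ (fun w => ∏ n ∈ s, (w - lam n)) z :=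
    Differentiable.analyticAt (by fun_prop) z
  rw [natCast_le_analyticOrderAt (ha Λ)]
  refine ⟨_, ha (Λ.filter fun n => ¬ lam n = z), Eventually.of_forall fun w => ?_⟩
  rw [← Finset.prod_filter_mul_prod_filter_not Λ fun n => lam n = z, smul_eq_mul]
  congr 1
  rw [Finset.prod_congr rfl fun n hn => by rw [(Finset.mem_filter.1 hn).2], Finset.prod_const]

/-- If all zeros of `Δ` apart from finitely many are zeros of `Δ'`, with multiplicities, then `Δ`
divides the product of `Δ'` with the polynomial of the exceptional zeros. -/
theorem exists_quotient_of_isSubsequenceOff {Δ Δ' : ℂ → ℂ} (hΔ : Differentiable ℂ Δ)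
    (hΔ' : Differentiable ℂ Δ') {eig eig' : ℂ → Prop} {lam lam' : ℕ → ℂ}
    (h : IsSpectralSequence eig Δ lam) (h' : IsSpectralSequence eig' Δ' lam')
    (hzero : ∀ z, Δ z = 0 → eig z) (hne : ∃ z, Δ z ≠ 0) {Λ : Finset ℕ}
    (hsub : IsSubsequenceOff Λ lam lam') :
    ∃ F : ℂ → ℂ, Differentiable ℂ F ∧ ∀ z, Δ' z * ∏ n ∈ Λ, (z - lam n) = F z * Δ z := by
  have hP : Differentiable ℂ fun z => ∏ n ∈ Λ, (z - lam n) := by fun_prop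
  refine exists_entire_quotient (f := fun z => Δ' z * ∏ n ∈ Λ, (z - lam n)) (hΔ'.mul hP) hΔ
    (fun z htop => ?_) fun z => ?_
  · obtain ⟨w, hw⟩ := hne
    have hA : AnalyticOnNhd ℂ Δ univ := fun z _ => hΔ.analyticAt z
    have := hA.eqOn_zero_of_preconnected_of_eventuallyEq_zero isPreconnected_univ (mem_univ z)
      (analyticOrderAt_eq_top.1 htop)
    exact hw (this (mem_univ w))
  · by_cases hz : Δ z = 0
    swap
    · rw [(hΔ.analyticAt z).analyticOrderAt_eq_zero.2 hz]
      exact zero_le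
    have e1 : analyticOrderAt (fun z => Δ' z * ∏ n ∈ Λ, (z - lam n)) z
        = analyticOrderAt Δ' z + analyticOrderAt (fun z => ∏ n ∈ Λ, (z - lam n)) z :=
      analyticOrderAt_mul (hΔ'.analyticAt z) (hP.analyticAt z)
    rw [e1, ← h.count z (hzero z hz)]
    obtain ⟨e, he, hval⟩ := hsub
    have h1 : {n | lam n = z} ⊆ {n | n ∉ Λ ∧ lam n = z} ∪ ↑(Λ.filter fun n => lam n = z) := by
      intro n hn
      by_cases hnΛ : n ∈ Λ
      · exact Or.inr (by simpa using ⟨hnΛ, hn⟩)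
      · exact Or.inl ⟨hnΛ, hn⟩
    -- the indices outside `Λ` inject into those of `lam'`; the others are zeros of the polynomial
    refine (encard_le_encard h1).trans ((encard_union_le _ _).trans (add_le_add ?_ ?_))
    · rcases eq_empty_or_nonempty {n | n ∉ Λ ∧ lam n = z} with h0 | ⟨n, hn, hnz⟩
      · simp [h0]
      · have heig : eig' z := by rw [← hnz, hval n hn]; exact h'.mem _
        rw [← h'.count z heig]
        refine encard_le_encard_of_injOn (f := e) ?_ (he.mono fun n hn => hn.1)
        intro k hk
        exact (hval k hk.1).symm.trans hk.2
    · rw [encard_coe_eq_coe_finsetCard]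
      exact card_filter_le_analyticOrderAt_prod Λ lam z

/-! ### Laplace-type integrals near the right end -/

theorem tendsto_pow_mul_exp_neg (k : ℕ) {c : ℝ} (hc : 0 < c) :
    Tendsto (fun τ : ℝ => τ ^ k * Real.exp (-(c * τ))) atTop (𝓝 0) := by
  have := Real.tendsto_pow_mul_exp_neg_atTop_nhds_zero k
  have h1 : Tendsto (fun τ : ℝ => (c * τ) ^ k * Real.exp (-(c * τ))) atTop (𝓝 0) :=
    this.comp (tendsto_id.const_mul_atTop hc)
  have h2 := h1.const_mul ((c ^ k)⁻¹)
  rw [mul_zero] at h2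
  refine h2.congr fun τ => ?_
  rw [mul_pow]
  field_simp

/-- `∫ |Q(x)| exp(-2τ(b - x)) dx = o(τ⁻ᵏ)` if `Q` is integrable and, for `k ≥ 1`,
`Q(x) = o((b - x)ᵏ⁻¹)` at `b`. -/
theorem tendsto_pow_mul_integral_exp {Q : ℝ → ℂ} {a b : ℝ} (hab : a < b)
    (hQ : IntervalIntegrable Q volume a b) (k : ℕ)
    (hk : k ≠ 0 → ∀ ε > 0, ∃ δ > 0, ∀ x ∈ Icc (b - δ) b, ‖Q x‖ ≤ ε * (b - x) ^ (k - 1)) :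
    Tendsto (fun τ : ℝ => τ ^ k * ∫ x in a..b, ‖Q x‖ * Real.exp (-(2 * τ * (b - x)))) atTop
      (𝓝 0) := by
  have hec (τ : ℝ) : Continuous fun x : ℝ => Real.exp (-(2 * τ * (b - x))) := by fun_prop
  rcases k with _ | m
  · have h0 : (0 : ℝ) = ∫ x in a..b, (0 : ℝ) := by simp
    simp only [pow_zero, one_mul]
    rw [h0]
    refine intervalIntegral.tendsto_integral_filter_of_dominated_convergence (fun x => ‖Q x‖)
      (Eventually.of_forall fun τ => ?_) ?_ hQ.norm ?_
    · exact (hQ.norm.mul_continuousOn (hec τ).continuousOn).aestronglyMeasurable_restrict_uIoc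
    · filter_upwards [eventually_ge_atTop 0] with τ hτ
      refine Eventually.of_forall fun x hx => ?_
      rw [uIoc_of_le hab.le] at hx
      rw [norm_mul, norm_norm, Real.norm_eq_abs, Real.abs_exp]
      refine mul_le_of_le_one_right (norm_nonneg _) (Real.exp_le_one_iff.2 ?_)
      have : 0 ≤ 2 * τ * (b - x) := mul_nonneg (by linarith) (by linarith [hx.2])
      linarith
    · filter_upwards [Ioo_ae_eq_Ioc (a := a) (b := b) (μ := volume)] with x hx hxI
      rw [uIoc_of_le hab.le] at hxI
      have hxo : x ∈ Ioo a b := (iff_of_eq hx).2 hxI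
      have h1 := (tendsto_pow_mul_exp_neg 0 (c := 2 * (b - x))
        (by linarith [hxo.2])).const_mul ‖Q x‖
      rw [mul_zero] at h1
      refine h1.congr fun τ => ?_
      rw [pow_zero, one_mul]
      congr 3; ring
  · rw [Metric.tendsto_atTop']
    intro ε hε
    obtain ⟨δ, hδ, hδQ⟩ := hk (by simp) (ε / (4 * m.factorial)) (by positivity)
    set c := max a (b - δ) with hc
    have hca : a ≤ c := le_max_left _ _
    have hcb : c < b := max_lt hab (by linarith)
    have hcI : c ∈ Icc a b := ⟨hca, hcb.le⟩
    have i1 := intervalIntegrable_initial hQ hcI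
    have i2 := intervalIntegrable_final hQ hcI
    -- on `[a, c]` the integrand is exponentially small
    have hfar := ((tendsto_pow_mul_exp_neg (m + 1) (c := 2 * (b - c)) (by linarith)).mul_const
      (∫ x in a..c, ‖Q x‖))
    rw [zero_mul] at hfar
    obtain ⟨τ₀, hτ₀⟩ := ((hfar.eventually (gt_mem_nhds (half_pos hε))).and
      (eventually_gt_atTop 0)).exists_forall_of_atTop
    refine ⟨τ₀, fun τ hτ => ?_⟩
    obtain ⟨hf1, hτ0⟩ := hτ₀ τ hτ.le
    have hint0 : 0 ≤ ∫ x in a..b, ‖Q x‖ * Real.exp (-(2 * τ * (b - x))) :=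
      intervalIntegral.integral_nonneg hab.le fun _ _ => by positivity
    rw [Real.dist_eq, sub_zero, abs_of_nonneg (by positivity),
      ← intervalIntegral.integral_add_adjacent_intervals
        (i1.norm.mul_continuousOn (hec τ).continuousOn)
        (i2.norm.mul_continuousOn (hec τ).continuousOn), mul_add]
    have b1 : τ ^ (m + 1) * ∫ x in a..c, ‖Q x‖ * Real.exp (-(2 * τ * (b - x)))
        ≤ τ ^ (m + 1) * Real.exp (-(2 * (b - c) * τ)) * ∫ x in a..c, ‖Q x‖ := by
      rw [mul_assoc (τ ^ (m + 1)),
        ← intervalIntegral.integral_const_mul (Real.exp (-(2 * (b - c) * τ)))]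
      refine mul_le_mul_of_nonneg_left ?_ (by positivity)
      refine intervalIntegral.integral_mono_on hca
        (i1.norm.mul_continuousOn (hec τ).continuousOn) (i1.norm.const_mul _) fun x hx => ?_
      rw [mul_comm (Real.exp _)]
      refine mul_le_mul_of_nonneg_left (Real.exp_le_exp.2 ?_) (norm_nonneg _)
      nlinarith [hx.2]
    -- on `[c, b]`: `(τ (b - x))ᵐ exp(-τ(b - x)) ≤ m!`
    have b2 : τ ^ (m + 1) * ∫ x in c..b, ‖Q x‖ * Real.exp (-(2 * τ * (b - x))) ≤ ε / 4 := by
      have e0 : ∫ x in c..b, τ * Real.exp (-(τ * (b - x))) = 1 - Real.exp (-(τ * (b - c))) := by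
        have hd : ∀ x ∈ uIcc c b, HasDerivAt (fun x => Real.exp (-(τ * (b - x))))
            (τ * Real.exp (-(τ * (b - x)))) x := fun x _ => by
          have := ((((hasDerivAt_id x).const_sub b).const_mul τ).neg).exp
          convert! this using 1
          simp; ring
        rw [intervalIntegral.integral_eq_sub_of_hasDerivAt hd
          (Continuous.intervalIntegrable (by fun_prop) _ _)]
        simp
      calc τ ^ (m + 1) * ∫ x in c..b, ‖Q x‖ * Real.exp (-(2 * τ * (b - x)))
          ≤ ∫ x in c..b, ε / 4 * (τ * Real.exp (-(τ * (b - x)))) := by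
            rw [← intervalIntegral.integral_const_mul]
            refine intervalIntegral.integral_mono_on hcb.le
              ((i2.norm.mul_continuousOn (hec τ).continuousOn).const_mul _)
              (Continuous.intervalIntegrable (by fun_prop) _ _) fun x hx => ?_
            have hQx := hδQ x ⟨(le_max_right _ _).trans hx.1, hx.2⟩
            rw [Nat.add_sub_cancel] at hQx
            have hs : 0 ≤ τ * (b - x) := mul_nonneg hτ0.le (by linarith [hx.2])
            have hp := Real.pow_div_factorial_le_exp _ hs m
            rw [div_le_iff₀ (by positivity)] at hp
            have he : Real.exp (-(2 * τ * (b - x)))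
                = Real.exp (-(τ * (b - x))) * Real.exp (-(τ * (b - x))) := by
              rw [← Real.exp_add]; congr 1; ring
            have he1 : Real.exp (τ * (b - x)) * Real.exp (-(τ * (b - x))) = 1 := by
              rw [← Real.exp_add]; simp
            calc τ ^ (m + 1) * (‖Q x‖ * Real.exp (-(2 * τ * (b - x))))
                ≤ τ ^ (m + 1) * (ε / (4 * m.factorial) * (b - x) ^ m
                  * Real.exp (-(2 * τ * (b - x)))) := by gcongr
              _ = ε / (4 * m.factorial) * τ * ((τ * (b - x)) ^ m * Real.exp (-(τ * (b - x))))
                  * Real.exp (-(τ * (b - x))) := by rw [he, mul_pow]; ring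
              _ ≤ ε / (4 * m.factorial) * τ * (Real.exp (τ * (b - x)) * m.factorial
                  * Real.exp (-(τ * (b - x)))) * Real.exp (-(τ * (b - x))) := by gcongr
              _ = ε / (4 * m.factorial) * τ * m.factorial * Real.exp (-(τ * (b - x)))
                  * (Real.exp (τ * (b - x)) * Real.exp (-(τ * (b - x)))) := by ring
              _ = ε / 4 * (τ * Real.exp (-(τ * (b - x)))) := by rw [he1]; field_simp
        _ ≤ ε / 4 := by
            rw [intervalIntegral.integral_const_mul, e0]
            have := Real.exp_pos (-(τ * (b - c)))
            nlinarith
    linarith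

/-- Two functions that are `C^m` near `π` with the same derivatives at `π` up to order `m` differ
by `o((π - x)^m)`. -/
theorem norm_sub_le_of_isSmoothNearPi {m : ℕ} {q p : ℝ → ℂ} (hq : IsSmoothNearPi m q)
    (hp : IsSmoothNearPi m p) (h : ∀ j ≤ m, derivAtPi j q = derivAtPi j p) {ε : ℝ} (hε : 0 < ε) :
    ∃ δ > 0, ∀ x ∈ Icc (Real.pi - δ) Real.pi, ‖p x - q x‖ ≤ ε * (Real.pi - x) ^ m := by
  obtain ⟨δ₁, hδ₁, hq⟩ := hq
  obtain ⟨δ₂, hδ₂, hp⟩ := hp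
  set δ := min δ₁ δ₂ with hδ
  have hδ0 : 0 < δ := lt_min hδ₁ hδ₂
  set s := Icc (Real.pi - δ) Real.pi with hs
  have hqs : ContDiffOn ℝ m q s :=
    (hq m le_rfl).mono (Icc_subset_Icc (by linarith [min_le_left δ₁ δ₂]) le_rfl)
  have hps : ContDiffOn ℝ m p s :=
    (hp m le_rfl).mono (Icc_subset_Icc (by linarith [min_le_right δ₁ δ₂]) le_rfl)
  have hmem : Real.pi ∈ s := ⟨by linarith, le_rfl⟩
  have hset : s =ᶠ[𝓝 Real.pi] Iic Real.pi := by
    filter_upwards [Ioi_mem_nhds (show Real.pi - δ < Real.pi by linarith)] with x hx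
    exact propext ⟨fun h => h.2, fun h => ⟨(mem_Ioi.1 hx).le, h⟩⟩
  have hD (j : ℕ) (f : ℝ → ℂ) : iteratedDerivWithin j f s Real.pi = derivAtPi j f := by
    rw [derivAtPi, iteratedDerivWithin, iteratedDerivWithin, iteratedFDerivWithin_congr_set hset]
  have hT (x : ℝ) : taylorWithinEval q m s Real.pi x = taylorWithinEval p m s Real.pi x := by
    rw [taylor_within_apply, taylor_within_apply]
    refine Finset.sum_congr rfl fun j hj => ?_
    rw [hD, hD, h j (Nat.lt_succ_iff.1 (Finset.mem_range.1 hj))]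
  have ho := (taylor_isLittleO (convex_Icc _ _) hmem hps).sub
    (taylor_isLittleO (convex_Icc _ _) hmem hqs)
  have hb := ho.bound hε
  rw [eventually_nhdsWithin_iff, Metric.eventually_nhds_iff] at hb
  obtain ⟨η, hη, hb⟩ := hb
  refine ⟨min (η / 2) δ, by positivity, fun x hx => ?_⟩
  have h1 := min_le_left (η / 2) δ
  have h2 := min_le_right (η / 2) δ
  have hx1 := hx.1
  have hx2 := hx.2
  have := hb (y := x) (by rw [Real.dist_eq, abs_lt]; constructor <;> linarith)
    ⟨by linarith, hx2⟩
  rw [hT, sub_sub_sub_cancel_right, norm_pow, Real.norm_eq_abs, abs_sub_comm,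
    abs_of_nonneg (by linarith)] at this
  exact this

/-! ### The solution `φ` of the discontinuous problem -/

namespace Problem

variable (L : Problem)

theorem phi_isSolution (z : ℂ) : L.IsSolution z (L.phi z) := (L.exists_phi z).choose_spec.1

theorem phi_left_zero (z : ℂ) : (L.phi z).left 0 = 1 := (L.exists_phi z).choose_spec.2.1

theorem phi_left'_zero (z : ℂ) : (L.phi z).left' 0 = L.h := (L.exists_phi z).choose_spec.2.2

theorem q_integrable_left : IntervalIntegrable L.q volume 0 L.d :=
  intervalIntegrable_initial L.q_integrable ⟨L.d_mem.1.le, L.d_mem.2.le⟩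

theorem q_integrable_right : IntervalIntegrable L.q volume L.d Real.pi :=
  intervalIntegrable_final L.q_integrable ⟨L.d_mem.1.le, L.d_mem.2.le⟩

/-- `φ(π, z)` and `φ'(π, z)` are entire functions of `z`. -/
theorem differentiable_phi_pi : Differentiable ℂ (fun z => (L.phi z).right Real.pi) ∧
    Differentiable ℂ (fun z => (L.phi z).right' Real.pi) := by
  have hd := L.d_mem
  obtain ⟨h1, h2⟩ := differentiable_of_initial_const hd.1.le L.q_integrable_left
    (fun z => (L.phi_isSolution z).left) L.phi_left_zero L.phi_left'_zero (x := L.d)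
    ⟨hd.1.le, le_rfl⟩
  refine differentiable_of_initial hd.2.le L.q_integrable_right
    (fun z => (L.phi_isSolution z).right) ?_ ?_ ⟨hd.2.le, le_rfl⟩
  · simp_rw [fun z => (L.phi_isSolution z).jump]
    exact h1.const_mul _
  · simp_rw [fun z => (L.phi_isSolution z).jump']
    exact (h2.const_mul _).add (h1.const_mul _)

theorem differentiable_charFun : Differentiable ℂ L.charFun :=
  L.differentiable_phi_pi.2.add (L.differentiable_phi_pi.1.const_mul _)

theorem differentiable_charFunInfty : Differentiable ℂ L.charFunInfty :=
  L.differentiable_phi_pi.1.neg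

theorem isEigenvalue_of_charFun_eq_zero {z : ℂ} (hz : L.charFun z = 0) : L.IsEigenvalue z :=
  ⟨L.phi z, L.phi_isSolution z, Or.inl ⟨0, ⟨le_rfl, L.d_mem.1.le⟩, by simp [L.phi_left_zero]⟩,
    by simp [L.phi_left_zero, L.phi_left'_zero], hz⟩

theorem isEigenvalueInfty_of_charFunInfty_eq_zero {z : ℂ} (hz : L.charFunInfty z = 0) :
    L.IsEigenvalueInfty z :=
  ⟨L.phi z, L.phi_isSolution z, Or.inl ⟨0, ⟨le_rfl, L.d_mem.1.le⟩, by simp [L.phi_left_zero]⟩,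
    by simp [L.phi_left_zero, L.phi_left'_zero], neg_eq_zero.1 hz⟩

/-- The coefficient `(β + β⁻¹) / 2` of the leading term of `φ(π, ρ²)`. -/
noncomputable def b₁ : ℝ := (L.β + L.β⁻¹) / 2

/-- The coefficient `(β - β⁻¹) / 2` of the reflected term of `φ(π, ρ²)`. -/
noncomputable def b₂ : ℝ := (L.β - L.β⁻¹) / 2

theorem abs_b₂_lt : |L.b₂| < L.b₁ := by
  have h1 := L.β_pos
  have h2 := inv_pos.2 L.β_pos
  rw [b₁, b₂, abs_lt]
  constructor <;> linarith

/-- The bounds and leading terms of `φ(·, ρ²)` for large `ρ`, all with one constant `K`. -/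
structure PhiBounds (K : ℝ) (ρ : ℂ) : Prop where
  left : ∀ x ∈ Icc 0 L.d, ‖(L.phi (ρ ^ 2)).left x‖ ≤ K * Real.exp (|ρ.im| * x)
  right : ∀ x ∈ Icc L.d Real.pi, ‖(L.phi (ρ ^ 2)).right x‖ ≤ K * Real.exp (|ρ.im| * x)
  right'_d : ‖(L.phi (ρ ^ 2)).right' L.d‖ ≤ K * ‖ρ‖ * Real.exp (|ρ.im| * L.d)
  right'_pi : ‖(L.phi (ρ ^ 2)).right' Real.pi‖ ≤ K * ‖ρ‖ * Real.exp (|ρ.im| * Real.pi)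
  left_d_sub : ‖(L.phi (ρ ^ 2)).left L.d - Complex.cos (ρ * L.d)‖
    ≤ K * Real.exp (|ρ.im| * L.d) / ‖ρ‖
  left'_d_add : ‖(L.phi (ρ ^ 2)).left' L.d + ρ * Complex.sin (ρ * L.d)‖
    ≤ K * Real.exp (|ρ.im| * L.d)
  right_pi_sub : ‖(L.phi (ρ ^ 2)).right Real.pi
      - (L.b₁ * Complex.cos (ρ * Real.pi) + L.b₂ * Complex.cos (ρ * (Real.pi - 2 * L.d : ℝ)))‖
    ≤ K * Real.exp (|ρ.im| * Real.pi) / ‖ρ‖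
  right'_pi_add : ‖(L.phi (ρ ^ 2)).right' Real.pi + ρ * (L.b₁ * Complex.sin (ρ * Real.pi)
      + L.b₂ * Complex.sin (ρ * (Real.pi - 2 * L.d : ℝ)))‖
    ≤ K * Real.exp (|ρ.im| * Real.pi)

/-- The asymptotics of `φ(·, ρ²)`, obtained on `[0, d]` from the initial data at `0` and on `[d, π]`
from the conditions at `d`. The term with `γ` is smaller than the leading ones by a factor
`O(1 / ρ)` and contributes only to the remainders. -/
theorem exists_phiBounds : ∃ K, 1 ≤ K ∧ ∀ ρ : ℂ, 1 ≤ ‖ρ‖ → L.PhiBounds K ρ := by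
  have hd0 := L.d_mem.1.le
  have hdπ := L.d_mem.2.le
  have hβ := L.β_pos
  have hβC : (L.β : ℂ) ≠ 0 := Complex.ofReal_ne_zero.2 hβ.ne'
  set k₁ := IsSolutionOn.boundConst L.q 0 L.d
  set k₂ := IsSolutionOn.boundConst L.q L.d Real.pi
  set I₁ := ∫ t in (0)..L.d, ‖L.q t‖ with hI₁
  set I₂ := ∫ t in L.d..Real.pi, ‖L.q t‖ with hI₂
  have hk₁ : 0 < k₁ := IsSolutionOn.boundConst_pos
  have hk₂ : 0 < k₂ := IsSolutionOn.boundConst_pos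
  have hI₁0 : 0 ≤ I₁ := intervalIntegral.integral_nonneg hd0 fun _ _ => norm_nonneg _
  have hI₂0 : 0 ≤ I₂ := intervalIntegral.integral_nonneg hdπ fun _ _ => norm_nonneg _
  -- `A₁`, `A₂` bound `φ` on `[0, d]` and `φ`, `φ' / ρ` at `d + 0`; `M₁`, `M₂` bound the remainders
  -- at `d - 0` and `d + 0`, and `N` the effect of the potential on `[d, π]`
  obtain ⟨A₁, hA₁⟩ : ∃ A, A = (1 + ‖L.h‖) * k₁ := ⟨_, rfl⟩
  obtain ⟨M₁, hM₁⟩ : ∃ M, M = A₁ * I₁ + ‖L.h‖ := ⟨_, rfl⟩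
  obtain ⟨M₂, hM₂⟩ : ∃ M, M = L.β⁻¹ * M₁ + ‖L.γ‖ * A₁ := ⟨_, rfl⟩
  obtain ⟨A₂, hA₂⟩ : ∃ A, A = L.β * A₁ + (L.β⁻¹ * (M₁ + 1) + ‖L.γ‖ * A₁) := ⟨_, rfl⟩
  obtain ⟨N, hN⟩ : ∃ N, N = A₂ * k₂ * I₂ := ⟨_, rfl⟩
  have hA₁0 : 0 ≤ A₁ := by rw [hA₁]; positivity
  have hM₁0 : 0 ≤ M₁ := by rw [hM₁]; positivity
  have hM₂0 : 0 ≤ M₂ := by rw [hM₂]; positivity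
  have hA₂0 : 0 ≤ A₂ := by rw [hA₂]; positivity
  have hN0 : 0 ≤ N := by rw [hN]; positivity
  have hAk : 0 ≤ A₂ * k₂ := by positivity
  have hβM : 0 ≤ L.β * M₁ := by positivity
  have hβA : 0 ≤ L.β * A₁ := by positivity
  refine ⟨1 + A₁ + (M₁ + 1) + A₂ + A₂ * k₂ + (N + L.β * M₁ + M₂) + (N + 2 * A₂), by linarith,
    fun ρ hρ => ?_⟩
  generalize hKK : 1 + A₁ + (M₁ + 1) + A₂ + A₂ * k₂ + (N + L.β * M₁ + M₂) + (N + 2 * A₂) = K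
  have hρpos : 0 < ‖ρ‖ := by linarith
  have hρ0 : ρ ≠ 0 := norm_pos_iff.1 hρpos
  have hsol := L.phi_isSolution (ρ ^ 2)
  have l0 := L.phi_left_zero (ρ ^ 2)
  have l0' := L.phi_left'_zero (ρ ^ 2)
  have hjump := hsol.jump
  have hjump' := hsol.jump'
  have hA : ‖(L.phi (ρ ^ 2)).left 0‖ + ‖(L.phi (ρ ^ 2)).left' 0‖ / ‖ρ‖ ≤ 1 + ‖L.h‖ := by
    rw [l0, l0', norm_one]
    gcongr
    exact div_le_self (norm_nonneg _) hρ
  have hleft : ∀ x ∈ Icc 0 L.d, ‖(L.phi (ρ ^ 2)).left x‖ ≤ A₁ * Real.exp (|ρ.im| * x) :=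
    fun x hx => by
      have := hsol.left.norm_le hd0 L.q_integrable_left hρ hA hx
      rwa [sub_zero, ← hA₁] at this
  obtain ⟨r1, r2⟩ := hsol.left.norm_sub_le hd0 L.q_integrable_left hρ hA (x := L.d) ⟨hd0, le_rfl⟩
  rw [← hA₁, ← hI₁, l0, l0', Complex.ofReal_zero, sub_zero, sub_zero] at r1 r2
  set e₁ := Real.exp (|ρ.im| * L.d) with he₁
  set e₂ := Real.exp (|ρ.im| * (Real.pi - L.d)) with he₂
  have he : e₁ * e₂ = Real.exp (|ρ.im| * Real.pi) := by
    rw [he₁, he₂, ← Real.exp_add]; congr 1; ring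
  have he₁0 : 0 < e₁ := Real.exp_pos _
  have he₂0 : 0 < e₂ := Real.exp_pos _
  have hcA : ‖Complex.cos (ρ * L.d)‖ ≤ e₁ := by
    simpa using (IsSolutionOn.norm_trig_le ρ hd0).1
  have hsA : ‖Complex.sin (ρ * L.d)‖ ≤ e₁ := by
    simpa using (IsSolutionOn.norm_trig_le ρ hd0).2
  obtain ⟨hcB, hsB⟩ := IsSolutionOn.norm_trig_le ρ hdπ
  rw [← he₂] at hcB hsB
  set l := (L.phi (ρ ^ 2)).left L.d
  set l' := (L.phi (ρ ^ 2)).left' L.d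
  set r := (L.phi (ρ ^ 2)).right L.d
  set r' := (L.phi (ρ ^ 2)).right' L.d
  set cA := Complex.cos (ρ * L.d)
  set sA := Complex.sin (ρ * L.d)
  set cB := Complex.cos (ρ * (Real.pi - L.d))
  set sB := Complex.sin (ρ * (Real.pi - L.d))
  have hl : ‖l‖ ≤ A₁ * e₁ := hleft L.d ⟨hd0, le_rfl⟩
  -- leading terms at `d - 0`
  have hl1 : ‖l - cA‖ ≤ M₁ * e₁ / ‖ρ‖ := by
    calc ‖l - cA‖ = ‖(l - (1 * cA + L.h / ρ * sA)) + L.h / ρ * sA‖ := by congr 1; ring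
      _ ≤ A₁ * I₁ * e₁ / ‖ρ‖ + ‖L.h‖ / ‖ρ‖ * e₁ := by
          refine (norm_add_le _ _).trans (add_le_add r1 ?_)
          rw [norm_mul, norm_div]
          gcongr
      _ = M₁ * e₁ / ‖ρ‖ := by rw [hM₁]; ring
  have hl2 : ‖l' + ρ * sA‖ ≤ M₁ * e₁ := by
    calc ‖l' + ρ * sA‖ = ‖(l' - (-(ρ * (1 * sA)) + L.h * cA)) + L.h * cA‖ := by congr 1; ring
      _ ≤ A₁ * I₁ * e₁ + ‖L.h‖ * e₁ := by
          refine (norm_add_le _ _).trans (add_le_add r2 ?_)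
          rw [norm_mul]
          gcongr
      _ = M₁ * e₁ := by rw [hM₁]; ring
  have hle_ρ {c : ℝ} (hc : 0 ≤ c) : c ≤ c * ‖ρ‖ := le_mul_of_one_le_right hc hρ
  have hl' : ‖l'‖ ≤ (M₁ + 1) * ‖ρ‖ * e₁ := by
    calc ‖l'‖ = ‖(l' + ρ * sA) - ρ * sA‖ := by congr 1; ring
      _ ≤ M₁ * e₁ + ‖ρ‖ * e₁ := by
          refine (norm_sub_le _ _).trans (add_le_add hl2 ?_)
          rw [norm_mul]
          gcongr
      _ ≤ (M₁ + 1) * ‖ρ‖ * e₁ := by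
          have := mul_le_mul_of_nonneg_right (hle_ρ hM₁0) he₁0.le
          linarith
  -- leading terms at `d + 0`
  have hr1 : ‖r - L.β * cA‖ ≤ L.β * M₁ * e₁ / ‖ρ‖ := by
    rw [hjump, ← mul_sub, norm_mul, Complex.norm_real, Real.norm_eq_abs, abs_of_pos hβ,
      mul_assoc L.β, mul_div_assoc]
    gcongr
  have hr2 : ‖r' + (L.β : ℂ)⁻¹ * (ρ * sA)‖ ≤ M₂ * e₁ := by
    calc ‖r' + (L.β : ℂ)⁻¹ * (ρ * sA)‖ = ‖(L.β : ℂ)⁻¹ * (l' + ρ * sA) + L.γ * l‖ := by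
          rw [hjump']; congr 1; ring
      _ ≤ L.β⁻¹ * (M₁ * e₁) + ‖L.γ‖ * (A₁ * e₁) := by
          refine (norm_add_le _ _).trans ?_
          rw [norm_mul, norm_mul, norm_inv, Complex.norm_real, Real.norm_eq_abs, abs_of_pos hβ]
          gcongr
      _ = M₂ * e₁ := by rw [hM₂]; ring
  have hr : ‖r‖ ≤ L.β * A₁ * e₁ := by
    rw [hjump, norm_mul, Complex.norm_real, Real.norm_eq_abs, abs_of_pos hβ, mul_assoc]
    gcongr
  have hr' : ‖r'‖ ≤ (L.β⁻¹ * (M₁ + 1) + ‖L.γ‖ * A₁) * ‖ρ‖ * e₁ := by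
    calc ‖r'‖ ≤ L.β⁻¹ * ((M₁ + 1) * ‖ρ‖ * e₁) + ‖L.γ‖ * (A₁ * e₁) := by
          rw [hjump']
          refine (norm_add_le _ _).trans ?_
          rw [norm_mul, norm_mul, norm_inv, Complex.norm_real, Real.norm_eq_abs, abs_of_pos hβ]
          gcongr
      _ ≤ _ := by
          have := mul_le_mul_of_nonneg_left (hle_ρ (mul_nonneg hA₁0 he₁0.le)) (norm_nonneg L.γ)
          linarith
  have hAr : ‖r‖ + ‖r'‖ / ‖ρ‖ ≤ A₂ * e₁ := by
    have : ‖r'‖ / ‖ρ‖ ≤ (L.β⁻¹ * (M₁ + 1) + ‖L.γ‖ * A₁) * e₁ := by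
      rw [div_le_iff₀ hρpos]; linarith
    rw [hA₂]; linarith
  have hright : ∀ x ∈ Icc L.d Real.pi,
      ‖(L.phi (ρ ^ 2)).right x‖ ≤ A₂ * k₂ * Real.exp (|ρ.im| * x) := fun x hx => by
    have := hsol.right.norm_le hdπ L.q_integrable_right hρ hAr hx
    have e : Real.exp (|ρ.im| * x) = e₁ * Real.exp (|ρ.im| * (x - L.d)) := by
      rw [he₁, ← Real.exp_add]; congr 1; ring
    rw [e]
    linarith
  obtain ⟨s1, s2⟩ := hsol.right.norm_sub_le hdπ L.q_integrable_right hρ hAr (x := Real.pi)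
    ⟨hdπ, le_rfl⟩
  have eN : A₂ * e₁ * IsSolutionOn.boundConst L.q L.d Real.pi * I₂ * e₂
      = N * Real.exp (|ρ.im| * Real.pi) := by
    rw [hN, ← he]; ring
  rw [eN] at s1 s2
  set E := Real.exp (|ρ.im| * Real.pi)
  have hE0 : 0 < E := Real.exp_pos _
  -- addition formulas
  have add1 : L.b₁ * Complex.cos (ρ * Real.pi) + L.b₂ * Complex.cos (ρ * (Real.pi - 2 * L.d : ℝ))
      = L.β * cA * cB - (L.β : ℂ)⁻¹ * sA * sB := by
    rw [show ρ * Real.pi = ρ * L.d + ρ * (Real.pi - L.d) by ring,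
      show ρ * (Real.pi - 2 * L.d : ℝ) = ρ * (Real.pi - L.d) - ρ * L.d by push_cast; ring,
      Complex.cos_add, Complex.cos_sub, b₁, b₂]
    push_cast
    ring
  have add2 : L.b₁ * Complex.sin (ρ * Real.pi) + L.b₂ * Complex.sin (ρ * (Real.pi - 2 * L.d : ℝ))
      = L.β * cA * sB + (L.β : ℂ)⁻¹ * sA * cB := by
    rw [show ρ * Real.pi = ρ * L.d + ρ * (Real.pi - L.d) by ring,
      show ρ * (Real.pi - 2 * L.d : ℝ) = ρ * (Real.pi - L.d) - ρ * L.d by push_cast; ring,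
      Complex.sin_add, Complex.sin_sub, b₁, b₂]
    push_cast
    ring
  have c1 : ‖(r - L.β * cA) * cB‖ ≤ L.β * M₁ * E / ‖ρ‖ := by
    rw [norm_mul, ← he]
    calc _ ≤ L.β * M₁ * e₁ / ‖ρ‖ * e₂ := by gcongr
      _ = _ := by ring
  have c2 : ‖(r - L.β * cA) * sB‖ ≤ L.β * M₁ * E / ‖ρ‖ := by
    rw [norm_mul, ← he]
    calc _ ≤ L.β * M₁ * e₁ / ‖ρ‖ * e₂ := by gcongr
      _ = _ := by ring
  have c3 : ‖(r' + (L.β : ℂ)⁻¹ * (ρ * sA)) * cB‖ ≤ M₂ * E := by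
    rw [norm_mul, ← he]
    calc _ ≤ M₂ * e₁ * e₂ := by gcongr
      _ = _ := by ring
  have c4 : ‖(r' + (L.β : ℂ)⁻¹ * (ρ * sA)) * sB‖ ≤ M₂ * E := by
    rw [norm_mul, ← he]
    calc _ ≤ M₂ * e₁ * e₂ := by gcongr
      _ = _ := by ring
  have key1 : ‖(L.phi (ρ ^ 2)).right Real.pi - (L.b₁ * Complex.cos (ρ * Real.pi)
      + L.b₂ * Complex.cos (ρ * (Real.pi - 2 * L.d : ℝ)))‖ ≤ (N + L.β * M₁ + M₂) * E / ‖ρ‖ := by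
    have e : (L.phi (ρ ^ 2)).right Real.pi - (L.b₁ * Complex.cos (ρ * Real.pi)
        + L.b₂ * Complex.cos (ρ * (Real.pi - 2 * L.d : ℝ)))
        = ((L.phi (ρ ^ 2)).right Real.pi - (r * cB + r' / ρ * sB)) + (r - L.β * cA) * cB
          + (r' + (L.β : ℂ)⁻¹ * (ρ * sA)) * sB / ρ := by
      rw [add1]; field_simp; ring
    rw [e]
    calc _ ≤ N * E / ‖ρ‖ + L.β * M₁ * E / ‖ρ‖ + M₂ * E / ‖ρ‖ := by
          refine (norm_add_le _ _).trans (add_le_add ((norm_add_le _ _).trans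
            (add_le_add s1 c1)) ?_)
          rw [norm_div]
          gcongr
      _ = _ := by ring
  have key2 : ‖(L.phi (ρ ^ 2)).right' Real.pi + ρ * (L.b₁ * Complex.sin (ρ * Real.pi)
      + L.b₂ * Complex.sin (ρ * (Real.pi - 2 * L.d : ℝ)))‖ ≤ (N + L.β * M₁ + M₂) * E := by
    have e : (L.phi (ρ ^ 2)).right' Real.pi + ρ * (L.b₁ * Complex.sin (ρ * Real.pi)
        + L.b₂ * Complex.sin (ρ * (Real.pi - 2 * L.d : ℝ)))
        = ((L.phi (ρ ^ 2)).right' Real.pi - (-(ρ * (r * sB)) + r' * cB))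
          - ρ * ((r - L.β * cA) * sB) + (r' + (L.β : ℂ)⁻¹ * (ρ * sA)) * cB := by
      rw [add2]; ring
    rw [e]
    calc _ ≤ N * E + L.β * M₁ * E + M₂ * E := by
          refine (norm_add_le _ _).trans (add_le_add ((norm_sub_le _ _).trans
            (add_le_add s2 ?_)) c3)
          rw [norm_mul]
          calc _ ≤ ‖ρ‖ * (L.β * M₁ * E / ‖ρ‖) := by gcongr
            _ = _ := by field_simp
      _ = _ := by ring
  have key3 : ‖(L.phi (ρ ^ 2)).right' Real.pi‖ ≤ (N + 2 * A₂) * ‖ρ‖ * E := by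
    have e : (L.phi (ρ ^ 2)).right' Real.pi
        = ((L.phi (ρ ^ 2)).right' Real.pi - (-(ρ * (r * sB)) + r' * cB))
          - ρ * (r * sB) + r' * cB := by ring
    have hr0 : ‖r‖ ≤ A₂ * e₁ := by
      have : 0 ≤ ‖r'‖ / ‖ρ‖ := by positivity
      linarith
    have hr0' : ‖r'‖ ≤ A₂ * e₁ * ‖ρ‖ := by
      rw [← div_le_iff₀ hρpos]
      linarith [norm_nonneg r]
    rw [e]
    calc _ ≤ N * E + ‖ρ‖ * (A₂ * e₁ * e₂) + A₂ * e₁ * ‖ρ‖ * e₂ := by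
          refine (norm_add_le _ _).trans (add_le_add ((norm_sub_le _ _).trans
            (add_le_add s2 ?_)) ?_)
          · rw [norm_mul, norm_mul]; gcongr
          · rw [norm_mul]; gcongr
      _ ≤ N * E * ‖ρ‖ + ‖ρ‖ * (A₂ * e₁ * e₂) + A₂ * e₁ * ‖ρ‖ * e₂ := by
          exact add_le_add (add_le_add (hle_ρ (by positivity)) le_rfl) le_rfl
      _ = _ := by rw [← he]; ring
  refine ⟨fun x hx => (hleft x hx).trans ?_, fun x hx => (hright x hx).trans ?_,
    hr'.trans ?_, key3.trans ?_, hl1.trans ?_, hl2.trans ?_, key1.trans ?_, key2.trans ?_⟩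
  all_goals
    gcongr
    rw [← hKK]
    linarith

end Problem

/-- A lower bound for functions with leading term `b₁ u + b₂ v` as in `exists_exp_le_norm_add`, with
`s = |Im ρ| l`. -/
theorem exists_exp_le_norm_of_norm_sub_le {b₁ b₂ : ℝ} (hb : |b₂| < b₁) (K : ℝ) {l : ℝ}
    (hl : 0 < l) : ∃ κ > 0, ∃ T, ∀ ρ u v f : ℂ, T ≤ ‖ρ‖ → ‖v‖ ≤ Real.cosh (|ρ.im| * l) →
      (‖u‖ = Real.cosh (|ρ.im| * l) ∨ (T ≤ |ρ.im| ∧ Real.sinh (|ρ.im| * l) ≤ ‖u‖)) →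
      ‖f - (b₁ * u + b₂ * v)‖ ≤ K * Real.exp (|ρ.im| * l) / ‖ρ‖ →
      κ * Real.exp (|ρ.im| * l) ≤ ‖f‖ := by
  obtain ⟨κ, hκ, T, h⟩ := exists_exp_le_norm_add hb
  refine ⟨κ / 2, by positivity, max (T / l) (max 1 (2 * K / κ)), fun ρ u v f hρ hv hu hf => ?_⟩
  have hρ1 : 1 ≤ ‖ρ‖ := ((le_max_left _ _).trans (le_max_right _ _)).trans hρ
  have hρ2 : 2 * K / κ ≤ ‖ρ‖ := ((le_max_right _ _).trans (le_max_right _ _)).trans hρ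
  have h1 := h u v (|ρ.im| * l) (by positivity) hv (hu.imp_right fun hu =>
    ⟨(div_le_iff₀ hl).1 ((le_max_left _ _).trans hu.1), hu.2⟩)
  have h2 : K * Real.exp (|ρ.im| * l) / ‖ρ‖ ≤ κ / 2 * Real.exp (|ρ.im| * l) := by
    rw [div_le_iff₀ hκ] at hρ2
    rw [div_le_iff₀ (by linarith)]
    nlinarith [Real.exp_pos (|ρ.im| * l)]
  have h3 := norm_sub_norm_le (b₁ * u + b₂ * v) f
  rw [norm_sub_rev] at h3
  linarith

theorem im_mul_ofReal_abs (ρ : ℂ) {l : ℝ} (hl : 0 ≤ l) : |(ρ * l).im| = |ρ.im| * l := by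
  rw [Complex.im_mul_ofReal, abs_mul, abs_of_nonneg hl]

theorem cosh_im_mul (ρ : ℂ) {l l₂ : ℝ} (h : |l₂| ≤ l) :
    Real.cosh (ρ * l₂).im ≤ Real.cosh (|ρ.im| * l) := by
  rw [Real.cosh_le_cosh, Complex.im_mul_ofReal, abs_mul, abs_mul, abs_abs]
  exact mul_le_mul_of_nonneg_left (h.trans (le_abs_self _)) (abs_nonneg _)

/-- Squares on whose vertical sides `sin (l Re ρ)` vanishes. -/
theorem eventually_squareBoundary_sin {l : ℝ} (hl : 0 < l) (T : ℝ) :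
    ∀ᶠ n : ℕ in atTop, ∀ ρ ∈ squareBoundary (n * (Real.pi / l)),
      T ≤ ‖ρ‖ ∧ (Real.sin (ρ.re * l) = 0 ∨ T ≤ |ρ.im|) := by
  have hR : Tendsto (fun n : ℕ => (n : ℝ) * (Real.pi / l)) atTop atTop :=
    tendsto_natCast_atTop_atTop.atTop_mul_const (by positivity)
  filter_upwards [hR.eventually_ge_atTop T] with n hn ρ hρ
  refine ⟨hn.trans (le_norm_of_mem_squareBoundary hρ), ?_⟩
  rcases hρ.2.2 with h | h
  · left
    have e : (n : ℝ) * (Real.pi / l) * l = n * Real.pi := by field_simp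
    rcases abs_choice ρ.re with h' | h'
    · rw [← h', h, e, Real.sin_nat_mul_pi]
    · rw [show ρ.re = -(n * (Real.pi / l)) by linarith, neg_mul, e, Real.sin_neg,
        Real.sin_nat_mul_pi, neg_zero]
  · exact Or.inr (hn.trans h.ge)

/-- Squares on whose vertical sides `cos (π Re ρ)` vanishes. -/
theorem eventually_squareBoundary_cos (T : ℝ) :
    ∀ᶠ n : ℕ in atTop, ∀ ρ ∈ squareBoundary ((n : ℝ) + 1 / 2),
      T ≤ ‖ρ‖ ∧ (Real.cos (ρ.re * Real.pi) = 0 ∨ T ≤ |ρ.im|) := by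
  have hR : Tendsto (fun n : ℕ => (n : ℝ) + 1 / 2) atTop atTop :=
    tendsto_atTop_add_const_right _ _ tendsto_natCast_atTop_atTop
  filter_upwards [hR.eventually_ge_atTop T] with n hn ρ hρ
  refine ⟨hn.trans (le_norm_of_mem_squareBoundary hρ), ?_⟩
  rcases hρ.2.2 with h | h
  · left
    have e : Real.cos (((n : ℝ) + 1 / 2) * Real.pi) = 0 := by
      rw [Real.cos_eq_zero_iff]
      exact ⟨n, by push_cast; ring⟩
    rcases abs_choice ρ.re with h' | h'
    · rw [← h', h, e]
    · rw [show ρ.re = -((n : ℝ) + 1 / 2) by linarith, neg_mul, Real.cos_neg, e]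
  · exact Or.inr (hn.trans h.ge)

namespace Problem

variable (L : Problem)

theorem exists_le_norm_left_d : ∃ κ > 0, ∃ T, ∀ ρ : ℂ, T ≤ ‖ρ‖ →
    (Real.sin (ρ.re * L.d) = 0 ∨ T ≤ |ρ.im|) →
    κ * Real.exp (|ρ.im| * L.d) ≤ ‖(L.phi (ρ ^ 2)).left L.d‖ := by
  obtain ⟨K, -, hK⟩ := L.exists_phiBounds
  have hd := L.d_mem.1
  obtain ⟨κ, hκ, T, h⟩ := exists_exp_le_norm_of_norm_sub_le (b₁ := 1) (b₂ := 0) (by simp) K hd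
  refine ⟨κ, hκ, max T 1, fun ρ hρ hs => ?_⟩
  refine h ρ (Complex.cos (ρ * L.d)) 0 _ ((le_max_left _ _).trans hρ)
    (by simpa using (Real.cosh_pos _).le) ?_ ?_
  · rcases hs with hs | hs
    · left
      rw [norm_cos_eq_cosh (by rwa [Complex.re_mul_ofReal]), ← Real.cosh_abs,
        im_mul_ofReal_abs ρ hd.le]
    · right
      rw [← im_mul_ofReal_abs ρ hd.le]
      exact ⟨(le_max_left _ _).trans hs, sinh_le_norm_cos _⟩
  · simpa using (hK ρ ((le_max_right _ _).trans hρ)).left_d_sub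

theorem exists_le_norm_left'_d : ∃ κ > 0, ∃ T, ∀ ρ : ℂ, T ≤ ‖ρ‖ → T ≤ |ρ.im| →
    κ * ‖ρ‖ * Real.exp (|ρ.im| * L.d) ≤ ‖(L.phi (ρ ^ 2)).left' L.d‖ := by
  obtain ⟨K, -, hK⟩ := L.exists_phiBounds
  have hd := L.d_mem.1
  obtain ⟨κ, hκ, T, h⟩ := exists_exp_le_norm_of_norm_sub_le (b₁ := 1) (b₂ := 0) (by simp) K hd
  refine ⟨κ, hκ, max T 1, fun ρ hρ hs => ?_⟩
  have hρ1 : 1 ≤ ‖ρ‖ := (le_max_right _ _).trans hρ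
  have hρ0 : ρ ≠ 0 := norm_pos_iff.1 (by linarith)
  have key := h ρ (Complex.sin (ρ * L.d)) 0 (-((L.phi (ρ ^ 2)).left' L.d / ρ))
    ((le_max_left _ _).trans hρ) (by simpa using (Real.cosh_pos _).le) ?_ ?_
  · rw [norm_neg, norm_div, le_div_iff₀ (by linarith)] at key
    linarith
  · right
    rw [← im_mul_ofReal_abs ρ hd.le]
    exact ⟨(le_max_left _ _).trans hs, sinh_le_norm_sin _⟩
  · have e : -((L.phi (ρ ^ 2)).left' L.d / ρ) - (((1 : ℝ) : ℂ) * Complex.sin (ρ * L.d)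
        + ((0 : ℝ) : ℂ) * 0)
        = -(((L.phi (ρ ^ 2)).left' L.d + ρ * Complex.sin (ρ * L.d)) / ρ) := by
      push_cast; field_simp; ring
    rw [e, norm_neg, norm_div]
    gcongr
    exact (hK ρ hρ1).left'_d_add

theorem abs_pi_sub_le : |Real.pi - 2 * L.d| ≤ Real.pi := by
  have := L.d_mem
  rw [abs_le]; constructor <;> linarith [this.1, this.2]

/-- `Δ^∞(ρ²)` is at least of order `exp(π |Im ρ|)` far from the real axis and on the vertical lines
where `sin(π Re ρ) = 0`. The term with `b₁` dominates because `|b₂| < b₁` and `|π - 2d| ≤ π`. -/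
theorem exists_le_norm_charFunInfty : ∃ κ > 0, ∃ T, ∀ ρ : ℂ, T ≤ ‖ρ‖ →
    (Real.sin (ρ.re * Real.pi) = 0 ∨ T ≤ |ρ.im|) →
    κ * Real.exp (|ρ.im| * Real.pi) ≤ ‖L.charFunInfty (ρ ^ 2)‖ := by
  obtain ⟨K, -, hK⟩ := L.exists_phiBounds
  obtain ⟨κ, hκ, T, h⟩ := exists_exp_le_norm_of_norm_sub_le L.abs_b₂_lt K Real.pi_pos
  refine ⟨κ, hκ, max T 1, fun ρ hρ hs => ?_⟩
  rw [charFunInfty, norm_neg]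
  refine h ρ _ _ _ ((le_max_left _ _).trans hρ)
    ((norm_cos_le_cosh _).trans (cosh_im_mul ρ L.abs_pi_sub_le)) ?_
    (hK ρ ((le_max_right _ _).trans hρ)).right_pi_sub
  rcases hs with hs | hs
  · left
    rw [norm_cos_eq_cosh (by rwa [Complex.re_mul_ofReal]), ← Real.cosh_abs,
      im_mul_ofReal_abs ρ Real.pi_pos.le]
  · right
    rw [← im_mul_ofReal_abs ρ Real.pi_pos.le]
    exact ⟨(le_max_left _ _).trans hs, sinh_le_norm_cos _⟩

/-- `Δ(ρ²)` is at least of order `ρ exp(π |Im ρ|)` far from the real axis and on the vertical lines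
where `cos(π Re ρ) = 0`. The leading term of `-Δ(ρ²) / ρ` is
`b₁ sin(πρ) + b₂ sin((π - 2d)ρ)`. -/
theorem exists_le_norm_charFun : ∃ κ > 0, ∃ T, ∀ ρ : ℂ, T ≤ ‖ρ‖ →
    (Real.cos (ρ.re * Real.pi) = 0 ∨ T ≤ |ρ.im|) →
    κ * ‖ρ‖ * Real.exp (|ρ.im| * Real.pi) ≤ ‖L.charFun (ρ ^ 2)‖ := by
  obtain ⟨K, -, hK⟩ := L.exists_phiBounds
  obtain ⟨κ, hκ, T, h⟩ := exists_exp_le_norm_of_norm_sub_le L.abs_b₂_lt (K + ‖L.H‖ * K)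
    Real.pi_pos
  refine ⟨κ, hκ, max T 1, fun ρ hρ hs => ?_⟩
  have hρ1 : 1 ≤ ‖ρ‖ := (le_max_right _ _).trans hρ
  have hρ0 : ρ ≠ 0 := norm_pos_iff.1 (by linarith)
  have key := h ρ (Complex.sin (ρ * Real.pi)) (Complex.sin (ρ * (Real.pi - 2 * L.d : ℝ)))
    (-(L.charFun (ρ ^ 2) / ρ)) ((le_max_left _ _).trans hρ)
    ((norm_sin_le_cosh _).trans (cosh_im_mul ρ L.abs_pi_sub_le)) ?_ ?_
  · rw [norm_neg, norm_div, le_div_iff₀ (by linarith)] at key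
    linarith
  · rcases hs with hs | hs
    · left
      rw [norm_sin_eq_cosh (by rwa [Complex.re_mul_ofReal]), ← Real.cosh_abs,
        im_mul_ofReal_abs ρ Real.pi_pos.le]
    · right
      rw [← im_mul_ofReal_abs ρ Real.pi_pos.le]
      exact ⟨(le_max_left _ _).trans hs, sinh_le_norm_sin _⟩
  · have e : -(L.charFun (ρ ^ 2) / ρ) - (L.b₁ * Complex.sin (ρ * Real.pi)
        + L.b₂ * Complex.sin (ρ * (Real.pi - 2 * L.d : ℝ)))
        = -(((L.phi (ρ ^ 2)).right' Real.pi + ρ * (L.b₁ * Complex.sin (ρ * Real.pi)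
          + L.b₂ * Complex.sin (ρ * (Real.pi - 2 * L.d : ℝ)))
          + L.H * (L.phi (ρ ^ 2)).right Real.pi) / ρ) := by
      rw [charFun]; field_simp; ring
    rw [e, norm_neg, norm_div, add_mul, mul_assoc ‖L.H‖]
    gcongr
    refine (norm_add_le _ _).trans ?_
    rw [norm_mul]
    have hr := (hK ρ hρ1).right Real.pi ⟨L.d_mem.2.le, le_rfl⟩
    gcongr
    exact (hK ρ hρ1).right'_pi_add

end Problem

/-! ### Wronskians on the imaginary axis -/

/-- The Wronskian at `b` of solutions of two equations that grow like `exp(τ x)`, in terms of the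
Wronskian at `a` and the difference of the potentials near `b`, by Lagrange's identity. -/
theorem norm_wronskian_mul_exp_le {q p : ℝ → ℂ} {z : ℂ} {a b τ K K' : ℝ} (hab : a ≤ b)
    (hq : IntervalIntegrable q volume a b) (hp : IntervalIntegrable p volume a b)
    {y y' w w' : ℝ → ℂ} (hy : IsSolutionOn q z a b y y') (hw : IsSolutionOn p z a b w w')
    (hyb : ∀ x ∈ Icc a b, ‖y x‖ ≤ K * Real.exp (τ * x))
    (hwb : ∀ x ∈ Icc a b, ‖w x‖ ≤ K' * Real.exp (τ * x)) :
    ‖y b * w' b - y' b * w b‖ * Real.exp (-(2 * τ * b))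
      ≤ ‖y a * w' a - y' a * w a‖ * Real.exp (-(2 * τ * b))
        + K * K' * ∫ x in a..b, ‖p x - q x‖ * Real.exp (-(2 * τ * (b - x))) := by
  have h1 := (hy.lagrange hab hq hp hw).eq b ⟨hab, le_rfl⟩
  have hec : Continuous fun x : ℝ => Real.exp (-(2 * τ * (b - x))) := by fun_prop
  have h2 : ‖∫ t in a..b, ((p t - z) - (q t - z)) * (y t * w t)‖
      ≤ ∫ x in a..b, ‖p x - q x‖ * Real.exp (-(2 * τ * (b - x)))
        * (K * K' * Real.exp (2 * τ * b)) := by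
    refine intervalIntegral.norm_integral_le_of_norm_le hab (Eventually.of_forall fun x hx => ?_)
      (((hp.sub hq).norm.mul_continuousOn hec.continuousOn).mul_const _)
    have hx' : x ∈ Icc a b := ⟨hx.1.le, hx.2⟩
    rw [sub_sub_sub_cancel_right, norm_mul, norm_mul]
    have e : Real.exp (-(2 * τ * (b - x))) * Real.exp (2 * τ * b)
        = Real.exp (τ * x) * Real.exp (τ * x) := by
      rw [← Real.exp_add, ← Real.exp_add]; congr 1; ring
    calc ‖p x - q x‖ * (‖y x‖ * ‖w x‖)
        ≤ ‖p x - q x‖ * ((K * Real.exp (τ * x)) * (K' * Real.exp (τ * x))) := by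
          refine mul_le_mul_of_nonneg_left (mul_le_mul (hyb x hx') (hwb x hx') (norm_nonneg _)
            ((norm_nonneg _).trans (hyb x hx'))) (norm_nonneg _)
      _ = _ := by linear_combination (-‖p x - q x‖ * K * K') * e
  rw [intervalIntegral.integral_mul_const] at h2
  have he : Real.exp (2 * τ * b) * Real.exp (-(2 * τ * b)) = 1 := by rw [← Real.exp_add]; simp
  rw [h1]
  calc _ ≤ (‖y a * w' a - y' a * w a‖ + (∫ x in a..b, ‖p x - q x‖
        * Real.exp (-(2 * τ * (b - x)))) * (K * K' * Real.exp (2 * τ * b)))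
        * Real.exp (-(2 * τ * b)) := by
        refine mul_le_mul_of_nonneg_right ?_ (Real.exp_pos _).le
        exact (norm_add_le _ _).trans (add_le_add le_rfl h2)
    _ = _ := by linear_combination (K * K' * ∫ x in a..b, ‖p x - q x‖
        * Real.exp (-(2 * τ * (b - x)))) * he

theorem abs_im_mul_I {τ : ℝ} (hτ : 0 ≤ τ) : |((τ : ℂ) * Complex.I).im| = τ := by
  simp [abs_of_nonneg hτ]

theorem norm_mul_I {τ : ℝ} (hτ : 0 ≤ τ) : ‖(τ : ℂ) * Complex.I‖ = τ := by
  simp [abs_of_nonneg hτ]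

namespace Problem

variable (L L' : Problem)

/-- The Wronskian at `d - 0` of the solutions `φ` of two problems is `o(exp(2τd))` at `z = -τ²`. -/
theorem tendsto_wronskian_left (hd : L.d = L'.d) :
    Tendsto (fun τ : ℝ => ‖(L.phi ((τ * Complex.I) ^ 2)).left L.d
        * (L'.phi ((τ * Complex.I) ^ 2)).left' L.d - (L.phi ((τ * Complex.I) ^ 2)).left' L.d
        * (L'.phi ((τ * Complex.I) ^ 2)).left L.d‖ * Real.exp (-(2 * τ * L.d))) atTop (𝓝 0) := by
  obtain ⟨K, -, hK⟩ := L.exists_phiBounds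
  obtain ⟨K', -, hK'⟩ := L'.exists_phiBounds
  have hd0 := L.d_mem.1
  have hq' := hd ▸ L'.q_integrable_left
  have lim1 := (tendsto_pow_mul_exp_neg 0 (c := 2 * L.d) (by linarith)).const_mul ‖L'.h - L.h‖
  have lim2 := (tendsto_pow_mul_integral_exp hd0 (hq'.sub L.q_integrable_left) 0
    (by simp)).const_mul (K * K')
  have lim := lim1.add lim2
  rw [mul_zero, mul_zero, add_zero] at lim
  refine squeeze_zero' (Eventually.of_forall fun τ => by positivity) ?_ lim
  filter_upwards [eventually_ge_atTop 1] with τ hτ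
  have hτ0 : 0 ≤ τ := by linarith
  have b := (hK (τ * Complex.I) (by rwa [norm_mul_I hτ0])).left
  have b' := (hK' (τ * Complex.I) (by rwa [norm_mul_I hτ0])).left
  have s' := (L'.phi_isSolution ((τ * Complex.I) ^ 2)).left
  rw [← hd] at b' s'
  rw [abs_im_mul_I hτ0] at b b'
  have := norm_wronskian_mul_exp_le hd0.le L.q_integrable_left hq'
    (L.phi_isSolution ((τ * Complex.I) ^ 2)).left s' b b'
  simp only [phi_left_zero, phi_left'_zero, one_mul, mul_one] at this
  rw [pow_zero, one_mul, one_mul, show 2 * L.d * τ = 2 * τ * L.d by ring]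
  exact this

/-- The Wronskian at `π` of the solutions `φ` of two problems is `o(τ⁻ᵏ exp(2τπ))` at `z = -τ²` if
the potentials differ by `o((π - x)ᵏ⁻¹)` at `π`; the contribution of `[0, d]` is exponentially
smaller than that, whatever the conditions at `d` are. -/
theorem tendsto_wronskian_pi (hd : L.d = L'.d) (k : ℕ)
    (hk : k ≠ 0 → ∀ ε > 0, ∃ δ > 0, ∀ x ∈ Icc (Real.pi - δ) Real.pi,
      ‖L'.q x - L.q x‖ ≤ ε * (Real.pi - x) ^ (k - 1)) :
    Tendsto (fun τ : ℝ => τ ^ k * (‖(L.phi ((τ * Complex.I) ^ 2)).right Real.pi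
        * (L'.phi ((τ * Complex.I) ^ 2)).right' Real.pi
        - (L.phi ((τ * Complex.I) ^ 2)).right' Real.pi
        * (L'.phi ((τ * Complex.I) ^ 2)).right Real.pi‖ * Real.exp (-(2 * τ * Real.pi))))
      atTop (𝓝 0) := by
  obtain ⟨K, hK1, hK⟩ := L.exists_phiBounds
  obtain ⟨K', hK1', hK'⟩ := L'.exists_phiBounds
  have hdπ := L.d_mem.2
  have hq' := hd ▸ L'.q_integrable_right
  have lim1 := (tendsto_pow_mul_exp_neg (k + 1) (c := 2 * (Real.pi - L.d))
    (by linarith)).const_mul (2 * K * K')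
  have lim2 := (tendsto_pow_mul_integral_exp hdπ (hq'.sub L.q_integrable_right) k
    hk).const_mul (K * K')
  have lim := lim1.add lim2
  rw [mul_zero, mul_zero, add_zero] at lim
  refine squeeze_zero' ?_ ?_ lim
  · filter_upwards [eventually_ge_atTop 0] with τ hτ
    positivity
  filter_upwards [eventually_ge_atTop 1] with τ hτ
  have hτ0 : 0 ≤ τ := by linarith
  have B := hK (τ * Complex.I) (by rwa [norm_mul_I hτ0])
  have B' := hK' (τ * Complex.I) (by rwa [norm_mul_I hτ0])
  have b := B.right
  have b' := B'.right
  have c := B.right'_d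
  have c' := B'.right'_d
  have s' := (L'.phi_isSolution ((τ * Complex.I) ^ 2)).right
  rw [← hd] at b' s' c'
  rw [abs_im_mul_I hτ0] at b b' c c'
  rw [norm_mul_I hτ0] at c c'
  have h1 := norm_wronskian_mul_exp_le hdπ.le L.q_integrable_right hq'
    (L.phi_isSolution ((τ * Complex.I) ^ 2)).right s' b b'
  have bd := b L.d ⟨le_rfl, hdπ.le⟩
  have bd' := b' L.d ⟨le_rfl, hdπ.le⟩
  have he : Real.exp (τ * L.d) * Real.exp (τ * L.d) * Real.exp (-(2 * τ * Real.pi))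
      = Real.exp (-(2 * (Real.pi - L.d) * τ)) := by
    rw [← Real.exp_add, ← Real.exp_add]; congr 1; ring
  have h2 : ‖(L.phi ((τ * Complex.I) ^ 2)).right L.d * (L'.phi ((τ * Complex.I) ^ 2)).right' L.d
      - (L.phi ((τ * Complex.I) ^ 2)).right' L.d * (L'.phi ((τ * Complex.I) ^ 2)).right L.d‖
      ≤ 2 * K * K' * τ * (Real.exp (τ * L.d) * Real.exp (τ * L.d)) := by
    refine (norm_sub_le _ _).trans ?_
    rw [norm_mul, norm_mul]
    calc _ ≤ (K * Real.exp (τ * L.d)) * (K' * τ * Real.exp (τ * L.d))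
          + (K * τ * Real.exp (τ * L.d)) * (K' * Real.exp (τ * L.d)) := by gcongr
      _ = _ := by ring
  have h3 := h1.trans (add_le_add (mul_le_mul_of_nonneg_right h2 (Real.exp_pos _).le) le_rfl)
  rw [mul_assoc (2 * K * K' * τ), he] at h3
  refine (mul_le_mul_of_nonneg_left h3 (pow_nonneg hτ0 k)).trans (le_of_eq ?_)
  rw [pow_succ]
  ring

end Problem

/-! ### The Wronskian at `π` vanishes -/

/-- The quotient `F = Δ' P / Δ`, where `P` is the polynomial of the exceptional zeros, is a
polynomial in `ρ = √z` if `Δ` and `Δ'` have the same order of growth `g` and `Δ` attains it on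
expanding squares. -/
theorem exists_polynomial_of_quotient {Δ Δ' F : ℂ → ℂ} (hF : Differentiable ℂ F) {Λ : Finset ℕ}
    {lam : ℕ → ℂ} (heq : ∀ z, Δ' z * ∏ n ∈ Λ, (z - lam n) = F z * Δ z) {R : ℕ → ℝ}
    (hR : Tendsto R atTop atTop) {g : ℂ → ℝ} (hg : ∀ ρ, 1 ≤ ‖ρ‖ → 0 < g ρ) {κ K : ℝ} (hκ : 0 < κ)
    (hlow : ∀ᶠ n in atTop, ∀ ρ ∈ squareBoundary (R n), κ * g ρ ≤ ‖Δ (ρ ^ 2)‖)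
    (hup : ∀ ρ, 1 ≤ ‖ρ‖ → ‖Δ' (ρ ^ 2)‖ ≤ K * g ρ) :
    ∃ p : Polynomial ℂ, ∀ ρ, F (ρ ^ 2) = p.eval ρ := by
  obtain ⟨C, hC, hP⟩ := norm_prod_sub_le Λ lam
  have hd : Differentiable ℂ fun ρ => F (ρ ^ 2) := hF.comp (differentiable_id.pow 2)
  refine exists_polynomial_of_norm_le hd hR (K := K * C * 2 ^ (2 * Λ.card) / κ)
    (k := 2 * Λ.card) ?_
  filter_upwards [hlow, hR.eventually_ge_atTop 1] with n hn hR1 ρ hρ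
  have hρ1 : 1 ≤ ‖ρ‖ := hR1.trans (le_norm_of_mem_squareBoundary hρ)
  have hgρ := hg ρ hρ1
  have hK : 0 ≤ K := nonneg_of_mul_nonneg_left ((norm_nonneg _).trans (hup ρ hρ1)) hgρ
  have h1 := congrArg norm (heq (ρ ^ 2))
  rw [norm_mul, norm_mul] at h1
  have h2 : ‖F (ρ ^ 2)‖ * (κ * g ρ) ≤ (K * g ρ) * (C * ‖ρ‖ ^ (2 * Λ.card)) := by
    calc _ ≤ ‖F (ρ ^ 2)‖ * ‖Δ (ρ ^ 2)‖ := by gcongr; exact hn ρ hρ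
      _ = _ := h1.symm
      _ ≤ _ := by
        have h3 := hP (ρ ^ 2) (by rw [norm_pow]; exact one_le_pow₀ hρ1)
        rw [norm_pow, ← pow_mul] at h3
        exact mul_le_mul (hup ρ hρ1) h3 (norm_nonneg _) (by positivity)
  have h4 : ‖F (ρ ^ 2)‖ * κ ≤ K * C * ‖ρ‖ ^ (2 * Λ.card) := by
    refine le_of_mul_le_mul_right ?_ hgρ
    linarith
  have h5 : ‖ρ‖ ^ (2 * Λ.card) ≤ 2 ^ (2 * Λ.card) * R n ^ (2 * Λ.card) := by
    rw [← mul_pow]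
    exact pow_le_pow_left₀ (norm_nonneg _) (norm_le_of_mem_squareBoundary hρ) _
  rw [div_mul_eq_mul_div, le_div_iff₀ hκ]
  refine h4.trans ?_
  rw [mul_assoc (K * C)]
  gcongr

namespace Problem

/-- The Weyl functions `φ'/φ` of the two problems at `π` agree. The quotients `F` of the
characteristic functions are rational functions of `z`, hence so is the quotient of the Wronskian by
`Δ Δ^∞`; its decay on the negative axis is too fast for a nonzero rational function with at most
`[(m + 2) / 2]` poles. -/
theorem wronskian_pi_eq_zero {m : ℤ} (hm : -1 ≤ m) {L L' : Problem} (hH : L.H = L'.H)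
    (hd : L.d = L'.d) (hq : IsSmoothNearPi m L.q) (hq' : IsSmoothNearPi m L'.q)
    (hderiv : ∀ j : ℕ, (j : ℤ) ≤ m → derivAtPi j L.q = derivAtPi j L'.q)
    {lam lamInf lam' lamInf' : ℕ → ℂ} (hlam : L.IsSpectrum lam)
    (hlamInf : L.IsSpectrumInfty lamInf) (hlam' : L'.IsSpectrum lam')
    (hlamInf' : L'.IsSpectrumInfty lamInf') {Λ ΛInf : Finset ℕ}
    (hcard : ((Λ.card + ΛInf.card : ℕ) : ℤ) = (m + 2) / 2)
    (hsub : IsSubsequenceOff Λ lam lam') (hsubInf : IsSubsequenceOff ΛInf lamInf lamInf') (z : ℂ) :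
    (L.phi z).right Real.pi * (L'.phi z).right' Real.pi
      - (L.phi z).right' Real.pi * (L'.phi z).right Real.pi = 0 := by
  obtain ⟨κ, hκ, T, hlow⟩ := L.exists_le_norm_charFun
  obtain ⟨κi, hκi, Ti, hlowi⟩ := L.exists_le_norm_charFunInfty
  obtain ⟨K, hK1, hK⟩ := L'.exists_phiBounds
  have lowI : ∀ᶠ τ : ℝ in atTop, κ * τ * Real.exp (τ * Real.pi)
      ≤ ‖L.charFun ((τ * Complex.I) ^ 2)‖ := by
    filter_upwards [eventually_ge_atTop T, eventually_ge_atTop 0] with τ h1 h2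
    have := hlow (τ * Complex.I) (by rwa [norm_mul_I h2]) (Or.inr (by rwa [abs_im_mul_I h2]))
    rwa [norm_mul_I h2, abs_im_mul_I h2] at this
  have lowiI : ∀ᶠ τ : ℝ in atTop, κi * Real.exp (τ * Real.pi)
      ≤ ‖L.charFunInfty ((τ * Complex.I) ^ 2)‖ := by
    filter_upwards [eventually_ge_atTop Ti, eventually_ge_atTop 0] with τ h1 h2
    have := hlowi (τ * Complex.I) (by rwa [norm_mul_I h2]) (Or.inr (by rwa [abs_im_mul_I h2]))
    rwa [abs_im_mul_I h2] at this
  have hne : ∃ z, L.charFun z ≠ 0 := by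
    obtain ⟨τ, h1, h2⟩ := (lowI.and (eventually_gt_atTop 0)).exists
    exact ⟨_, norm_pos_iff.1 (lt_of_lt_of_le (by positivity) h1)⟩
  have hnei : ∃ z, L.charFunInfty z ≠ 0 := by
    obtain ⟨τ, h1⟩ := lowiI.exists
    exact ⟨_, norm_pos_iff.1 (lt_of_lt_of_le (by positivity) h1)⟩
  obtain ⟨F, hF, hFeq⟩ := exists_quotient_of_isSubsequenceOff L.differentiable_charFun
    L'.differentiable_charFun hlam hlam' (fun z => L.isEigenvalue_of_charFun_eq_zero) hne hsub
  obtain ⟨Fi, hFi, hFieq⟩ := exists_quotient_of_isSubsequenceOff L.differentiable_charFunInfty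
    L'.differentiable_charFunInfty hlamInf hlamInf'
    (fun z => L.isEigenvalueInfty_of_charFunInfty_eq_zero) hnei hsubInf
  have hKr (ρ : ℂ) (hρ : 1 ≤ ‖ρ‖) := (hK ρ hρ).right Real.pi ⟨L'.d_mem.2.le, le_rfl⟩
  obtain ⟨f, hf⟩ := exists_polynomial_of_quotient hF hFeq
    (tendsto_atTop_add_const_right _ _ tendsto_natCast_atTop_atTop)
    (g := fun ρ => ‖ρ‖ * Real.exp (|ρ.im| * Real.pi)) (fun ρ hρ => by positivity) hκ
    (K := K + ‖L'.H‖ * K) (by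
      filter_upwards [eventually_squareBoundary_cos T] with n hn ρ hρ
      have := hlow ρ (hn ρ hρ).1 (hn ρ hρ).2
      linarith) (fun ρ hρ => by
      rw [charFun]
      refine (norm_add_le _ _).trans ?_
      rw [norm_mul]
      have h1 := (hK ρ hρ).right'_pi
      have h2 := mul_le_mul_of_nonneg_left (hKr ρ hρ) (norm_nonneg L'.H)
      have h3 : ‖L'.H‖ * (K * Real.exp (|ρ.im| * Real.pi))
          ≤ ‖L'.H‖ * (K * Real.exp (|ρ.im| * Real.pi)) * ‖ρ‖ :=
        le_mul_of_one_le_right (by positivity) hρ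
      linarith)
  obtain ⟨fi, hfi⟩ := exists_polynomial_of_quotient hFi hFieq
    (tendsto_natCast_atTop_atTop.atTop_mul_const (show 0 < Real.pi / Real.pi by positivity))
    (g := fun ρ => Real.exp (|ρ.im| * Real.pi)) (fun ρ hρ => by positivity) hκi (K := K) (by
      filter_upwards [eventually_squareBoundary_sin Real.pi_pos Ti] with n hn ρ hρ
      exact hlowi ρ (hn ρ hρ).1 (hn ρ hρ).2) (fun ρ hρ => by
      rw [charFunInfty, norm_neg]
      exact hKr ρ hρ)
  set P : ℂ → ℂ := fun z => ∏ n ∈ Λ, (z - lam n) with hP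
  set Pi : ℂ → ℂ := fun z => ∏ n ∈ ΛInf, (z - lamInf n) with hPi
  set W : ℂ → ℂ := fun z => (L.phi z).right Real.pi * (L'.phi z).right' Real.pi
      - (L.phi z).right' Real.pi * (L'.phi z).right Real.pi with hW
  have hWc : Continuous W :=
    ((L.differentiable_phi_pi.1.mul L'.differentiable_phi_pi.2).sub
      (L.differentiable_phi_pi.2.mul L'.differentiable_phi_pi.1)).continuous
  -- `W = Δ Δ'^∞ - Δ^∞ Δ'`, expressed through the quotients `F`, `F^∞`
  have hT (z : ℂ) : (Fi z * P z - F z * Pi z) * (L.charFun z * L.charFunInfty z)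
      = P z * Pi z * W z := by
    have e : W z = L.charFun z * L'.charFunInfty z - L.charFunInfty z * L'.charFun z := by
      simp only [hW, charFun, charFunInfty, hH]; ring
    rw [e]
    linear_combination (L.charFunInfty z * Pi z) * hFeq z - (L.charFun z * P z) * hFieq z
  -- `T(ρ²)` is a polynomial in `ρ` that tends to zero along the imaginary axis
  have hpoly : fi * ∏ n ∈ Λ, (Polynomial.X ^ 2 - Polynomial.C (lam n))
      - f * ∏ n ∈ ΛInf, (Polynomial.X ^ 2 - Polynomial.C (lamInf n)) = 0 := by
    refine polynomial_eq_zero_of_tendsto_zero ?_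
    have heval (ρ : ℂ) : (fi * ∏ n ∈ Λ, (Polynomial.X ^ 2 - Polynomial.C (lam n))
        - f * ∏ n ∈ ΛInf, (Polynomial.X ^ 2 - Polynomial.C (lamInf n))).eval ρ
        = Fi (ρ ^ 2) * P (ρ ^ 2) - F (ρ ^ 2) * Pi (ρ ^ 2) := by
      simp [Polynomial.eval_prod, hf, hfi, hP, hPi]
    simp_rw [heval]
    -- `P P^∞` is `O(τᵏ⁺¹)` at `ρ = iτ`, and `W` is `o(τ⁻ᵏ exp(2τπ))`
    obtain ⟨k, hk⟩ : ∃ k : ℕ, (k : ℤ) = m + 1 := ⟨(m + 1).toNat, Int.toNat_of_nonneg (by lia)⟩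
    have hN : 2 * (Λ.card + ΛInf.card) ≤ k + 1 := by lia
    have hWlim := tendsto_wronskian_pi L L' hd k (fun hk0 ε hε => by
      have hm' : m = ((k - 1 : ℕ) : ℤ) := by lia
      rw [hm'] at hq hq' hderiv
      exact norm_sub_le_of_isSmoothNearPi hq hq' (fun j hj => hderiv j (by exact_mod_cast hj)) hε)
    obtain ⟨C, hC, hCP⟩ := norm_prod_sub_le Λ lam
    obtain ⟨Ci, hCi, hCPi⟩ := norm_prod_sub_le ΛInf lamInf
    have hlim := hWlim.const_mul (C * Ci / (κ * κi))
    rw [mul_zero] at hlim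
    refine squeeze_zero_norm' ?_ hlim
    filter_upwards [lowI, lowiI, eventually_ge_atTop 1] with τ h1 h2 hτ
    have hτ0 : 0 ≤ τ := by linarith
    set ζ := ((τ : ℂ) * Complex.I) ^ 2 with hζ
    have hζn : ‖ζ‖ = τ ^ 2 := by rw [hζ, norm_pow, norm_mul_I hτ0]
    have hζ1 : 1 ≤ ‖ζ‖ := by rw [hζn]; exact one_le_pow₀ hτ
    have h3 := congrArg norm (hT ζ)
    rw [norm_mul, norm_mul, norm_mul, norm_mul] at h3
    have hPP : ‖P ζ‖ * ‖Pi ζ‖ ≤ C * Ci * τ ^ (k + 1) := by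
      calc _ ≤ (C * ‖ζ‖ ^ Λ.card) * (Ci * ‖ζ‖ ^ ΛInf.card) :=
            mul_le_mul (hCP ζ hζ1) (hCPi ζ hζ1) (norm_nonneg _) (by positivity)
        _ = C * Ci * τ ^ (2 * (Λ.card + ΛInf.card)) := by rw [hζn]; ring
        _ ≤ _ := by gcongr
    have he : Real.exp (τ * Real.pi) * Real.exp (τ * Real.pi) * Real.exp (-(2 * τ * Real.pi))
        = 1 := by
      rw [← Real.exp_add, ← Real.exp_add, ← Real.exp_zero]; congr 1; ring
    have h4 : ‖Fi ζ * P ζ - F ζ * Pi ζ‖ * ((κ * τ * Real.exp (τ * Real.pi))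
        * (κi * Real.exp (τ * Real.pi))) ≤ C * Ci * τ ^ (k + 1) * ‖W ζ‖ := by
      calc _ ≤ ‖Fi ζ * P ζ - F ζ * Pi ζ‖ * (‖L.charFun ζ‖ * ‖L.charFunInfty ζ‖) := by gcongr
        _ = _ := h3
        _ ≤ _ := by gcongr
    have h5 := mul_le_mul_of_nonneg_right h4 (Real.exp_pos (-(2 * τ * Real.pi))).le
    have h6 : ‖Fi ζ * P ζ - F ζ * Pi ζ‖ * (κ * κi) * τ
        ≤ C * Ci * (τ ^ k * (‖W ζ‖ * Real.exp (-(2 * τ * Real.pi)))) * τ := by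
      calc _ = ‖Fi ζ * P ζ - F ζ * Pi ζ‖ * ((κ * τ * Real.exp (τ * Real.pi))
            * (κi * Real.exp (τ * Real.pi))) * Real.exp (-(2 * τ * Real.pi)) := by
            linear_combination (-‖Fi ζ * P ζ - F ζ * Pi ζ‖ * κ * κi * τ) * he
        _ ≤ _ := h5
        _ = _ := by ring
    have h7 := le_of_mul_le_mul_right h6 (by linarith)
    rw [div_mul_eq_mul_div, le_div_iff₀ (by positivity)]
    exact h7
  -- hence `W` vanishes off the zeros of `P P^∞`, and everywhere by continuity
  have hPW (z : ℂ) : P z * Pi z * W z = 0 := by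
    obtain ⟨ρ, rfl⟩ := IsAlgClosed.exists_pow_nat_eq z two_pos
    have := congrArg (Polynomial.eval ρ) hpoly
    simp only [Polynomial.eval_sub, Polynomial.eval_mul, Polynomial.eval_prod, Polynomial.eval_pow,
      Polynomial.eval_X, Polynomial.eval_C, ← hf, ← hfi, Polynomial.eval_zero] at this
    rw [← hT, this, zero_mul]
  have hdense : Dense ((↑(Λ.image lam ∪ ΛInf.image lamInf) : Set ℂ)ᶜ) :=
    (Finset.finite_toSet _).countable.dense_compl ℂ
  have := Continuous.ext_on hdense hWc continuous_const (g := fun _ => (0 : ℂ)) fun z hz => by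
    have hz' : ∀ n, (n ∈ Λ → z ≠ lam n) ∧ (n ∈ ΛInf → z ≠ lamInf n) := fun n =>
      ⟨fun hn h => hz (by simpa using Or.inl ⟨n, hn, h.symm⟩),
        fun hn h => hz (by simpa using Or.inr ⟨n, hn, h.symm⟩)⟩
    have h1 : P z ≠ 0 := Finset.prod_ne_zero_iff.2 fun n hn => sub_ne_zero.2 ((hz' n).1 hn)
    have h2 : Pi z ≠ 0 := Finset.prod_ne_zero_iff.2 fun n hn => sub_ne_zero.2 ((hz' n).2 hn)
    exact (mul_eq_zero.1 (hPW z)).resolve_left (mul_ne_zero h1 h2)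
  exact congrFun this z

end Problem

/-! ### From the Wronskian at `π` to the coefficients -/

/-- Decay of `u / v` from `a` to `x`, out of an upper bound at `x` and a lower bound at `a`. -/
theorem norm_le_of_le_exp {K κ t a x : ℝ} {u v : ℂ} (hκ : 0 < κ) (hK : 0 ≤ K)
    (hu : ‖u‖ ≤ K * Real.exp (t * x)) (hv : κ * Real.exp (t * a) ≤ ‖v‖) :
    ‖u‖ ≤ K / κ * Real.exp (-(t * (a - x))) * ‖v‖ := by
  refine hu.trans ?_
  have e : Real.exp (t * x) = Real.exp (-(t * (a - x))) * Real.exp (t * a) := by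
    rw [← Real.exp_add]; congr 1; ring
  calc K * Real.exp (t * x) = K / κ * Real.exp (-(t * (a - x))) * (κ * Real.exp (t * a)) := by
        rw [e]; field_simp
    _ ≤ _ := by gcongr

namespace Problem

variable {L L' : Problem}

/-- If the Weyl functions at `π` agree, then so do the potentials on `[d, π]` and the Weyl functions
at `d + 0`. -/
theorem eq_right_of_wronskian_pi (hd : L.d = L'.d)
    (hW : ∀ z, (L.phi z).right Real.pi * (L'.phi z).right' Real.pi
      = (L.phi z).right' Real.pi * (L'.phi z).right Real.pi) :
    (∀ᵐ x, x ∈ Icc L.d Real.pi → L.q x = L'.q x) ∧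
      ∀ z, (L.phi z).right L.d * (L'.phi z).right' L.d
        = (L.phi z).right' L.d * (L'.phi z).right L.d := by
  obtain ⟨K, hK1, hK⟩ := L.exists_phiBounds
  obtain ⟨K', hK1', hK'⟩ := L'.exists_phiBounds
  obtain ⟨κ, hκ, T, hlow⟩ := L.exists_le_norm_charFunInfty
  obtain ⟨κ', hκ', T', hlow'⟩ := L'.exists_le_norm_charFunInfty
  have hsol' (z : ℂ) := (L'.phi_isSolution z).right
  have hint' := L'.q_integrable_right
  rw [← hd] at hsol' hint'
  have hR : Tendsto (fun n : ℕ => (n : ℝ) * (Real.pi / Real.pi)) atTop atTop :=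
    tendsto_natCast_atTop_atTop.atTop_mul_const (by positivity)
  obtain ⟨h1, h2⟩ := potential_eq_of_weyl_eq_right L.d_mem.2 L.q_integrable_right hint'
    (fun z => (L.phi_isSolution z).right) hsol' hW hR (K := K / κ + K' / κ') (by
      filter_upwards [eventually_squareBoundary_sin Real.pi_pos T,
        eventually_squareBoundary_sin Real.pi_pos T', hR.eventually_ge_atTop 1]
        with n hn hn' h1 ρ hρ x hx
      have hρ1 : 1 ≤ ‖ρ‖ := h1.trans (le_norm_of_mem_squareBoundary hρ)
      have l := hlow ρ (hn ρ hρ).1 (hn ρ hρ).2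
      have l' := hlow' ρ (hn' ρ hρ).1 (hn' ρ hρ).2
      rw [charFunInfty, norm_neg] at l l'
      have b := norm_le_of_le_exp hκ (by linarith) ((hK ρ hρ1).right x hx) l
      have b' := norm_le_of_le_exp hκ' (by linarith) ((hK' ρ hρ1).right x (hd ▸ hx)) l'
      refine ⟨norm_pos_iff.1 (lt_of_lt_of_le (by positivity) l),
        norm_pos_iff.1 (lt_of_lt_of_le (by positivity) l'), b.trans ?_, b'.trans ?_⟩
      · gcongr
        exact le_add_of_nonneg_right (by positivity)
      · gcongr
        exact le_add_of_nonneg_left (by positivity))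
  exact ⟨h1, fun z => h2 z L.d ⟨le_rfl, L.d_mem.2.le⟩⟩

/-- If the Weyl functions at `d - 0` agree, then so do the potentials on `[0, d]` and the boundary
coefficients at `0`. -/
theorem eq_left_of_wronskian_d (hd : L.d = L'.d)
    (hW : ∀ z, (L.phi z).left L.d * (L'.phi z).left' L.d
      = (L.phi z).left' L.d * (L'.phi z).left L.d) :
    (∀ᵐ x, x ∈ Icc 0 L.d → L.q x = L'.q x) ∧ L.h = L'.h := by
  obtain ⟨K, hK1, hK⟩ := L.exists_phiBounds
  obtain ⟨K', hK1', hK'⟩ := L'.exists_phiBounds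
  obtain ⟨κ, hκ, T, hlow⟩ := L.exists_le_norm_left_d
  obtain ⟨κ', hκ', T', hlow'⟩ := L'.exists_le_norm_left_d
  have hd0 := L.d_mem.1
  have hsol' (z : ℂ) := (L'.phi_isSolution z).left
  have hint' := L'.q_integrable_left
  rw [← hd] at hsol' hint' hlow'
  have hR : Tendsto (fun n : ℕ => (n : ℝ) * (Real.pi / L.d)) atTop atTop :=
    tendsto_natCast_atTop_atTop.atTop_mul_const (by positivity)
  obtain ⟨h1, h2⟩ := potential_eq_of_weyl_eq_right hd0 L.q_integrable_left hint'
    (fun z => (L.phi_isSolution z).left) hsol' hW hR (K := K / κ + K' / κ') (by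
      filter_upwards [eventually_squareBoundary_sin hd0 T,
        eventually_squareBoundary_sin hd0 T', hR.eventually_ge_atTop 1]
        with n hn hn' h1 ρ hρ x hx
      have hρ1 : 1 ≤ ‖ρ‖ := h1.trans (le_norm_of_mem_squareBoundary hρ)
      have l := hlow ρ (hn ρ hρ).1 (hn ρ hρ).2
      have l' := hlow' ρ (hn' ρ hρ).1 (hn' ρ hρ).2
      have b := norm_le_of_le_exp hκ (by linarith) ((hK ρ hρ1).left x hx) l
      have b' := norm_le_of_le_exp hκ' (by linarith) ((hK' ρ hρ1).left x (hd ▸ hx)) l'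
      refine ⟨norm_pos_iff.1 (lt_of_lt_of_le (by positivity) l),
        norm_pos_iff.1 (lt_of_lt_of_le (by positivity) l'), b.trans ?_, b'.trans ?_⟩
      · gcongr
        exact le_add_of_nonneg_right (by positivity)
      · gcongr
        exact le_add_of_nonneg_left (by positivity))
  refine ⟨h1, ?_⟩
  -- at `x = 0` the Weyl functions are `h` and `h'`
  have := h2 0 0 ⟨le_rfl, hd0.le⟩
  simpa [phi_left_zero, phi_left'_zero] using this.symm

/-- If the Weyl functions at `d + 0` agree, then so do the transmission coefficients and the Weyl
functions at `d - 0`. The conditions at `d` turn the assumption into a relation between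
`φ' φt`, `φ φt` and the Wronskian at `d - 0`, where `φt` belongs to the second problem. At `z = -τ²`
these are of order `τ exp(2τd)`, `exp(2τd)` and `o(exp(2τd))`, so their coefficients vanish one
after the other. -/
theorem transmission_eq_of_wronskian_d (hd : L.d = L'.d)
    (hW : ∀ z, (L.phi z).right L.d * (L'.phi z).right' L.d
      = (L.phi z).right' L.d * (L'.phi z).right L.d) :
    L.β = L'.β ∧ L.γ = L'.γ ∧ ∀ z, (L.phi z).left L.d * (L'.phi z).left' L.d
      = (L.phi z).left' L.d * (L'.phi z).left L.d := by
  obtain ⟨K, hK1, hK⟩ := L.exists_phiBounds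
  obtain ⟨K', hK1', hK'⟩ := L'.exists_phiBounds
  obtain ⟨κ₁, hκ₁, T₁, hlow₁⟩ := L.exists_le_norm_left_d
  obtain ⟨κ₂, hκ₂, T₂, hlow₂⟩ := L'.exists_le_norm_left_d
  obtain ⟨κ₃, hκ₃, T₃, hlow₃⟩ := L.exists_le_norm_left'_d
  have hlim := tendsto_wronskian_left L L' hd
  have hβ := L.β_pos
  have hβ' := L'.β_pos
  have hβC : (L.β : ℂ) ≠ 0 := Complex.ofReal_ne_zero.2 hβ.ne'
  have hβC' : (L'.β : ℂ) ≠ 0 := Complex.ofReal_ne_zero.2 hβ'.ne'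
  rw [← hd] at hlow₂
  have hd0 := L.d_mem.1.le
  -- the relation at `d - 0`
  have hrel (z : ℂ) : ((L'.β : ℂ) * (L.β : ℂ)⁻¹ - L.β * (L'.β : ℂ)⁻¹)
        * ((L.phi z).left' L.d * (L'.phi z).left L.d)
      = L.β * (L'.β : ℂ)⁻¹ * ((L.phi z).left L.d * (L'.phi z).left' L.d
          - (L.phi z).left' L.d * (L'.phi z).left L.d)
        + (L.β * L'.γ - L.γ * L'.β) * ((L.phi z).left L.d * (L'.phi z).left L.d) := by
    have j := (L.phi_isSolution z).jump
    have j' := (L.phi_isSolution z).jump'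
    have k := (L'.phi_isSolution z).jump
    have k' := (L'.phi_isSolution z).jump'
    rw [← hd] at k k'
    have h := hW z
    rw [j, j', k, k'] at h
    linear_combination -h
  set e : ℝ → ℝ := fun τ => Real.exp (-(2 * τ * L.d)) with he
  have hexp (τ : ℝ) : Real.exp (τ * L.d) * Real.exp (τ * L.d) * e τ = 1 := by
    rw [he]
    simp only
    rw [← Real.exp_add, ← Real.exp_add, ← Real.exp_zero]; congr 1; ring
  -- lower and upper bounds on the imaginary axis
  have hev : ∀ᶠ τ : ℝ in atTop, 0 < τ ∧
      κ₁ * κ₂ ≤ ‖(L.phi ((τ * Complex.I) ^ 2)).left L.d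
        * (L'.phi ((τ * Complex.I) ^ 2)).left L.d‖ * e τ ∧
      ‖(L.phi ((τ * Complex.I) ^ 2)).left L.d * (L'.phi ((τ * Complex.I) ^ 2)).left L.d‖ * e τ
        ≤ K * K' ∧
      κ₃ * κ₂ * τ ≤ ‖(L.phi ((τ * Complex.I) ^ 2)).left' L.d
        * (L'.phi ((τ * Complex.I) ^ 2)).left L.d‖ * e τ := by
    filter_upwards [eventually_ge_atTop T₁, eventually_ge_atTop T₂, eventually_ge_atTop T₃,
      eventually_ge_atTop 1] with τ t1 t2 t3 hτ
    have hτ0 : 0 ≤ τ := by linarith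
    have n := norm_mul_I hτ0
    have i := abs_im_mul_I hτ0
    have l₁ := hlow₁ (τ * Complex.I) (by rwa [n]) (Or.inr (by rwa [i]))
    have l₂ := hlow₂ (τ * Complex.I) (by rwa [n]) (Or.inr (by rwa [i]))
    have l₃ := hlow₃ (τ * Complex.I) (by rwa [n]) (by rwa [i])
    have u₁ := (hK (τ * Complex.I) (by rwa [n])).left L.d ⟨hd0, le_rfl⟩
    have u₂ := (hK' (τ * Complex.I) (by rwa [n])).left L.d (hd ▸ ⟨hd0, le_rfl⟩)
    rw [i] at l₁ l₂ l₃ u₁ u₂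
    rw [n] at l₃
    have e0 : 0 < e τ := Real.exp_pos _
    have hx := hexp τ
    refine ⟨by linarith, ?_, ?_, ?_⟩
    · calc κ₁ * κ₂ = (κ₁ * Real.exp (τ * L.d)) * (κ₂ * Real.exp (τ * L.d)) * e τ := by
            linear_combination (-κ₁ * κ₂) * hx
        _ ≤ _ := by rw [norm_mul]; gcongr
    · calc _ ≤ (K * Real.exp (τ * L.d)) * (K' * Real.exp (τ * L.d)) * e τ := by
            rw [norm_mul]; gcongr
        _ = K * K' := by linear_combination (K * K') * hx
    · calc κ₃ * κ₂ * τ = (κ₃ * τ * Real.exp (τ * L.d)) * (κ₂ * Real.exp (τ * L.d)) * e τ := by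
            linear_combination (-κ₃ * κ₂ * τ) * hx
        _ ≤ _ := by rw [norm_mul]; gcongr
  -- the term with `φ' φt` dominates the others in `hrel`
  have hc : (L'.β : ℂ) * (L.β : ℂ)⁻¹ - L.β * (L'.β : ℂ)⁻¹ = 0 := by
    by_contra hc
    have hcpos := norm_pos_iff.2 hc
    set A := ‖(L.β : ℂ) * (L'.β : ℂ)⁻¹‖
    set B := ‖(L.β : ℂ) * L'.γ - L.γ * L'.β‖
    obtain ⟨τ, ⟨h0, -, h2, h3⟩, h4, h5⟩ := (hev.and ((hlim.eventually
      (gt_mem_nhds one_pos)).and (eventually_gt_atTop ((A + B * (K * K'))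
        / (‖(L'.β : ℂ) * (L.β : ℂ)⁻¹ - L.β * (L'.β : ℂ)⁻¹‖ * (κ₃ * κ₂)))))).exists
    have hn := congrArg norm (hrel ((τ * Complex.I) ^ 2))
    rw [norm_mul] at hn
    have e0 : 0 < e τ := Real.exp_pos _
    have h6 : ‖(L'.β : ℂ) * (L.β : ℂ)⁻¹ - L.β * (L'.β : ℂ)⁻¹‖ * (κ₃ * κ₂ * τ)
        ≤ A + B * (K * K') := by
      refine (mul_le_mul_of_nonneg_left h3 hcpos.le).trans ?_
      rw [← mul_assoc, hn]
      refine (mul_le_mul_of_nonneg_right (norm_add_le _ _) e0.le).trans ?_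
      rw [norm_mul ((L.β : ℂ) * (L'.β : ℂ)⁻¹), norm_mul ((L.β : ℂ) * L'.γ - L.γ * L'.β), add_mul,
        mul_assoc A, mul_assoc B]
      have : 0 ≤ A := norm_nonneg _
      have : 0 ≤ B := norm_nonneg _
      refine add_le_add (mul_le_of_le_one_right ‹0 ≤ A› h4.le) ?_
      exact mul_le_mul_of_nonneg_left h2 ‹0 ≤ B›
    rw [div_lt_iff₀ (by positivity)] at h5
    linarith
  have hββ : L.β = L'.β := by
    have h1 : (L'.β : ℂ) ^ 2 = (L.β : ℂ) ^ 2 := by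
      field_simp at hc
      linear_combination hc
    have h2 : L'.β ^ 2 = L.β ^ 2 := by exact_mod_cast h1
    exact ((sq_eq_sq₀ hβ'.le hβ.le).1 h2).symm
  -- with the first coefficient gone, the term with `φ φt` dominates
  have hγγ : L.γ = L'.γ := by
    by_contra hγ
    have hB : 0 < ‖(L.β : ℂ) * (L'.γ - L.γ)‖ :=
      norm_pos_iff.2 (mul_ne_zero hβC (sub_ne_zero.2 (Ne.symm hγ)))
    obtain ⟨τ, ⟨h0, h1, -, -⟩, h4⟩ := (hev.and (hlim.eventually (gt_mem_nhds
      (show 0 < ‖(L.β : ℂ) * (L'.γ - L.γ)‖ * (κ₁ * κ₂) by positivity)))).exists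
    have h5 := hrel ((τ * Complex.I) ^ 2)
    rw [hc, zero_mul, ← hββ, mul_inv_cancel₀ hβC, one_mul] at h5
    have h6 := congrArg norm (eq_neg_of_add_eq_zero_left h5.symm)
    rw [norm_neg, show (L.β : ℂ) * L'.γ - L.γ * L.β = L.β * (L'.γ - L.γ) by ring, norm_mul] at h6
    rw [h6, mul_assoc] at h4
    exact absurd (mul_le_mul_of_nonneg_left h1 hB.le) (not_le.2 h4)
  refine ⟨hββ, hγγ, fun z => ?_⟩
  have h5 := hrel z
  rw [hc, zero_mul, ← hββ, ← hγγ, mul_inv_cancel₀ hβC, one_mul] at h5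
  linear_combination -h5

end Problem

end SturmLiouville

theorem mainTheorem2 (m : ℤ) (hm : -1 ≤ m) (L L' : SturmLiouville.Problem)
    -- `H` and `d` are fixed
    (hH : L.H = L'.H) (hd : L.d = L'.d)
    -- `q` and `q'` are `C^m` near `π`, with the same derivatives at `π`
    (hq : SturmLiouville.IsSmoothNearPi m L.q) (hq' : SturmLiouville.IsSmoothNearPi m L'.q)
    (hderiv : ∀ j : ℕ, (j : ℤ) ≤ m →
      SturmLiouville.derivAtPi j L.q = SturmLiouville.derivAtPi j L'.q)
    -- the sequences of all eigenvalues
    (lam lamInf lam' lamInf' : ℕ → ℂ)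
    (hlam : L.IsSpectrum lam) (hlamInf : L.IsSpectrumInfty lamInf)
    (hlam' : L'.IsSpectrum lam') (hlamInf' : L'.IsSpectrumInfty lamInf')
    -- the indices of the missing eigenvalues
    (Λ ΛInf : Finset ℕ) (hcard : ((Λ.card + ΛInf.card : ℕ) : ℤ) = (m + 2) / 2)
    -- all other eigenvalues are shared
    (hsub : SturmLiouville.IsSubsequenceOff Λ lam lam')
    (hsubInf : SturmLiouville.IsSubsequenceOff ΛInf lamInf lamInf') :
    L.h = L'.h ∧ L.β = L'.β ∧ L.γ = L'.γ ∧
      ∀ᵐ x ∂(MeasureTheory.volume.restrict (Set.Icc 0 Real.pi)), L.q x = L'.q x := by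
  obtain ⟨hr, hWr⟩ := SturmLiouville.Problem.eq_right_of_wronskian_pi hd fun z =>
    sub_eq_zero.1 (SturmLiouville.Problem.wronskian_pi_eq_zero hm hH hd hq hq' hderiv hlam hlamInf
      hlam' hlamInf' hcard hsub hsubInf z)
  obtain ⟨hβ, hγ, hWl⟩ := SturmLiouville.Problem.transmission_eq_of_wronskian_d hd hWr
  obtain ⟨hl, hh⟩ := SturmLiouville.Problem.eq_left_of_wronskian_d hd hWl
  refine ⟨hh, hβ, hγ, (MeasureTheory.ae_restrict_iff' measurableSet_Icc).2 ?_⟩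
  filter_upwards [hl, hr] with x h1 h2 hx
  rcases le_total x L.d with h | h
  · exact h1 ⟨hx.1, h⟩
  · exact h2 ⟨h, hx.2⟩
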